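/- **Theorem (Kirman–Sondermann theorem for countable societies).** The following statement $\mathrm{KS}$, formalised as a sentence of the two-sorted language of second-order arithmetic ($0,1,+,\times,<,\in$), is provable in $\mathrm{RCA}_0$, the theory given by the axioms of commutative discretely ordered semirings, $\Sigma^0_1$ induction and $\Delta^0_1$ comprehension. *Conventions.* $(m,n)=(m+n)^2+m$ is the pairing function, and $(a,b,c)=(a,(b,c))$. A set $Y\subseteq\mathbb N$ codes the sequence of sets $Y_i=\{v:(i,v)\in Y\}$, $i\in\mathbb N$. Functions are sets of pairs. A finite set $D\subseteq\mathbb N$ is coded by the least number of the form $(k,(m,n))$ such that, for all $i$, $i\in D$ iff $i<k$ and $m(i+1)+1$ divides $n$. A finite sequence $s$ is (the code of) a finite set of pairs that is a function with domain $\{i:i<\mathrm{lh}(s)\}$. For a finite set $X\subseteq\mathbb N$, $W$ is the set of codes of weak orders (transitive, strongly connected relations) on $X$. For $R\in W$, $x\lesssim_R y$ means $(x,y)\in R$, and $x<_R y$ means $x\lesssim_R y$ and not $y\lesssim_R x$. *Countable societies.* A countable society $\mathcal S=\langle V,X,\mathcal A,\mathcal F\rangle$ consists of a nonempty set $V\subseteq\mathbb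 N$, a finite set $X\subseteq\mathbb N$ with $|X|\ge 3$, a sequence $\mathcal A=\langle A_n:n\in\mathbb N\rangle$ of subsets of $V$, and a sequence $\mathcal F=\langle f_i:i\in\mathbb N\rangle$ of functions $f_i:V\to W$, such that: 1. $\mathcal A$ is an atomic algebra: $V$ occurs in $\mathcal A$; unions, intersections and complements relative to $V$ of sets occurring in $\mathcal A$ occur in $\mathcal A$; and $\{v\}$ occurs in $\mathcal A$ for every $v\in V$. 2. (Uniform measurability.) There is a function $\mu:\mathbb N\times X\times X\to\mathbb N$ such that $x\lesssim_{f_n(v)}y\leftrightarrow v\in A_{\mu(n,x,y)}$ for all $n\in\mathbb N$, $x,y\in X$, $v\in V$. 3. (Quasi-partition embedding.) Let $\mathrm{Perm}(W)$ be the set of finite sequences of elements of $W$ in which each element of $W$ occurs exactly once, and let $\mathrm{QPart}(|W|)$ be the set of finite sequences $s$ of natural numbers with $1\le\mathrm{lh}(s)\le|W|$. There is a function $e:\mathrm{Perm}(W)\times\mathrm{QPart}(|W|)\to\mathbb N$ such that for all $p$, $s$ and all $v\in V$: if there is exactly one $i<\mathrm{lh}(s)-1$ with $v\in A_{s(i)}$,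 then $f_{e(p,s)}(v)=p(i)$ for this $i$; otherwise $f_{e(p,s)}(v)=p(\mathrm{lh}(s)-1)$. *Social welfare functions.* A social welfare function for $\mathcal S$ is a function $\sigma:\mathbb N\to W$ satisfying, for all $x,y\in X$ and $i,j\in\mathbb N$: * (Unanimity) if $x<_{f_i(v)}y$ for all $v\in V$, then $x<_{\sigma(i)}y$; * (Independence) if for each $v\in V$ the orders $f_i(v)$ and $f_j(v)$ agree on $\{x,y\}$, then $\sigma(i)$ and $\sigma(j)$ agree on $\{x,y\}$. It is non-dictatorial if for every $v\in V$ there are $i\in\mathbb N$ and $x,y\in X$ with $x<_{f_i(v)}y$ and $y\lesssim_{\sigma(i)}x$; otherwise it is dictatorial. The coalition $A_n$ is $\sigma$-decisive if for all $x,y\in X$ and all $i\in\mathbb N$: if $x<_{f_i(v)}y$ for all $v\in A_n$, then $x<_{\sigma(i)}y$. *Ultrafilters.* A set $\mathcal U\subseteq\mathbb N$ is an ultrafilter on $\mathcal A$ if for all $i,j,k$: if $A_i=V$ then $i\in\mathcal U$; if $A_i=\emptyset$ then $i\notin\mathcal U$; if $i\in\mathcal U$ and $A_i\subseteq A_j$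 then $j\in\mathcal U$; if $i,j\in\mathcal U$ and $A_k=A_i\cap A_j$ then $k\in\mathcal U$; if $A_j=V\setminus A_i$ then $i\in\mathcal U$ or $j\in\mathcal U$. It is principal if there are $k,d$ with $k\in\mathcal U$ and $A_k=\{d\}$. *The statement $\mathrm{KS}$.* For every countable society $\mathcal S=\langle V,X,\mathcal A,\mathcal F\rangle$ and every social welfare function $\sigma$ for $\mathcal S$, the set $$\mathcal U_\sigma=\{i\in\mathbb N: A_i\text{ is }\sigma\text{-decisive}\}$$ exists, it is an ultrafilter on $\mathcal A$, and it is principal if and only if $\sigma$ is dictatorial. -/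

import Mathlib

namespace SOArith

/-! # The two-sorted language of second-order arithmetic

De Bruijn indices are used, separately for number variables and for set variables: a number
quantifier shifts the number variables only, a set quantifier the set variables only. -/

/-- Number terms over `0, 1, +, ×`. -/
inductive Tm : Type
  | var : ℕ → Tm
  | zero : Tm
  | one : Tm
  | add : Tm → Tm → Tm
  | mul : Tm → Tm → Tm

instance : Zero Tm := ⟨Tm.zero⟩
instance : One Tm := ⟨Tm.one⟩
instance : Add Tm := ⟨Tm.add⟩
instance : Mul Tm := ⟨Tm.mul⟩

/-- Formulas. The atomic formulas are `s = t`, `s < t` and `t ∈ X`, where `X` is a set variable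
(given by its index). The primitive logical symbols are `⊥`, `→`, and the universal number and set
quantifiers; the others are the usual classical abbreviations. -/
inductive Form : Type
  | eq : Tm → Tm → Form
  | lt : Tm → Tm → Form
  | mem : Tm → ℕ → Form
  | bot : Form
  | imp : Form → Form → Form
  | all : Form → Form
  | allS : Form → Form

namespace Form

def neg (φ : Form) : Form := imp φ bot
def and (φ ψ : Form) : Form := neg (imp φ (neg ψ))
def or (φ ψ : Form) : Form := imp (neg φ) ψ
def iff (φ ψ : Form) : Form := and (imp φ ψ) (imp ψ φ)
def ex (φ : Form) : Form := neg (all (neg φ))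
def exS (φ : Form) : Form := neg (allS (neg φ))

end Form

infix:50 " ≐ " => Form.eq
infix:50 " ≺ " => Form.lt
infix:50 " ∊ " => Form.mem
prefix:max "∼" => Form.neg
infixr:35 " ⋏ " => Form.and
infixr:30 " ⋎ " => Form.or
infixr:25 " ⟹ " => Form.imp
infix:20 " ⟺ " => Form.iff

/-! ### Substitution -/

/-- Replace the number variable `k` by the term `σ k`. -/
def Tm.subst (σ : ℕ → Tm) : Tm → Tm
  | .var k => σ k
  | .zero => .zero
  | .one => .one
  | .add s t => .add (s.subst σ) (t.subst σ)
  | .mul s t => .mul (s.subst σ) (t.subst σ)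

/-- `t.up k` is `t` read below `k` further number quantifiers. -/
def Tm.up (t : Tm) (k : ℕ) : Tm := t.subst fun i => .var (i + k)

/-- A substitution of number terms, carried below a number quantifier. -/
def underN (σ : ℕ → Tm) : ℕ → Tm
  | 0 => .var 0
  | k + 1 => (σ k).up 1

/-- A renaming of set variables, carried below a set quantifier. -/
def underS (τ : ℕ → ℕ) : ℕ → ℕ
  | 0 => 0
  | k + 1 => τ k + 1

/-- Simultaneous capture-free substitution of number terms and renaming of set variables. -/
def Form.subst : (ℕ → Tm) → (ℕ → ℕ) → Form → Form
  | σ, _, .eq s t => .eq (s.subst σ) (t.subst σ)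
  | σ, _, .lt s t => .lt (s.subst σ) (t.subst σ)
  | σ, τ, .mem t X => .mem (t.subst σ) (τ X)
  | _, _, .bot => .bot
  | σ, τ, .imp φ ψ => .imp (φ.subst σ τ) (ψ.subst σ τ)
  | σ, τ, .all φ => .all (φ.subst (underN σ) τ)
  | σ, τ, .allS φ => .allS (φ.subst σ (underS τ))

/-- `φ` read below one further number quantifier. -/
def Form.upN (φ : Form) : Form := φ.subst (fun k => .var (k + 1)) id

/-- `φ` read below one further set quantifier. -/
def Form.upS (φ : Form) : Form := φ.subst Tm.var (fun k => k + 1)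

/-- The instance `φ(t)` of the matrix of a number quantifier. -/
def Form.instN (φ : Form) (t : Tm) : Form :=
  φ.subst (fun k => Nat.casesOn k t Tm.var) id

/-- The instance `φ(X)` of the matrix of a set quantifier. -/
def Form.instS (φ : Form) (X : ℕ) : Form :=
  φ.subst Tm.var (fun k => Nat.casesOn k X id)

/-! ### Provability -/

/-- Natural deduction for classical two-sorted first-order logic with equality of numbers.
`Deriv Γ φ` says that `φ` is derivable from the finitely many assumptions `Γ`. -/
inductive Deriv : List Form → Form → Prop
  | assumption {Γ : List Form} {φ : Form} : φ ∈ Γ → Deriv Γ φ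
  | impI {Γ : List Form} {φ ψ : Form} : Deriv (φ :: Γ) ψ → Deriv Γ (φ ⟹ ψ)
  | impE {Γ : List Form} {φ ψ : Form} : Deriv Γ (φ ⟹ ψ) → Deriv Γ φ → Deriv Γ ψ
  | raa {Γ : List Form} {φ : Form} : Deriv (∼φ :: Γ) .bot → Deriv Γ φ
  | allI {Γ : List Form} {φ : Form} : Deriv (Γ.map Form.upN) φ → Deriv Γ (.all φ)
  | allE {Γ : List Form} {φ : Form} (t : Tm) : Deriv Γ (.all φ) → Deriv Γ (φ.instN t)
  | allSI {Γ : List Form} {φ : Form} : Deriv (Γ.map Form.upS) φ → Deriv Γ (.allS φ)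
  | allSE {Γ : List Form} {φ : Form} (X : ℕ) : Deriv Γ (.allS φ) → Deriv Γ (φ.instS X)
  | eqRefl {Γ : List Form} (t : Tm) : Deriv Γ (t ≐ t)
  | eqSubst {Γ : List Form} {φ : Form} (s t : Tm) :
      Deriv Γ (s ≐ t) → Deriv Γ (φ.instN s) → Deriv Γ (φ.instN t)

/-- `φ` is provable in the theory `T` (a set of sentences). -/
def Provable (T : Set Form) (φ : Form) : Prop :=
  ∃ Γ : List Form, (∀ ψ ∈ Γ, ψ ∈ T) ∧ Deriv Γ φ

/-! ### The system `RCA₀` -/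

/-- All variables of the term have index `< n`. -/
def Tm.Below (n : ℕ) : Tm → Prop
  | .var k => k < n
  | .zero => True
  | .one => True
  | .add s t => s.Below n ∧ t.Below n
  | .mul s t => s.Below n ∧ t.Below n

/-- All free number variables have index `< n` and all free set variables have index `< m`. -/
def Form.Below : ℕ → ℕ → Form → Prop
  | n, _, .eq s t => s.Below n ∧ t.Below n
  | n, _, .lt s t => s.Below n ∧ t.Below n
  | n, m, .mem t X => t.Below n ∧ X < m
  | _, _, .bot => True
  | n, m, .imp φ ψ => φ.Below n m ∧ ψ.Below n m
  | n, m, .all φ => φ.Below (n + 1) m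
  | n, m, .allS φ => φ.Below n (m + 1)

/-- The block `∀x₁ … ∀xₖ` of number quantifiers. -/
def alls (k : ℕ) (φ : Form) : Form := Form.all^[k] φ

/-- The block `∃x₁ … ∃xₖ` of number quantifiers. -/
def exs (k : ℕ) (φ : Form) : Form := Form.ex^[k] φ

/-- The block `∀X₁ … ∀Xₖ` of set quantifiers. -/
def allSs (k : ℕ) (φ : Form) : Form := Form.allS^[k] φ

/-- The formulas with only bounded quantifiers. -/
inductive IsBounded : Form → Prop
  | eq (s t : Tm) : IsBounded (s ≐ t)
  | lt (s t : Tm) : IsBounded (s ≺ t)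
  | mem (t : Tm) (X : ℕ) : IsBounded (t ∊ X)
  | bot : IsBounded .bot
  | imp {φ ψ : Form} : IsBounded φ → IsBounded ψ → IsBounded (φ ⟹ ψ)
  | ball (t : Tm) {φ : Form} : IsBounded φ → IsBounded (.all (.var 0 ≺ t.up 1 ⟹ φ))
  | bex (t : Tm) {φ : Form} : IsBounded φ → IsBounded (.ex (.var 0 ≺ t.up 1 ⋏ φ))

/-- `Σ⁰₁` formulas: `∃k θ` with `θ` bounded. -/
def IsSigma1 (φ : Form) : Prop := ∃ θ, IsBounded θ ∧ φ = .ex θ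

/-- `Π⁰₁` formulas: `∀k θ` with `θ` bounded. -/
def IsPi1 (φ : Form) : Prop := ∃ θ, IsBounded θ ∧ φ = .all θ

abbrev x0 : Tm := .var 0
abbrev x1 : Tm := .var 1
abbrev x2 : Tm := .var 2
abbrev x3 : Tm := .var 3
abbrev x4 : Tm := .var 4

/-- `s ≤ t`. -/
def le (s t : Tm) : Form := s ≺ t ⋎ s ≐ t

/-- The axioms of commutative discretely ordered semirings (with free variables `x0, x1, x2`). -/
inductive IsBasic : Form → Prop
  | add_assoc : IsBasic ((x0 + x1) + x2 ≐ x0 + (x1 + x2))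
  | add_comm : IsBasic (x0 + x1 ≐ x1 + x0)
  | mul_assoc : IsBasic ((x0 * x1) * x2 ≐ x0 * (x1 * x2))
  | mul_comm : IsBasic (x0 * x1 ≐ x1 * x0)
  | distrib : IsBasic (x0 * (x1 + x2) ≐ x0 * x1 + x0 * x2)
  | add_zero : IsBasic (x0 + 0 ≐ x0)
  | mul_zero : IsBasic (x0 * 0 ≐ 0)
  | mul_one : IsBasic (x0 * 1 ≐ x0)
  | lt_trans : IsBasic (x0 ≺ x1 ⋏ x1 ≺ x2 ⟹ x0 ≺ x2)
  | lt_irrefl : IsBasic ∼(x0 ≺ x0)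
  | lt_total : IsBasic (x0 ≺ x1 ⋎ x0 ≐ x1 ⋎ x1 ≺ x0)
  | add_lt : IsBasic (x0 ≺ x1 ⟹ x0 + x2 ≺ x1 + x2)
  | mul_lt : IsBasic (0 ≺ x2 ⋏ x0 ≺ x1 ⟹ x0 * x2 ≺ x1 * x2)
  | lt_sub : IsBasic (x0 ≺ x1 ⟹ .ex (x1 + x0 ≐ x2))
  | zero_lt_one : IsBasic (0 ≺ 1)
  | discrete : IsBasic (0 ≺ x0 ⟹ le 1 x0)
  | nonneg : IsBasic (le 0 x0)

/-- `(φ(0) ∧ ∀n (φ(n) → φ(n+1))) → ∀n φ(n)`, where the variable `n` of `φ` is `x0`. -/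
def inductionAx (φ : Form) : Form :=
  φ.instN 0 ⋏ .all (φ ⟹ φ.subst (fun k => Nat.casesOn k (x0 + 1) (fun i => .var (i + 1))) id)
    ⟹ .all φ

/-- `∀n (φ(n) ↔ ψ(n)) → ∃X ∀n (n ∈ X ↔ φ(n))`, where the variable `n` of `φ`, `ψ` is `x0` and `X`
is not free in `φ`. -/
def comprehensionAx (φ ψ : Form) : Form :=
  .all (φ ⟺ ψ) ⟹ .exS (.all (x0 ∊ 0 ⟺ φ.upS))

/-- The axioms of `RCA₀` before universal closure. -/
inductive IsAxiom : Form → Prop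
  | basic {φ : Form} : IsBasic φ → IsAxiom φ
  | induction {φ : Form} : IsSigma1 φ → IsAxiom (inductionAx φ)
  | comprehension {φ ψ : Form} : IsSigma1 φ → IsPi1 ψ → IsAxiom (comprehensionAx φ ψ)

/-- The theory `RCA₀`: all universal closures of the axioms. -/
def RCA0 : Set Form :=
  {χ | ∃ φ n m, IsAxiom φ ∧ φ.Below n m ∧ χ = allSs m (alls n φ)}

/-! # Coding in second-order arithmetic

From here on the definitions are abbreviations for formulas of the language. Number arguments are
terms, and set arguments are (indices of) set variables. Below a block of `k` number quantifiers the
new variables are `x(k-1), …, x0`, in the order in which they are quantified, and a term argument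
`t` of the definition is written `t.up k`. -/

/-- The pairing function `(a, b) = (a + b)² + a`. -/
def pair (a b : Tm) : Tm := (a + b) * (a + b) + a

/-- `(a, b, c) = (a, (b, c))`. -/
def triple (a b c : Tm) : Tm := pair a (pair b c)

/-- `s` divides `t`. -/
def dvd (s t : Tm) : Form := .ex (s.up 1 * x0 ≐ t.up 1)

/-- `c` is of the form `(k, m, n)`. -/
def isTriple (c : Tm) : Form := exs 3 (c.up 3 ≐ triple x2 x1 x0)

/-- `i` belongs to the finite set represented by `c = (k, m, n)`, which is
`{i < k : m(i+1)+1 divides n}`. -/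
def fmem (i c : Tm) : Form :=
  exs 3 (c.up 3 ≐ triple x2 x1 x0 ⋏ i.up 3 ≺ x2 ⋏ dvd (x1 * (i.up 3 + 1) + 1) x0)

/-- `c` is the code of a finite set: the least number that represents it. -/
def isCode (c : Tm) : Form :=
  isTriple c ⋏
    ∼(.ex (x0 ≺ c.up 1 ⋏ isTriple x0 ⋏ .all (fmem x0 x1 ⟺ fmem x0 (c.up 2))))

/-- `s ∈ Seq` and `lh(s) = l`: `s` is the code of a finite set of pairs which is a function with
domain `{i : i < l}`. -/
def isSeq (s l : Tm) : Form :=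
  isCode s ⋏
  .all (fmem x0 (s.up 1) ⟹ exs 2 (x2 ≐ pair x1 x0 ⋏ x1 ≺ l.up 3)) ⋏
  .all (x0 ≺ l.up 1 ⟹
    .ex (fmem (pair x1 x0) (s.up 2) ⋏ .all (fmem (pair x2 x0) (s.up 3) ⟹ x0 ≐ x1)))

/-- `s(i) = y`, for a finite sequence `s`. -/
def seqVal (s i y : Tm) : Form := fmem (pair i y) s

/-- `x ≲_r y`, for the code `r` of a binary relation. -/
def rel (r x y : Tm) : Form := fmem (pair x y) r

/-- `r ∈ W`: `r` is the code of a weak order (a transitive and strongly connected relation) on the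
set `X`. -/
def isWO (X : ℕ) (r : Tm) : Form :=
  isCode r ⋏
  .all (fmem x0 (r.up 1) ⟹ exs 2 (x2 ≐ pair x1 x0 ⋏ x1 ∊ X ⋏ x0 ∊ X)) ⋏
  alls 2 (x1 ∊ X ⋏ x0 ∊ X ⟹ rel (r.up 2) x1 x0 ⋎ rel (r.up 2) x0 x1) ⋏
  alls 3 (rel (r.up 3) x2 x1 ⋏ rel (r.up 3) x1 x0 ⟹ rel (r.up 3) x2 x0)

/-! # Countable societies -/

/-- `v ∈ A_n`, for a sequence of sets `A`. -/
def inA (A : ℕ) (n v : Tm) : Form := pair n v ∊ A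

/-- `A_k = V`. -/
def eqV (V A : ℕ) (k : Tm) : Form := .all (inA A (k.up 1) x0 ⟺ x0 ∊ V)

/-- `A_k = ∅`. -/
def eqEmpty (A : ℕ) (k : Tm) : Form := .all ∼(inA A (k.up 1) x0)

/-- `A_k = {d}`. -/
def eqSingleton (A : ℕ) (k d : Tm) : Form := .all (inA A (k.up 1) x0 ⟺ x0 ≐ d.up 1)

/-- `A_k = A_i ∪ A_j`. -/
def eqUnion (A : ℕ) (k i j : Tm) : Form :=
  .all (inA A (k.up 1) x0 ⟺ (inA A (i.up 1) x0 ⋎ inA A (j.up 1) x0))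

/-- `A_k = A_i ∩ A_j`. -/
def eqInter (A : ℕ) (k i j : Tm) : Form :=
  .all (inA A (k.up 1) x0 ⟺ (inA A (i.up 1) x0 ⋏ inA A (j.up 1) x0))

/-- `A_k = V \ A_i`. -/
def eqCompl (V A : ℕ) (k i : Tm) : Form :=
  .all (inA A (k.up 1) x0 ⟺ (x0 ∊ V ⋏ ∼(inA A (i.up 1) x0)))

/-- `A_i ⊆ A_j`. -/
def subA (A : ℕ) (i j : Tm) : Form := .all (inA A (i.up 1) x0 ⟹ inA A (j.up 1) x0)

/-- `A` is an atomic countable algebra over `V`. -/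
def isAtomicAlgebra (V A : ℕ) : Form :=
  alls 2 (inA A x1 x0 ⟹ x0 ∊ V) ⋏
  .ex (eqV V A x0) ⋏
  alls 2 (.ex (eqUnion A x0 x2 x1)) ⋏
  alls 2 (.ex (eqInter A x0 x2 x1)) ⋏
  .all (.ex (eqCompl V A x0 x1)) ⋏
  .all (x0 ∊ V ⟹ .ex (eqSingleton A x0 x1))

/-- `F` is a sequence of profiles over `V`, `X`: every `f_i = {u : (i, u) ∈ F}` is a function
from `V` to `W`. -/
def isProfileSeq (V X F : ℕ) : Form :=
  alls 2 (pair x1 x0 ∊ F ⟹ exs 2 (x2 ≐ pair x1 x0 ⋏ x1 ∊ V ⋏ isWO X x0)) ⋏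
  alls 2 (x0 ∊ V ⟹ .ex (triple x2 x1 x0 ∊ F ⋏ .all (triple x3 x2 x0 ∊ F ⟹ x0 ≐ x1)))

/-- `x ≲_{i(v)} y`: the voter `v` ranks `x` weakly below `y` under the profile `f_i`. -/
def pref (F : ℕ) (i v x y : Tm) : Form :=
  .ex (triple (i.up 1) (v.up 1) x0 ∊ F ⋏ rel x0 (x.up 1) (y.up 1))

/-- `x <_{i(v)} y`. -/
def spref (F : ℕ) (i v x y : Tm) : Form := pref F i v x y ⋏ ∼(pref F i v y x)

/-- `x <_{i[A_n]} y`. -/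
def sprefOn (A F : ℕ) (i n x y : Tm) : Form :=
  .all (inA A (n.up 1) x0 ⟹ spref F (i.up 1) x0 (x.up 1) (y.up 1))

/-- `F` is uniformly `A`-measurable. The set variable `0` below the quantifier is the function
`μ : ℕ × X × X → ℕ`. -/
def isUniformlyMeasurable (V X A F : ℕ) : Form :=
  .exS (
    .all (x0 ∊ 0 ⟹ exs 4 (x4 ≐ pair (triple x3 x2 x1) x0 ⋏ x2 ∊ (X + 1) ⋏ x1 ∊ (X + 1))) ⋏
    alls 3 (x1 ∊ (X + 1) ⋏ x0 ∊ (X + 1) ⟹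
      .ex (pair (triple x3 x2 x1) x0 ∊ 0 ⋏
        .all (pair (triple x4 x3 x2) x0 ∊ 0 ⟹ x0 ≐ x1) ⋏
        .all (x0 ∊ (V + 1) ⟹ (pref (F + 1) x4 x0 x3 x2 ⟺ inA (A + 1) x1 x0)))))

/-- `p ∈ Perm(W)` and `lh(p) = l`: `p` is a finite sequence of elements of `W` in which every
element of `W` occurs exactly once. (So `l = |W|`.) -/
def isPerm (X : ℕ) (p l : Tm) : Form :=
  isSeq p l ⋏
  alls 2 (seqVal (p.up 2) x1 x0 ⟹ isWO X x0) ⋏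
  .all (isWO X x0 ⟹
    .ex (seqVal (p.up 2) x0 x1 ⋏ .all (seqVal (p.up 3) x0 x2 ⟹ x0 ≐ x1)))

/-- `s ∈ QPart(l)` and `lh(s) = k`. -/
def isQPart (s k l : Tm) : Form := isSeq s k ⋏ le 1 k ⋏ le k l

/-- `i < lh(s) - 1` and `v ∈ A_{s(i)}`, where `k = lh(s)`. -/
def inPart (A : ℕ) (s k i v : Tm) : Form :=
  i + 1 ≺ k ⋏ .ex (seqVal (s.up 1) (i.up 1) x0 ⋏ inA A x0 (v.up 1))

/-- `i` is the only index such that `i < lh(s) - 1` and `v ∈ A_{s(i)}`, where `k = lh(s)`. -/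
def onlyPart (A : ℕ) (s k i v : Tm) : Form :=
  inPart A s k i v ⋏ .all (inPart A (s.up 1) (k.up 1) x0 (v.up 1) ⟹ x0 ≐ i.up 1)

/-- `f_n(v)` is `p(i)` if `i` is the only index `< lh(s) - 1` with `v ∈ A_{s(i)}`, and it is
`p(lh(s) - 1)` if there is no such only index; here `k = lh(s)`. -/
def isMixedAt (A F : ℕ) (p s k n v : Tm) : Form :=
  .all (onlyPart A (s.up 1) (k.up 1) x0 (v.up 1) ⟹
    .ex (seqVal (p.up 2) x1 x0 ⋏ triple (n.up 2) (v.up 2) x0 ∊ F)) ⋏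
  (∼(.ex (onlyPart A (s.up 1) (k.up 1) x0 (v.up 1))) ⟹
    exs 2 (x1 + 1 ≐ k.up 2 ⋏ seqVal (p.up 2) x1 x0 ⋏ triple (n.up 2) (v.up 2) x0 ∊ F))

/-- `A` is quasi-partition embedded into `F`. The set variable `0` below the quantifier is the
function `e : Perm(W) × QPart(|W|) → ℕ`. In the second conjunct the variables are
`p = x3`, `|W| = x2`, `s = x1`, `lh(s) = x0`. -/
def isQPEmbedded (V X A F : ℕ) : Form :=
  .exS (
    .all (x0 ∊ 0 ⟹ exs 3 (x3 ≐ pair (pair x2 x1) x0 ⋏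
      exs 2 (isPerm (X + 1) x4 x1 ⋏ isQPart x3 x0 x1))) ⋏
    alls 4 (isPerm (X + 1) x3 x2 ⋏ isQPart x1 x0 x2 ⟹
      .ex (pair (pair x4 x2) x0 ∊ 0 ⋏
        .all (pair (pair (x4.up 1) x3) x0 ∊ 0 ⟹ x0 ≐ x1) ⋏
        .all (x0 ∊ (V + 1) ⟹ isMixedAt (A + 1) (F + 1) (x4.up 1) x3 x2 x1 x0))))

/-- `⟨V, X, A, F⟩` is a countable society. -/
def isSociety (V X A F : ℕ) : Form :=
  .ex (x0 ∊ V) ⋏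
  .ex (.all (x0 ∊ X ⟹ x0 ≺ x1)) ⋏
  exs 3 (x2 ∊ X ⋏ x1 ∊ X ⋏ x0 ∊ X ⋏ ∼(x2 ≐ x1) ⋏ ∼(x2 ≐ x0) ⋏ ∼(x1 ≐ x0)) ⋏
  isAtomicAlgebra V A ⋏
  isProfileSeq V X F ⋏
  isUniformlyMeasurable V X A F ⋏
  isQPEmbedded V X A F

/-! # Social welfare functions -/

/-- `x ≲_{σ(i)} y`, where the set variable `S` is the function `σ`. -/
def soc (S : ℕ) (i x y : Tm) : Form := .ex (pair (i.up 1) x0 ∊ S ⋏ rel x0 (x.up 1) (y.up 1))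

/-- `x <_{σ(i)} y`. -/
def ssoc (S : ℕ) (i x y : Tm) : Form := soc S i x y ⋏ ∼(soc S i y x)

/-- `f_i = f_j` on `{x, y}`. -/
def profilesAgreeOn (V F : ℕ) (i j x y : Tm) : Form :=
  alls 3 (x2 ∊ V ⋏ (x1 ≐ x.up 3 ⋎ x1 ≐ y.up 3) ⋏ (x0 ≐ x.up 3 ⋎ x0 ≐ y.up 3) ⟹
    (pref F (i.up 3) x2 x1 x0 ⟺ pref F (j.up 3) x2 x1 x0))

/-- `σ(i) = σ(j)` on `{x, y}`. -/
def socAgreeOn (S : ℕ) (i j x y : Tm) : Form :=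
  alls 2 ((x1 ≐ x.up 2 ⋎ x1 ≐ y.up 2) ⋏ (x0 ≐ x.up 2 ⋎ x0 ≐ y.up 2) ⟹
    (soc S (i.up 2) x1 x0 ⟺ soc S (j.up 2) x1 x0))

/-- `S` is a function `σ : ℕ → W`. -/
def isFunToW (X S : ℕ) : Form :=
  .all (x0 ∊ S ⟹ exs 2 (x2 ≐ pair x1 x0 ⋏ isWO X x0)) ⋏
  .all (.ex (pair x1 x0 ∊ S ⋏ .all (pair x2 x0 ∊ S ⟹ x0 ≐ x1)))

/-- Unanimity, with `x = x2`, `y = x1`, `i = x0`. -/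
def unanimity (V X F S : ℕ) : Form :=
  alls 3 (x2 ∊ X ⋏ x1 ∊ X ⋏ .all (x0 ∊ V ⟹ spref F x1 x0 x3 x2) ⟹ ssoc S x0 x2 x1)

/-- Independence, with `x = x3`, `y = x2`, `i = x1`, `j = x0`. -/
def independence (V X F S : ℕ) : Form :=
  alls 4 (x3 ∊ X ⋏ x2 ∊ X ⋏ profilesAgreeOn V F x1 x0 x3 x2 ⟹ socAgreeOn S x1 x0 x3 x2)

/-- `σ` is a social welfare function for `⟨V, X, A, F⟩`. -/
def isSWF (V X F S : ℕ) : Form :=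
  isFunToW X S ⋏ unanimity V X F S ⋏ independence V X F S

/-- Non-dictatoriality: for every `v ∈ V` there are `i = x2` and `x = x1`, `y = x0` in `X` with
`x <_{i(v)} y` and `y ≲_{σ(i)} x`. -/
def nonDictatorial (V X F S : ℕ) : Form :=
  .all (x0 ∊ V ⟹ exs 3 (x1 ∊ X ⋏ x0 ∊ X ⋏ spref F x2 x3 x1 x0 ⋏ soc S x2 x0 x1))

/-- `σ` is dictatorial. -/
def dictatorial (V X F S : ℕ) : Form := ∼(nonDictatorial V X F S)

/-- `A_n` is `σ`-decisive; here `x = x2`, `y = x1`, `i = x0`. -/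
def decisive (X A F S : ℕ) (n : Tm) : Form :=
  alls 3 (x2 ∊ X ⋏ x1 ∊ X ⋏ sprefOn A F x0 (n.up 3) x2 x1 ⟹ ssoc S x0 x2 x1)

/-- `U` is an ultrafilter on the algebra `A` over `V`. -/
def isUltrafilter (V A U : ℕ) : Form :=
  .all (eqV V A x0 ⟹ x0 ∊ U) ⋏
  .all (eqEmpty A x0 ⟹ ∼(x0 ∊ U)) ⋏
  alls 2 (x1 ∊ U ⋏ subA A x1 x0 ⟹ x0 ∊ U) ⋏
  alls 3 (x2 ∊ U ⋏ x1 ∊ U ⋏ eqInter A x0 x2 x1 ⟹ x0 ∊ U) ⋏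
  alls 2 (eqCompl V A x0 x1 ⟹ x1 ∊ U ⋎ x0 ∊ U)

/-- The ultrafilter `U` is principal. -/
def isPrincipal (A U : ℕ) : Form := exs 2 (x1 ∊ U ⋏ eqSingleton A x1 x0)

/-- The Kirman–Sondermann theorem for countable societies, as a sentence. The universally
quantified set variables are, in this order, `V, X, A, F, σ`, with indices `4, 3, 2, 1, 0`; below
`∃U` they have the indices `5, 4, 3, 2, 1`, and `U` has index `0`. -/
def KS : Form :=
  allSs 5 (isSociety 4 3 2 1 ⋏ isSWF 4 3 1 0 ⟹
    .exS (.all (x0 ∊ 0 ⟺ decisive 4 3 2 1 x0) ⋏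
      isUltrafilter 5 3 0 ⋏
      (isPrincipal 3 0 ⟺ dictatorial 5 4 2 1)))

end SOArith

/-!
The proof has two halves. By Gödel's completeness theorem for the two-sorted calculus `Deriv`
(`provable_of_sat`, a Henkin construction in which the free variables serve as witnesses), it
suffices to show that `KS` is true in every model `(M, S)` of `RCA₀`, where `M` is a discretely
ordered semiring, possibly nonstandard, and `S` its collection of sets (`provable_RCA0_of_models`).
Inside a model the argument is ordinary mathematics, subject to the restriction that induction and
comprehension are only available for predicates `Rec S P` that are sets of the model.

*Arithmetic.* Bounded sets have codes (`exists_code_le`): if `m` is a common multiple of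
`1, …, K`, the numbers `m (i + 1) + 1` with `i < K` are pairwise coprime, and the least positive
common multiple `n` of those with `i ∈ D` represents `D`. All these codes lie below a bound that
depends only on `K`, so there are boundedly many weak orders on the finite set `X`, and by `Σ⁰₁`
induction any finite list of distinct weak orders extends to an enumeration of all of them
(`exists_isPerm`). With the quasi-partition embedding this gives, for three disjoint coalitions and
four different orders, a profile in which the coalitions and the remaining voters hold these orders
(`IsSociety.exists_profile`).

*Social choice.* Such profiles suffice for the classical argument of Arrow, Kirman and Sondermann.
A coalition that prevails against unanimous opposition on a single pair of alternatives is decisive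
(`AlmostDecisive.decisive`, from `AlmostDecisive.expand_right` and `AlmostDecisive.expand_left`).
The closure of the decisive coalitions under intersection and the fact that one of two complementary
coalitions is decisive follow by evaluating one suitable profile each (`Decisive.inter`,
`decisive_or_decisive_compl`).

*Comprehension.* Since decisiveness can be tested on one pair of alternatives and one profile, and
that profile is obtained from the coalition by the embedding function, decisiveness is a `Δ⁰₁`
condition relative to the embedding and `σ`, and so the set of decisive coalitions exists
(`exists_set_decisive`).
-/

set_option linter.unusedSectionVars false

namespace SOArith

/-! ### Substitution and free variables -/

/-- The assignment `x, v 0, v 1, …`. -/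
def vcons {α : Type} (x : α) (v : ℕ → α) : ℕ → α
  | 0 => x
  | k + 1 => v k

@[simp] theorem vcons_zero {α : Type} (x : α) (v : ℕ → α) : vcons x v 0 = x := rfl
@[simp] theorem vcons_succ {α : Type} (x : α) (v : ℕ → α) (k : ℕ) : vcons x v (k + 1) = v k := rfl

theorem vcons_eq_casesOn {α : Type} (x : α) (v : ℕ → α) :
    (fun k => Nat.casesOn k x v) = vcons x v := by
  funext k
  cases k <;> rfl

theorem map_vcons {α β : Type} (f : α → β) (x : α) (v : ℕ → α) :
    (fun k => f (vcons x v k)) = vcons (f x) fun k => f (v k) := by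
  funext k
  cases k <;> rfl

theorem Form.instN_eq (φ : Form) (t : Tm) : φ.instN t = φ.subst (vcons t Tm.var) id :=
  congrArg (φ.subst · id) (vcons_eq_casesOn t Tm.var)

theorem Form.instS_eq (φ : Form) (X : ℕ) : φ.instS X = φ.subst Tm.var (vcons X id) :=
  congrArg (φ.subst Tm.var ·) (vcons_eq_casesOn X id)

theorem Tm.subst_subst (t : Tm) (σ σ' : ℕ → Tm) :
    (t.subst σ).subst σ' = t.subst fun k => (σ k).subst σ' := by
  induction t <;> simp_all [Tm.subst]

theorem Tm.subst_var (t : Tm) : t.subst Tm.var = t := by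
  induction t <;> simp_all [Tm.subst]

theorem Tm.subst_congr {n : ℕ} {t : Tm} {σ σ' : ℕ → Tm} (ht : t.Below n)
    (h : ∀ k < n, σ k = σ' k) : t.subst σ = t.subst σ' := by
  induction t <;> simp_all [Tm.subst, Tm.Below]

theorem underN_subst (σ σ' : ℕ → Tm) :
    (fun k => (underN σ k).subst (underN σ')) = underN fun k => (σ k).subst σ' := by
  funext k
  cases k with
  | zero => rfl
  | succ k => simp [underN, Tm.up, Tm.subst_subst, Tm.subst]

theorem underN_var : underN Tm.var = Tm.var := by
  funext k
  cases k <;> rfl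

theorem underS_comp (τ τ' : ℕ → ℕ) : underS τ' ∘ underS τ = underS (τ' ∘ τ) := by
  funext k
  cases k <;> rfl

theorem underS_id : underS id = id := by
  funext k
  cases k <;> rfl

theorem Form.subst_subst (φ : Form) (σ σ' : ℕ → Tm) (τ τ' : ℕ → ℕ) :
    (φ.subst σ τ).subst σ' τ' = φ.subst (fun k => (σ k).subst σ') (τ' ∘ τ) := by
  induction φ generalizing σ σ' τ τ' <;>
    simp_all [Form.subst, Tm.subst_subst, underN_subst, underS_comp]

theorem Form.subst_id (φ : Form) : φ.subst Tm.var id = φ := by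
  induction φ <;> simp_all [Form.subst, Tm.subst_var, underN_var, underS_id]

theorem Form.subst_congr {n m : ℕ} {φ : Form} {σ σ' : ℕ → Tm} {τ τ' : ℕ → ℕ}
    (hφ : φ.Below n m) (hσ : ∀ k < n, σ k = σ' k) (hτ : ∀ k < m, τ k = τ' k) :
    φ.subst σ τ = φ.subst σ' τ' := by
  induction φ generalizing n m σ σ' τ τ' with
  | eq s t => simp [Form.subst, Tm.subst_congr hφ.1 hσ, Tm.subst_congr hφ.2 hσ]
  | lt s t => simp [Form.subst, Tm.subst_congr hφ.1 hσ, Tm.subst_congr hφ.2 hσ]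
  | mem t X => simp [Form.subst, Tm.subst_congr hφ.1 hσ, hτ X hφ.2]
  | bot => rfl
  | imp φ ψ h₁ h₂ => simp [Form.subst, h₁ hφ.1 hσ hτ, h₂ hφ.2 hσ hτ]
  | all φ h =>
    simp only [Form.subst, Form.all.injEq]
    refine h hφ (fun k hk => ?_) hτ
    cases k with
    | zero => rfl
    | succ k => simp [underN, hσ k (by omega)]
  | allS φ h =>
    simp only [Form.subst, Form.allS.injEq]
    refine h hφ hσ (fun k hk => ?_)
    cases k with
    | zero => rfl
    | succ k => simp [underS, hτ k (by omega)]

theorem Form.subst_eq_self {n m : ℕ} {φ : Form} {σ : ℕ → Tm} {τ : ℕ → ℕ}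
    (hφ : φ.Below n m) (hσ : ∀ k < n, σ k = .var k) (hτ : ∀ k < m, τ k = k) :
    φ.subst σ τ = φ :=
  (Form.subst_congr hφ hσ hτ).trans φ.subst_id

theorem Tm.Below.mono {n n' : ℕ} (h : n ≤ n') {t : Tm} (ht : t.Below n) : t.Below n' := by
  induction t <;> simp_all [Tm.Below]
  omega

theorem Form.Below.mono {n n' m m' : ℕ} (h : n ≤ n') (h' : m ≤ m') {φ : Form}
    (hφ : φ.Below n m) : φ.Below n' m' := by
  induction φ generalizing n n' m m' with
  | eq s t => exact ⟨hφ.1.mono h, hφ.2.mono h⟩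
  | lt s t => exact ⟨hφ.1.mono h, hφ.2.mono h⟩
  | mem t X => exact ⟨hφ.1.mono h, hφ.2.trans_le h'⟩
  | bot => trivial
  | imp φ ψ h₁ h₂ => exact ⟨h₁ h h' hφ.1, h₂ h h' hφ.2⟩
  | all φ ih => exact ih (Nat.succ_le_succ h) h' hφ
  | allS φ ih => exact ih h (Nat.succ_le_succ h') hφ

theorem Tm.exists_below (t : Tm) : ∃ n, t.Below n := by
  induction t with
  | var k => exact ⟨k + 1, Nat.lt_succ_self k⟩
  | zero => exact ⟨0, trivial⟩
  | one => exact ⟨0, trivial⟩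
  | add s t hs ht =>
    obtain ⟨a, ha⟩ := hs
    obtain ⟨b, hb⟩ := ht
    exact ⟨max a b, ha.mono (le_max_left a b), hb.mono (le_max_right a b)⟩
  | mul s t hs ht =>
    obtain ⟨a, ha⟩ := hs
    obtain ⟨b, hb⟩ := ht
    exact ⟨max a b, ha.mono (le_max_left a b), hb.mono (le_max_right a b)⟩

theorem Form.exists_below (φ : Form) : ∃ n m, φ.Below n m := by
  induction φ with
  | eq s t =>
    obtain ⟨a, ha⟩ := s.exists_below
    obtain ⟨b, hb⟩ := t.exists_below
    exact ⟨max a b, 0, ha.mono (le_max_left a b), hb.mono (le_max_right a b)⟩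
  | lt s t =>
    obtain ⟨a, ha⟩ := s.exists_below
    obtain ⟨b, hb⟩ := t.exists_below
    exact ⟨max a b, 0, ha.mono (le_max_left a b), hb.mono (le_max_right a b)⟩
  | mem t X =>
    obtain ⟨a, ha⟩ := t.exists_below
    exact ⟨a, X + 1, ha, Nat.lt_succ_self X⟩
  | bot => exact ⟨0, 0, trivial⟩
  | imp φ ψ h₁ h₂ =>
    obtain ⟨a, b, h⟩ := h₁
    obtain ⟨c, d, h'⟩ := h₂
    exact ⟨max a c, max b d, h.mono (le_max_left a c) (le_max_left b d),
      h'.mono (le_max_right a c) (le_max_right b d)⟩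
  | all φ h =>
    obtain ⟨a, b, h⟩ := h
    exact ⟨a, b, h.mono (Nat.le_succ a) le_rfl⟩
  | allS φ h =>
    obtain ⟨a, b, h⟩ := h
    exact ⟨a, b, h.mono le_rfl (Nat.le_succ b)⟩

theorem Form.instN_subst (φ : Form) (t : Tm) (σ : ℕ → Tm) (τ : ℕ → ℕ) :
    (φ.instN t).subst σ τ = (φ.subst (underN σ) τ).instN (t.subst σ) := by
  simp only [Form.instN_eq, Form.subst_subst, Function.comp_id, Function.id_comp]
  congr 1
  funext k
  cases k <;> simp [underN, Tm.up, Tm.subst_subst, Tm.subst, Tm.subst_var]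

theorem Form.instS_subst (φ : Form) (X : ℕ) (σ : ℕ → Tm) (τ : ℕ → ℕ) :
    (φ.instS X).subst σ τ = (φ.subst σ (underS τ)).instS (τ X) := by
  simp only [Form.instS_eq, Form.subst_subst, Tm.subst, Tm.subst_var]
  congr 1
  funext k
  cases k <;> rfl

theorem Form.upN_subst (φ : Form) (σ : ℕ → Tm) (τ : ℕ → ℕ) :
    φ.upN.subst (underN σ) τ = (φ.subst σ τ).upN := by
  simp only [Form.upN, Form.subst_subst, Function.comp_id, Function.id_comp]
  rfl

theorem Form.upS_subst (φ : Form) (σ : ℕ → Tm) (τ : ℕ → ℕ) :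
    φ.upS.subst σ (underS τ) = (φ.subst σ τ).upS := by
  simp only [Form.upS, Form.subst_subst, Tm.subst, Tm.subst_var]
  rfl

theorem Form.subst_underN_instN (φ : Form) (t : Tm) (σ : ℕ → Tm) (τ : ℕ → ℕ) :
    (φ.subst (underN σ) τ).instN t = φ.subst (vcons t σ) τ := by
  simp only [Form.instN_eq, Form.subst_subst, Function.id_comp]
  congr 1
  funext k
  cases k <;> simp [underN, Tm.up, Tm.subst_subst, Tm.subst, Tm.subst_var]

theorem Form.subst_underS_instS (φ : Form) (X : ℕ) (σ : ℕ → Tm) (τ : ℕ → ℕ) :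
    (φ.subst σ (underS τ)).instS X = φ.subst σ (vcons X τ) := by
  simp only [Form.instS_eq, Form.subst_subst, Tm.subst_var]
  congr 1
  funext k
  cases k <;> rfl

/-! ### Derivations -/

theorem Deriv.subst {Γ : List Form} {φ : Form} (h : Deriv Γ φ) (σ : ℕ → Tm) (τ : ℕ → ℕ) :
    Deriv (Γ.map fun ψ => ψ.subst σ τ) (φ.subst σ τ) := by
  induction h generalizing σ τ with
  | assumption h => exact .assumption (List.mem_map_of_mem h)
  | impI _ ih => exact .impI (ih σ τ)
  | impE _ _ ih₁ ih₂ => exact .impE (ih₁ σ τ) (ih₂ σ τ)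
  | raa _ ih => exact .raa (ih σ τ)
  | allI _ ih =>
    refine .allI ?_
    have := ih (underN σ) τ
    simpa only [List.map_map, Function.comp_def, Form.upN_subst] using this
  | allE t _ ih =>
    rw [Form.instN_subst]
    exact .allE _ (ih σ τ)
  | allSI _ ih =>
    refine .allSI ?_
    have := ih σ (underS τ)
    simpa only [List.map_map, Function.comp_def, Form.upS_subst] using this
  | allSE X _ ih =>
    rw [Form.instS_subst]
    exact .allSE _ (ih σ τ)
  | eqRefl t => exact .eqRefl _
  | eqSubst s t _ _ ih₁ ih₂ =>
    have h₂ := ih₂ σ τ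
    rw [Form.instN_subst] at h₂ ⊢
    exact .eqSubst _ _ (ih₁ σ τ) h₂

theorem Deriv.weaken {Γ Δ : List Form} {φ : Form} (h : Deriv Γ φ) (hs : Γ ⊆ Δ) :
    Deriv Δ φ := by
  induction h generalizing Δ with
  | assumption h => exact .assumption (hs h)
  | impI _ ih => exact .impI (ih (List.cons_subset_cons _ hs))
  | impE _ _ ih₁ ih₂ => exact .impE (ih₁ hs) (ih₂ hs)
  | raa _ ih => exact .raa (ih (List.cons_subset_cons _ hs))
  | allI _ ih => exact .allI (ih (List.map_subset _ hs))
  | allE t _ ih => exact .allE t (ih hs)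
  | allSI _ ih => exact .allSI (ih (List.map_subset _ hs))
  | allSE X _ ih => exact .allSE X (ih hs)
  | eqRefl t => exact .eqRefl t
  | eqSubst s t _ _ ih₁ ih₂ => exact .eqSubst s t (ih₁ hs) (ih₂ hs)

/-- Generalization on a fresh number variable. -/
theorem Deriv.all_of_fresh {Γ : List Form} {φ : Form} {n m : ℕ} (hΓ : ∀ ψ ∈ Γ, ψ.Below n m)
    (hφ : φ.Below (n + 1) m) (h : Deriv Γ (φ.instN (.var n))) : Deriv Γ (.all φ) := by
  refine .allI ?_
  -- turn the fresh variable into the variable to be quantified, and shift the others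
  have key := h.subst (fun k => if k = n then .var 0 else .var (k + 1)) id
  have h₁ : (Γ.map fun ψ => ψ.subst (fun k => if k = n then .var 0 else .var (k + 1)) id)
      = Γ.map Form.upN :=
    List.map_congr_left fun ψ hψ => Form.subst_congr (hΓ ψ hψ)
      (fun k hk => if_neg hk.ne) (fun _ _ => rfl)
  have h₂ : (φ.instN (.var n)).subst (fun k => if k = n then .var 0 else .var (k + 1)) id = φ := by
    rw [Form.instN_eq, Form.subst_subst]
    refine Form.subst_eq_self hφ (fun k hk => ?_) (fun _ _ => rfl)
    cases k with
    | zero => simp [Tm.subst]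
    | succ k => simp [Tm.subst, show k ≠ n by omega]
  rwa [h₁, h₂] at key

/-- Generalization on a fresh set variable. -/
theorem Deriv.allS_of_fresh {Γ : List Form} {φ : Form} {n m : ℕ} (hΓ : ∀ ψ ∈ Γ, ψ.Below n m)
    (hφ : φ.Below n (m + 1)) (h : Deriv Γ (φ.instS m)) : Deriv Γ (.allS φ) := by
  refine .allSI ?_
  have key := h.subst Tm.var (fun k => if k = m then 0 else k + 1)
  have h₁ : (Γ.map fun ψ => ψ.subst Tm.var (fun k => if k = m then 0 else k + 1))
      = Γ.map Form.upS :=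
    List.map_congr_left fun ψ hψ => Form.subst_congr (hΓ ψ hψ)
      (fun _ _ => rfl) (fun k hk => if_neg hk.ne)
  have h₂ : (φ.instS m).subst Tm.var (fun k => if k = m then 0 else k + 1) = φ := by
    rw [Form.instS_eq, Form.subst_subst]
    refine Form.subst_eq_self hφ (fun _ _ => rfl) (fun k hk => ?_)
    cases k with
    | zero => simp
    | succ k => simp [show k ≠ m by omega]
  rwa [h₁, h₂] at key

theorem Provable.of_mem {T : Set Form} {φ : Form} (h : φ ∈ T) : Provable T φ :=
  ⟨[φ], by simpa using h, .assumption (by simp)⟩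

theorem Provable.mp {T : Set Form} {φ ψ : Form} (h : Provable T (φ ⟹ ψ)) (h' : Provable T φ) :
    Provable T ψ := by
  obtain ⟨Γ, hΓ, hd⟩ := h
  obtain ⟨Γ', hΓ', hd'⟩ := h'
  refine ⟨Γ ++ Γ', fun χ hχ => (List.mem_append.1 hχ).elim (hΓ χ) (hΓ' χ), ?_⟩
  exact .impE (hd.weaken (List.subset_append_left _ _)) (hd'.weaken (List.subset_append_right _ _))

theorem exists_list_of_provable_insert {T : Set Form} {φ ψ : Form}
    (h : Provable (insert φ T) ψ) : ∃ Γ : List Form, (∀ χ ∈ Γ, χ ∈ T) ∧ Deriv (φ :: Γ) ψ := by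
  classical
  obtain ⟨Γ, hΓ, hd⟩ := h
  refine ⟨Γ.filter (· ≠ φ), fun χ hχ => ?_, hd.weaken fun χ hχ => ?_⟩
  · rw [List.mem_filter] at hχ
    exact (hΓ χ hχ.1).resolve_left (by simpa using hχ.2)
  · by_cases h : χ = φ <;> simp [h, hχ]

theorem Provable.deduction {T : Set Form} {φ ψ : Form} (h : Provable (insert φ T) ψ) :
    Provable T (φ ⟹ ψ) := by
  obtain ⟨Γ, hΓ, hd⟩ := exists_list_of_provable_insert h
  exact ⟨Γ, hΓ, .impI hd⟩

theorem Provable.raa {T : Set Form} {φ : Form} (h : Provable (insert ∼φ T) .bot) :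
    Provable T φ := by
  obtain ⟨Γ, hΓ, hd⟩ := exists_list_of_provable_insert h
  exact ⟨Γ, hΓ, .raa hd⟩

/-! ### Maximal consistent sets with witnesses -/

/-- An injection of the terms into `ℕ`. -/
def Tm.encode : Tm → ℕ
  | .var k => Nat.pair 0 k
  | .zero => Nat.pair 1 0
  | .one => Nat.pair 2 0
  | .add s t => Nat.pair 3 (Nat.pair s.encode t.encode)
  | .mul s t => Nat.pair 4 (Nat.pair s.encode t.encode)

/-- An injection of the formulas into `ℕ`. -/
def Form.encode : Form → ℕ
  | .eq s t => Nat.pair 0 (Nat.pair s.encode t.encode)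
  | .lt s t => Nat.pair 1 (Nat.pair s.encode t.encode)
  | .mem t X => Nat.pair 2 (Nat.pair t.encode X)
  | .bot => Nat.pair 3 0
  | .imp φ ψ => Nat.pair 4 (Nat.pair φ.encode ψ.encode)
  | .all φ => Nat.pair 5 φ.encode
  | .allS φ => Nat.pair 6 φ.encode

theorem Tm.encode_injective : Function.Injective Tm.encode := by
  intro s
  induction s <;> intro t h <;> cases t <;> simp_all [Tm.encode, Nat.pair_eq_pair] <;> grind

theorem Form.encode_injective : Function.Injective Form.encode := by
  intro φ
  induction φ <;> intro ψ h <;> cases ψ <;>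
    simp_all [Form.encode, Nat.pair_eq_pair, Tm.encode_injective.eq_iff] <;> grind

instance : Countable Form := Form.encode_injective.countable

instance : Nonempty Form := ⟨.bot⟩

/-- `T` does not prove `⊥`. -/
def Consistent (T : Set Form) : Prop := ¬ Provable T .bot

/-- The free variables of the formulas in `T` lie below a common bound, so that there are fresh
variables. -/
def BoundedVars (T : Set Form) : Prop := ∃ n m, ∀ φ ∈ T, φ.Below n m

theorem BoundedVars.insert {T : Set Form} (h : BoundedVars T) (φ : Form) :
    BoundedVars (insert φ T) := by
  obtain ⟨n, m, h⟩ := h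
  obtain ⟨a, b, hφ⟩ := φ.exists_below
  refine ⟨max n a, max m b, ?_⟩
  rintro ψ (rfl | hψ)
  · exact hφ.mono (le_max_right _ _) (le_max_right _ _)
  · exact (h ψ hψ).mono (le_max_left _ _) (le_max_left _ _)

/-- `T` decides `φ`; if `φ` is a universal formula and is refuted, then an instance of it is. -/
def Decides (T : Set Form) (φ : Form) : Prop :=
  φ ∈ T ∨ ∼φ ∈ T ∧ (∀ ψ, φ = .all ψ → ∃ t, ∼(ψ.instN t) ∈ T) ∧
    ∀ ψ, φ = .allS ψ → ∃ X, ∼(ψ.instS X) ∈ T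

theorem Decides.mono {T T' : Set Form} {φ : Form} (h : Decides T φ) (hs : T ⊆ T') :
    Decides T' φ := by
  rcases h with h | ⟨h, h₁, h₂⟩
  · exact .inl (hs h)
  · refine .inr ⟨hs h, fun ψ hψ => ?_, fun ψ hψ => ?_⟩
    · obtain ⟨t, ht⟩ := h₁ ψ hψ
      exact ⟨t, hs ht⟩
    · obtain ⟨t, ht⟩ := h₂ ψ hψ
      exact ⟨t, hs ht⟩

theorem exists_decides {T : Set Form} (hc : Consistent T) (hb : BoundedVars T) (φ : Form) :
    ∃ T', T ⊆ T' ∧ Consistent T' ∧ BoundedVars T' ∧ Decides T' φ := by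
  by_cases h : Consistent (insert φ T)
  · exact ⟨_, Set.subset_insert _ _, h, hb.insert φ, .inl (Set.mem_insert _ _)⟩
  have hφ : Provable T ∼φ := (not_not.1 h).deduction
  have hneg : Consistent (insert ∼φ T) := fun h' => hc (hφ.mp h'.raa)
  have hb' := hb.insert ∼φ
  obtain ⟨n, m, hnm⟩ := hb'
  have hin : ∼φ ∈ insert ∼φ T := Set.mem_insert _ _
  have hφb : φ.Below n m := (hnm _ hin).1
  cases φ with
  | all ψ =>
    refine ⟨insert ∼(ψ.instN (.var n)) (insert ∼(.all ψ) T),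
      (Set.subset_insert _ _).trans (Set.subset_insert _ _), fun h' => ?_,
      (hb.insert _).insert _, .inr ⟨Set.mem_insert_of_mem _ hin, ?_, by simp⟩⟩
    · obtain ⟨Γ, hΓ, hd⟩ := h'.raa
      have : Deriv Γ (.all ψ) := hd.all_of_fresh (fun χ hχ => hnm χ (hΓ χ hχ)) hφb
      exact hneg ((Provable.of_mem hin).mp ⟨Γ, hΓ, this⟩)
    · rintro _ ⟨⟩
      exact ⟨_, Set.mem_insert _ _⟩
  | allS ψ =>
    refine ⟨insert ∼(ψ.instS m) (insert ∼(.allS ψ) T),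
      (Set.subset_insert _ _).trans (Set.subset_insert _ _), fun h' => ?_,
      (hb.insert _).insert _, .inr ⟨Set.mem_insert_of_mem _ hin, by simp, ?_⟩⟩
    · obtain ⟨Γ, hΓ, hd⟩ := h'.raa
      have : Deriv Γ (.allS ψ) := hd.allS_of_fresh (fun χ hχ => hnm χ (hΓ χ hχ)) hφb
      exact hneg ((Provable.of_mem hin).mp ⟨Γ, hΓ, this⟩)
    · rintro _ ⟨⟩
      exact ⟨_, Set.mem_insert _ _⟩
  | _ => exact ⟨_, Set.subset_insert _ _, hneg, hb.insert _, .inr ⟨hin, by simp, by simp⟩⟩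

/-- Henkin's lemma. As the free variables of `T` are bounded, variables can serve as witnesses. -/
theorem exists_henkin {T : Set Form} (hc : Consistent T) (hb : BoundedVars T) :
    ∃ H, T ⊆ H ∧ Consistent H ∧ ∀ φ, Decides H φ := by
  obtain ⟨f, hf⟩ := exists_surjective_nat Form
  let Stage := {T : Set Form // Consistent T ∧ BoundedVars T}
  choose next hsub hcon hbd hdec using
    fun (T : Stage) (φ : Form) => exists_decides T.2.1 T.2.2 φ
  let chain : ℕ → Stage :=
    fun n => Nat.rec ⟨T, hc, hb⟩ (fun k T => ⟨next T (f k), hcon T (f k), hbd T (f k)⟩) n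
  have hmono : Monotone fun n => (chain n).1 :=
    monotone_nat_of_le_succ fun n => hsub (chain n) (f n)
  refine ⟨⋃ n, (chain n).1, Set.subset_iUnion (fun n => (chain n).1) 0, ?_, fun φ => ?_⟩
  · rintro ⟨Γ, hΓ, hd⟩
    have : ∃ n, ∀ ψ ∈ Γ, ψ ∈ (chain n).1 := by
      clear hd
      induction Γ with
      | nil => exact ⟨0, by simp⟩
      | cons ψ Γ ih =>
        obtain ⟨n, hn⟩ := ih fun χ hχ => hΓ χ (List.mem_cons_of_mem _ hχ)
        obtain ⟨k, hk⟩ := Set.mem_iUnion.1 (hΓ ψ List.mem_cons_self)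
        refine ⟨max n k, fun χ hχ => ?_⟩
        rcases List.mem_cons.1 hχ with rfl | hχ
        · exact hmono (le_max_right n k) hk
        · exact hmono (le_max_left n k) (hn χ hχ)
    obtain ⟨n, hn⟩ := this
    exact (chain n).2.1 ⟨Γ, hn, hd⟩
  · obtain ⟨k, rfl⟩ := hf φ
    exact (hdec (chain k) (f k)).mono (Set.subset_iUnion (fun n => (chain n).1) (k + 1))

/-! ### Structures and completeness -/

section Semantics

variable {M S : Type}

variable [Zero M] [One M] [Add M] [Mul M]

/-- The value of a term under the assignment `v`. -/
def Tm.val (v : ℕ → M) : Tm → M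
  | .var k => v k
  | .zero => 0
  | .one => 1
  | .add s t => s.val v + t.val v
  | .mul s t => s.val v * t.val v

variable [LT M] [Membership M S]

/-- Tarskian truth in the structure with numbers `M` and sets `S`. The set quantifiers range over
all of `S`; extensionality is not required. -/
def Form.Sat : (ℕ → M) → (ℕ → S) → Form → Prop
  | v, _, .eq s t => s.val v = t.val v
  | v, _, .lt s t => s.val v < t.val v
  | v, e, .mem t X => t.val v ∈ e X
  | _, _, .bot => False
  | v, e, .imp φ ψ => φ.Sat v e → ψ.Sat v e
  | v, e, .all φ => ∀ x, φ.Sat (vcons x v) e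
  | v, e, .allS φ => ∀ X, φ.Sat v (vcons X e)

end Semantics

/-- The set variables, as the sets of the term structure. -/
structure SetVar : Type where
  index : ℕ

theorem mem_of_provable {H : Set Form} (hc : Consistent H) (hd : ∀ φ, Decides H φ) {φ : Form}
    (h : Provable H φ) : φ ∈ H :=
  (hd φ).resolve_right fun h' => hc ((Provable.of_mem h'.1).mp h)

theorem Tm.subst_up (t s : Tm) : (t.up 1).subst (vcons s Tm.var) = t := by
  simp [Tm.up, Tm.subst_subst, Tm.subst, Tm.subst_var]

/-- The term structure of a maximal consistent set with witnesses satisfies exactly this set. -/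
theorem exists_model {H : Set Form} (hc : Consistent H) (hd : ∀ φ, Decides H φ) :
    ∃ (M S : Type) (_ : Zero M) (_ : One M) (_ : Add M) (_ : Mul M) (_ : LT M)
      (_ : Membership M S) (c : Tm → M) (d : ℕ → S), Function.Surjective c ∧ Function.Surjective d ∧
      ∀ (φ : Form) (σ : ℕ → Tm) (τ : ℕ → ℕ),
        φ.Sat (fun k => c (σ k)) (fun k => d (τ k)) ↔ φ.subst σ τ ∈ H := by
  have hcl {φ : Form} (h : Provable H φ) : φ ∈ H := mem_of_provable hc hd h
  have refl (t : Tm) : (t ≐ t) ∈ H := hcl ⟨[], by simp, .eqRefl t⟩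
  -- all congruence properties are instances of Leibniz's law
  have leib (φ : Form) {s t : Tm} (h : (s ≐ t) ∈ H) (h' : φ.instN s ∈ H) : φ.instN t ∈ H := by
    refine hcl ⟨[s ≐ t, φ.instN s], by simp [h, h'], ?_⟩
    exact .eqSubst s t (.assumption (by simp)) (.assumption (by simp))
  have symm {s t : Tm} (h : (s ≐ t) ∈ H) : (t ≐ s) ∈ H := by
    have := leib (x0 ≐ s.up 1) h
    simp only [Form.instN_eq, Form.subst, Tm.subst_up, Tm.subst, vcons_zero] at this
    exact this (refl s)
  have trans {s t u : Tm} (h : (s ≐ t) ∈ H) (h' : (t ≐ u) ∈ H) : (s ≐ u) ∈ H := by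
    have := leib (s.up 1 ≐ x0) h'
    simp only [Form.instN_eq, Form.subst, Tm.subst_up, Tm.subst, vcons_zero] at this
    exact this h
  have cadd {s s' t t' : Tm} (h : (s ≐ s') ∈ H) (h' : (t ≐ t') ∈ H) :
      (s.add t ≐ s'.add t') ∈ H := by
    have h₁ := leib ((s.add t).up 1 ≐ .add x0 (t.up 1)) h
    have h₂ := leib ((s.add t).up 1 ≐ .add (s'.up 1) x0) h'
    simp only [Form.instN_eq, Form.subst, Tm.subst_up, Tm.subst, vcons_zero] at h₁ h₂
    exact h₂ (h₁ (refl _))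
  have cmul {s s' t t' : Tm} (h : (s ≐ s') ∈ H) (h' : (t ≐ t') ∈ H) :
      (s.mul t ≐ s'.mul t') ∈ H := by
    have h₁ := leib ((s.mul t).up 1 ≐ .mul x0 (t.up 1)) h
    have h₂ := leib ((s.mul t).up 1 ≐ .mul (s'.up 1) x0) h'
    simp only [Form.instN_eq, Form.subst, Tm.subst_up, Tm.subst, vcons_zero] at h₁ h₂
    exact h₂ (h₁ (refl _))
  have clt {s s' t t' : Tm} (h : (s ≐ s') ∈ H) (h' : (t ≐ t') ∈ H) (hlt : (s ≺ t) ∈ H) :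
      (s' ≺ t') ∈ H := by
    have h₁ := leib (x0 ≺ t.up 1) h
    have h₂ := leib (s'.up 1 ≺ x0) h'
    simp only [Form.instN_eq, Form.subst, Tm.subst_up, Tm.subst, vcons_zero] at h₁ h₂
    exact h₂ (h₁ hlt)
  have cmem {s s' : Tm} {X : ℕ} (h : (s ≐ s') ∈ H) (hm : (s ∊ X) ∈ H) : (s' ∊ X) ∈ H := by
    have h₁ := leib (x0 ∊ X) h
    simp only [Form.instN_eq, Form.subst, Tm.subst, vcons_zero, id] at h₁
    exact h₁ hm
  let st : Setoid Tm := ⟨fun s t => (s ≐ t) ∈ H, refl, symm, trans⟩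
  let iz : Zero (Quotient st) := ⟨⟦.zero⟧⟩
  let io : One (Quotient st) := ⟨⟦.one⟧⟩
  let ia : Add (Quotient st) := ⟨Quotient.map₂ Tm.add fun _ _ h _ _ h' => cadd h h'⟩
  let im : Mul (Quotient st) := ⟨Quotient.map₂ Tm.mul fun _ _ h _ _ h' => cmul h h'⟩
  let il : LT (Quotient st) := ⟨Quotient.lift₂ (fun s t => (s ≺ t) ∈ H) fun _ _ _ _ h h' =>
    propext ⟨clt h h', clt (symm h) (symm h')⟩⟩
  let ie : Membership (Quotient st) SetVar := ⟨fun X => Quotient.lift (fun t => (t ∊ X.index) ∈ H)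
    fun _ _ h => propext ⟨cmem h, cmem (symm h)⟩⟩
  let c : Tm → Quotient st := fun t => ⟦t⟧
  have hval (t : Tm) (σ : ℕ → Tm) : t.val (fun k => c (σ k)) = c (t.subst σ) := by
    induction t with
    | var k => rfl
    | zero => rfl
    | one => rfl
    | add s t hs ht => exact congrArg₂ (· + ·) hs ht
    | mul s t hs ht => exact congrArg₂ (· * ·) hs ht
  refine ⟨Quotient st, SetVar, iz, io, ia, im, il, ie, c, SetVar.mk,
    Quotient.mk_surjective, fun X => ⟨X.index, rfl⟩, fun φ => ?_⟩
  induction φ with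
  | eq s t =>
    intro σ τ
    simp only [Form.Sat, hval, Form.subst]
    exact Quotient.eq
  | lt s t =>
    intro σ τ
    simp only [Form.Sat, hval, Form.subst]
    rfl
  | mem s t =>
    intro σ τ
    simp only [Form.Sat, hval, Form.subst]
    rfl
  | bot => exact fun σ τ => ⟨False.elim, fun h => hc (.of_mem h)⟩
  | imp φ ψ h₁ h₂ =>
    intro σ τ
    simp only [Form.Sat, h₁, h₂, Form.subst]
    constructor
    · intro h
      by_cases hφ : φ.subst σ τ ∈ H
      · refine hcl (Provable.deduction (.of_mem (Set.mem_insert_of_mem _ (h hφ))))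
      · have hn : ∼(φ.subst σ τ) ∈ H := ((hd _).resolve_left hφ).1
        refine hcl ⟨[∼(φ.subst σ τ)], by simpa using hn, .impI (.raa ?_)⟩
        exact .impE (φ := φ.subst σ τ) (.assumption (by simp [Form.neg])) (.assumption (by simp))
    · exact fun h h' => hcl ((Provable.of_mem h).mp (.of_mem h'))
  | all φ ih =>
    intro σ τ
    have hinst (t : Tm) : φ.Sat (vcons (c t) fun k => c (σ k)) (fun k => SetVar.mk (τ k)) ↔
        (φ.subst (underN σ) τ).instN t ∈ H := by
      rw [← map_vcons, ih, Form.subst_underN_instN]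
    constructor
    · intro h
      refine (hd _).resolve_right fun h' => ?_
      obtain ⟨t, ht⟩ := h'.2.1 _ rfl
      exact hc ((Provable.of_mem ht).mp (.of_mem ((hinst t).1 (h _))))
    · intro h x
      obtain ⟨t, rfl⟩ := Quotient.mk_surjective x
      refine (hinst t).2 (hcl ⟨[_], by simpa using h, ?_⟩)
      exact .allE t (.assumption (by simp [Form.subst]))
  | allS φ ih =>
    intro σ τ
    have hinst (X : ℕ) : φ.Sat (fun k => c (σ k)) (vcons (SetVar.mk X) fun k => SetVar.mk (τ k)) ↔
        (φ.subst σ (underS τ)).instS X ∈ H := by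
      rw [← map_vcons, ih, Form.subst_underS_instS]
    constructor
    · intro h
      refine (hd _).resolve_right fun h' => ?_
      obtain ⟨t, ht⟩ := h'.2.2 _ rfl
      exact hc ((Provable.of_mem ht).mp (.of_mem ((hinst t).1 (h _))))
    · intro h X
      refine (hinst X.index).2 (hcl ⟨[_], by simpa using h, ?_⟩)
      exact .allSE X.index (.assumption (by simp [Form.subst]))

/-- Gödel's completeness theorem for a theory `T` of sentences. -/
theorem provable_of_sat {T : Set Form} (hT : ∀ ψ ∈ T, ψ.Below 0 0) {φ : Form}
    (h : ∀ (M S : Type) [Zero M] [One M] [Add M] [Mul M] [LT M] [Membership M S],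
      (∀ ψ ∈ T, ∀ (v : ℕ → M) (e : ℕ → S), ψ.Sat v e) →
        ∀ (v : ℕ → M) (e : ℕ → S), φ.Sat v e) : Provable T φ := by
  by_contra hφ
  have hb : BoundedVars T := ⟨0, 0, hT⟩
  obtain ⟨H, hTH, hc, hd⟩ := exists_henkin (fun h' => hφ h'.raa) (hb.insert ∼φ)
  obtain ⟨M, S, _, _, _, _, _, _, c, d, hcs, hds, hsat⟩ := exists_model hc hd
  have hn : φ ∉ H := fun h' =>
    hc ((Provable.of_mem (hTH (Set.mem_insert _ _))).mp (.of_mem h'))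
  refine hn ?_
  rw [← φ.subst_id, ← hsat]
  refine h M S (fun ψ hψ v e => ?_) _ _
  -- `ψ` is a sentence, so the terms and set variables that name the values of `v`, `e` do not matter
  choose σ hσ using fun k => hcs (v k)
  choose τ hτ using fun k => hds (e k)
  rw [← funext hσ, ← funext hτ, hsat, Form.subst_eq_self (hT ψ hψ) (by simp) (by simp)]
  exact hTH (Set.mem_insert_of_mem _ hψ)

/-! ### The meaning of the logical abbreviations -/

theorem Tm.val_subst {M : Type} [Zero M] [One M] [Add M] [Mul M] (t : Tm) (σ : ℕ → Tm)
    (v : ℕ → M) : (t.subst σ).val v = t.val fun k => (σ k).val v := by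
  induction t <;> simp_all [Tm.subst, Tm.val]

section Sat

variable {M S : Type} [Zero M] [One M] [Add M] [Mul M] (v : ℕ → M)

@[simp] theorem val_var (k : ℕ) : (Tm.var k).val v = v k := rfl
@[simp] theorem val_zero : (0 : Tm).val v = 0 := rfl
@[simp] theorem val_one : (1 : Tm).val v = 1 := rfl
@[simp] theorem val_add (s t : Tm) : (s + t).val v = s.val v + t.val v := rfl
@[simp] theorem val_mul (s t : Tm) : (s * t).val v = s.val v * t.val v := rfl

@[simp] theorem vcons_one {α : Type} (x : α) (v : ℕ → α) : vcons x v 1 = v 0 := rfl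
@[simp] theorem vcons_two {α : Type} (x : α) (v : ℕ → α) : vcons x v 2 = v 1 := rfl
@[simp] theorem vcons_three {α : Type} (x : α) (v : ℕ → α) : vcons x v 3 = v 2 := rfl
@[simp] theorem vcons_four {α : Type} (x : α) (v : ℕ → α) : vcons x v 4 = v 3 := rfl

@[simp] theorem val_up_one (a : M) (t : Tm) : (t.up 1).val (vcons a v) = t.val v := by
  simp [Tm.up, Tm.val_subst]

@[simp] theorem val_up_two (a b : M) (t : Tm) :
    (t.up 2).val (vcons a (vcons b v)) = t.val v := by
  simp [Tm.up, Tm.val_subst, vcons]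

@[simp] theorem val_up_three (a b c : M) (t : Tm) :
    (t.up 3).val (vcons a (vcons b (vcons c v))) = t.val v := by
  simp [Tm.up, Tm.val_subst, vcons]

variable [LT M] [Membership M S] (e : ℕ → S)

@[simp] theorem sat_eq (s t : Tm) : (s ≐ t).Sat v e ↔ s.val v = t.val v := Iff.rfl
@[simp] theorem sat_lt (s t : Tm) : (s ≺ t).Sat v e ↔ s.val v < t.val v := Iff.rfl
@[simp] theorem sat_mem (t : Tm) (X : ℕ) : (t ∊ X).Sat v e ↔ t.val v ∈ e X := Iff.rfl

variable (φ ψ : Form)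

@[simp] theorem sat_imp : (φ ⟹ ψ).Sat v e ↔ (φ.Sat v e → ψ.Sat v e) := Iff.rfl
@[simp] theorem sat_all : φ.all.Sat v e ↔ ∀ x, φ.Sat (vcons x v) e := Iff.rfl
@[simp] theorem sat_allS : φ.allS.Sat v e ↔ ∀ X, φ.Sat v (vcons X e) := Iff.rfl
@[simp] theorem sat_neg : φ.neg.Sat v e ↔ ¬ φ.Sat v e := Iff.rfl
@[simp] theorem sat_and : (φ ⋏ ψ).Sat v e ↔ φ.Sat v e ∧ ψ.Sat v e := by simp [Form.and]
@[simp] theorem sat_or : (φ ⋎ ψ).Sat v e ↔ φ.Sat v e ∨ ψ.Sat v e := by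
  simp [Form.or, or_iff_not_imp_left]
@[simp] theorem sat_iff : (φ ⟺ ψ).Sat v e ↔ (φ.Sat v e ↔ ψ.Sat v e) := by
  simp [Form.iff, iff_iff_implies_and_implies]
@[simp] theorem sat_ex : φ.ex.Sat v e ↔ ∃ x, φ.Sat (vcons x v) e := by simp [Form.ex]
@[simp] theorem sat_exS : φ.exS.Sat v e ↔ ∃ X, φ.Sat v (vcons X e) := by simp [Form.exS]

@[simp] theorem sat_alls_two :
    (alls 2 φ).Sat v e ↔ ∀ a b, φ.Sat (vcons b (vcons a v)) e := Iff.rfl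
@[simp] theorem sat_alls_three :
    (alls 3 φ).Sat v e ↔ ∀ a b c, φ.Sat (vcons c (vcons b (vcons a v))) e := Iff.rfl
@[simp] theorem sat_alls_four :
    (alls 4 φ).Sat v e ↔ ∀ a b c d, φ.Sat (vcons d (vcons c (vcons b (vcons a v)))) e := Iff.rfl
@[simp] theorem sat_exs_two :
    (exs 2 φ).Sat v e ↔ ∃ a b, φ.Sat (vcons b (vcons a v)) e := by simp [exs]
@[simp] theorem sat_exs_three :
    (exs 3 φ).Sat v e ↔ ∃ a b c, φ.Sat (vcons c (vcons b (vcons a v))) e := by simp [exs]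

theorem vcons_tail {α : Type} (v : ℕ → α) : vcons (v 0) (fun k => v (k + 1)) = v := by
  funext k
  cases k <;> rfl

theorem sat_subst (σ : ℕ → Tm) (τ : ℕ → ℕ) :
    (φ.subst σ τ).Sat v e ↔ φ.Sat (fun k => (σ k).val v) (fun k => e (τ k)) := by
  induction φ generalizing v e σ τ with
  | eq s t => simp [Form.subst, Tm.val_subst]
  | lt s t => simp [Form.subst, Tm.val_subst]
  | mem t X => simp [Form.subst, Tm.val_subst]
  | bot => rfl
  | imp φ ψ h₁ h₂ => simp [Form.subst, h₁, h₂]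
  | all φ ih =>
    have h (x : M) : (fun k => (underN σ k).val (vcons x v))
        = vcons x fun k => (σ k).val v := by
      funext k
      cases k <;> simp [underN]
    exact forall_congr' fun x => by rw [ih, h]
  | allS φ ih =>
    have h (X : S) : (fun k => vcons X e (underS τ k)) = vcons X fun k => e (τ k) := by
      funext k
      cases k <;> rfl
    exact forall_congr' fun X => by rw [ih, h]

theorem sat_upS (X : S) : φ.upS.Sat v (vcons X e) ↔ φ.Sat v e := by
  simp [Form.upS, sat_subst]

theorem sat_instN (t : Tm) : (φ.instN t).Sat v e ↔ φ.Sat (vcons (t.val v) v) e := by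
  rw [Form.instN_eq, sat_subst, map_vcons]
  rfl

theorem sat_of_sat_alls (n : ℕ) (h : ∀ v : ℕ → M, (alls n φ).Sat v e) (v : ℕ → M) :
    φ.Sat v e := by
  induction n generalizing v with
  | zero => exact h v
  | succ n ih =>
    refine ih (fun v => ?_) v
    have := h (fun k => v (k + 1))
    rw [alls, Function.iterate_succ_apply'] at this
    simpa only [vcons_tail, alls] using this (v 0)

theorem sat_of_sat_allSs (n : ℕ) (h : ∀ e : ℕ → S, (allSs n φ).Sat v e) (e : ℕ → S) :
    φ.Sat v e := by
  induction n generalizing e with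
  | zero => exact h e
  | succ n ih =>
    refine ih (fun e => ?_) e
    have := h (fun k => e (k + 1))
    rw [allSs, Function.iterate_succ_apply'] at this
    simpa only [vcons_tail, allSs] using this (e 0)

end Sat

theorem alls_below {φ : Form} {k n m : ℕ} (h : φ.Below (k + n) m) : (alls n φ).Below k m := by
  induction n generalizing k with
  | zero => exact h
  | succ n ih =>
    rw [alls, Function.iterate_succ_apply']
    exact ih (k := k + 1) (by rwa [Nat.succ_add_eq_add_succ])

theorem allSs_below {φ : Form} {k n m : ℕ} (h : φ.Below k (m + n)) : (allSs n φ).Below k m := by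
  induction n generalizing m with
  | zero => exact h
  | succ n ih =>
    rw [allSs, Function.iterate_succ_apply']
    exact ih (m := m + 1) (by rwa [Nat.succ_add_eq_add_succ])

theorem RCA0_below {χ : Form} (h : χ ∈ RCA0) : χ.Below 0 0 := by
  obtain ⟨φ, n, m, -, hb, rfl⟩ := h
  exact allSs_below (by rw [zero_add]; exact alls_below (by rwa [zero_add]))

/-! ### Models of `RCA₀` -/

/-- A commutative discretely ordered semiring: the nonnegative part of a discretely ordered ring. -/
class DiscreteSemiring (M : Type) extends CommSemiring M, LinearOrder M, IsStrictOrderedRing M,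
    CanonicallyOrderedAdd M where
  one_le_of_pos : ∀ a : M, 0 < a → 1 ≤ a

/-- The structure with numbers `M` and sets `S` satisfies induction for `Σ⁰₁` formulas and
comprehension for `Δ⁰₁` formulas, both with parameters. -/
class ModelRCA0 (M S : Type) [DiscreteSemiring M] [Membership M S] : Prop where
  induction : ∀ θ : Form, IsBounded θ → ∀ (v : ℕ → M) (e : ℕ → S),
    (∃ y, θ.Sat (vcons y (vcons 0 v)) e) →
    (∀ n, (∃ y, θ.Sat (vcons y (vcons n v)) e) → ∃ y, θ.Sat (vcons y (vcons (n + 1) v)) e) →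
    ∀ n, ∃ y, θ.Sat (vcons y (vcons n v)) e
  comprehension : ∀ θ η : Form, IsBounded θ → IsBounded η → ∀ (v : ℕ → M) (e : ℕ → S),
    (∀ n, (∃ y, θ.Sat (vcons y (vcons n v)) e) ↔ ∀ y, η.Sat (vcons y (vcons n v)) e) →
    ∃ X : S, ∀ n, n ∈ X ↔ ∃ y, θ.Sat (vcons y (vcons n v)) e

theorem sat_axiom {M S : Type} [Zero M] [One M] [Add M] [Mul M] [LT M] [Membership M S]
    (h : ∀ ψ ∈ RCA0, ∀ (v : ℕ → M) (e : ℕ → S), ψ.Sat v e) {φ : Form} (hφ : IsAxiom φ)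
    (v : ℕ → M) (e : ℕ → S) : φ.Sat v e := by
  obtain ⟨n, m, hb⟩ := φ.exists_below
  exact sat_of_sat_alls e φ n
    (fun v => sat_of_sat_allSs v _ m (fun e => h _ ⟨φ, n, m, hφ, hb, rfl⟩ v e) e) v

open Classical in
/-- Completeness for `RCA₀`: it suffices to establish a formula in models of `RCA₀` presented as ordered semirings. -/
theorem provable_RCA0_of_models {φ : Form}
    (h : ∀ (M S : Type) [DiscreteSemiring M] [Membership M S] [Nonempty S] [ModelRCA0 M S],
      ∀ (v : ℕ → M) (e : ℕ → S), φ.Sat v e) : Provable RCA0 φ := by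
  refine provable_of_sat (fun ψ hψ => RCA0_below hψ) ?_
  intro M S _ _ _ _ _ _ hT v₀ e
  have ax {ψ : Form} (hψ : IsAxiom ψ) (v : ℕ → M) : ψ.Sat v e := sat_axiom hT hψ v e
  have ax₃ {ψ : Form} (hψ : IsBasic ψ) (a b c : M) :
      ψ.Sat (vcons a (vcons b (vcons c v₀))) e := ax (.basic hψ) _
  have add_assoc' (a b c : M) : a + b + c = a + (b + c) := ax₃ .add_assoc a b c
  have add_comm' (a b : M) : a + b = b + a := ax₃ .add_comm a b 0
  have mul_assoc' (a b c : M) : a * b * c = a * (b * c) := ax₃ .mul_assoc a b c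
  have mul_comm' (a b : M) : a * b = b * a := ax₃ .mul_comm a b 0
  have distrib' (a b c : M) : a * (b + c) = a * b + a * c := ax₃ .distrib a b c
  have add_zero' (a : M) : a + 0 = a := ax₃ .add_zero a 0 0
  have mul_zero' (a : M) : a * 0 = 0 := ax₃ .mul_zero a 0 0
  have mul_one' (a : M) : a * 1 = a := ax₃ .mul_one a 0 0
  have lt_trans' {a b c : M} (h : a < b) (h' : b < c) : a < c := by
    have := ax₃ .lt_trans a b c
    simp only [sat_imp, sat_and, sat_lt, val_var, vcons_zero, vcons_one, vcons_two] at this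
    exact this ⟨h, h'⟩
  have lt_irrefl' (a : M) : ¬ a < a := ax₃ .lt_irrefl a 0 0
  have lt_total' (a b : M) : a < b ∨ a = b ∨ b < a := by
    simpa using ax₃ .lt_total a b 0
  have add_lt' {a b : M} (h : a < b) (c : M) : a + c < b + c := ax₃ .add_lt a b c h
  have mul_lt' {a b c : M} (h : 0 < c) (h' : a < b) : a * c < b * c := by
    have := ax₃ .mul_lt a b c
    simp only [sat_imp, sat_and, sat_lt, val_var, vcons_zero, vcons_one, vcons_two] at this
    exact this ⟨h, h'⟩
  have lt_sub' {a b : M} (h : a < b) : ∃ c, a + c = b := by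
    have := ax₃ .lt_sub a b 0
    simp only [sat_imp, sat_ex] at this
    exact this h
  have zero_lt_one' : (0 : M) < 1 := ax₃ .zero_lt_one 0 0 0
  have discrete' {a : M} (h : 0 < a) : 1 < a ∨ 1 = a := by
    have := ax₃ .discrete a 0 0
    simp only [sat_imp, le, sat_or] at this
    exact this h
  have nonneg' (a : M) : 0 < a ∨ 0 = a := by
    have := ax₃ .nonneg a 0 0
    simp only [le, sat_or] at this
    exact this
  let _ : CommSemiring M :=
    { add_assoc := add_assoc'
      add_comm := add_comm'
      zero_add := fun a => (add_comm' _ _).trans (add_zero' a)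
      add_zero := add_zero'
      mul_assoc := mul_assoc'
      mul_comm := mul_comm'
      one_mul := fun a => (mul_comm' _ _).trans (mul_one' a)
      mul_one := mul_one'
      zero_mul := fun a => (mul_comm' _ _).trans (mul_zero' a)
      mul_zero := mul_zero'
      left_distrib := distrib'
      right_distrib := fun a b c => by rw [mul_comm', distrib', mul_comm' c a, mul_comm' c b]
      nsmul := nsmulRec }
  let _ : LinearOrder M :=
    { le := fun a b => a < b ∨ a = b
      le_refl := fun a => .inr rfl
      le_trans := by
        rintro a b c (h | rfl) (h' | rfl)
        · exact .inl (lt_trans' h h')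
        · exact .inl h
        · exact .inl h'
        · exact .inr rfl
      lt_iff_le_not_ge := fun a b => by
        constructor
        · refine fun h => ⟨.inl h, ?_⟩
          rintro (h' | rfl)
          · exact lt_irrefl' _ (lt_trans' h h')
          · exact lt_irrefl' _ h
        · rintro ⟨h | rfl, h'⟩
          · exact h
          · exact (h' (.inr rfl)).elim
      le_antisymm := by
        rintro a b (h | rfl) (h' | h')
        · exact (lt_irrefl' _ (lt_trans' h h')).elim
        · exact h'.symm
        · rfl
        · rfl
      le_total := fun a b => by
        rcases lt_total' a b with h | h | h
        · exact .inl (.inl h)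
        · exact .inl (.inr h)
        · exact .inr (.inl h)
      toDecidableLE := Classical.decRel _ }
  have le_iff (a b : M) : a ≤ b ↔ a < b ∨ a = b := Iff.rfl
  have : IsStrictOrderedRing M :=
    { add_le_add_left := by
        rintro a b (h | rfl) c
        · exact .inl (add_lt' h c)
        · exact .inr rfl
      le_of_add_le_add_left := by
        intro a b c h
        by_contra h'
        have h₁ := add_lt' (not_le.1 h') a
        rw [add_comm' c, add_comm' b] at h₁
        exact lt_irrefl' _ (h₁.trans_le h)
      zero_le_one := zero_lt_one'.le
      exists_pair_ne := ⟨0, 1, zero_lt_one'.ne⟩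
      mul_lt_mul_of_pos_left := fun a ha b c hbc => by
        change a * b < a * c
        rw [mul_comm' a b, mul_comm' a c]
        exact mul_lt' ha hbc
      mul_lt_mul_of_pos_right := fun a ha b c hbc => mul_lt' ha hbc }
  have : CanonicallyOrderedAdd M :=
    { exists_add_of_le := by
        rintro a b (h | rfl)
        · obtain ⟨c, hc⟩ := lt_sub' h
          exact ⟨c, hc.symm⟩
        · exact ⟨0, (add_zero' a).symm⟩
      le_add_self := fun a b => by
        have := add_le_add_left (show (0 : M) ≤ b from nonneg' b) a
        rwa [zero_add] at this
      le_self_add := fun a b => by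
        have := add_le_add_right (show (0 : M) ≤ b from nonneg' b) a
        rwa [add_zero] at this }
  let _ : DiscreteSemiring M :=
    { one_le_of_pos := fun a h => discrete' h }
  have : Nonempty S := ⟨e 0⟩
  have : ModelRCA0 M S :=
    { induction := fun θ hθ v e h0 hs => by
        have := sat_axiom hT (.induction ⟨θ, hθ, rfl⟩) v e
        simp only [inductionAx, sat_imp, sat_and, sat_all, sat_instN, sat_ex, sat_subst] at this
        refine this ⟨h0, fun n hn => ?_⟩
        obtain ⟨y, hy⟩ := hs n hn
        refine ⟨y, (iff_of_eq (congrArg (fun w => Form.Sat (vcons y w) e θ) ?_)).1 hy⟩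
        funext k
        cases k <;> rfl
      comprehension := fun θ η hθ hη v e h => by
        have := sat_axiom hT (.comprehension ⟨θ, hθ, rfl⟩ ⟨η, hη, rfl⟩) v e
        simp only [comprehensionAx, sat_imp, sat_all, sat_exS, sat_iff, sat_upS, sat_ex] at this
        exact this h }
  exact h M S v₀ e

section Pairing

variable {M : Type} [DiscreteSemiring M]

/-! ### Pairing in a discretely ordered semiring -/

theorem lt_iff_succ_le {a b : M} : a < b ↔ a + 1 ≤ b := by
  constructor
  · intro h
    obtain ⟨c, rfl⟩ := exists_add_of_le h.le
    have hc : 0 < c := by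
      rcases eq_or_ne c 0 with rfl | hc
      · simp at h
      · exact pos_of_ne_zero hc
    exact add_le_add_right (DiscreteSemiring.one_le_of_pos c hc) a
  · exact fun h => (lt_add_one a).trans_le h

theorem lt_succ_iff_le {a b : M} : a < b + 1 ↔ a ≤ b := by
  rw [lt_iff_succ_le]
  exact add_le_add_iff_right 1

/-- The pairing function, in a structure. -/
def pr (a b : M) : M := (a + b) * (a + b) + a

theorem left_le_pr (a b : M) : a ≤ pr a b := le_add_self

theorem right_le_pr (a b : M) : b ≤ pr a b := by
  rcases eq_or_ne b 0 with rfl | hb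
  · exact zero_le
  have h1 : 1 ≤ a + b := le_add_left (DiscreteSemiring.one_le_of_pos b (pos_of_ne_zero hb))
  calc b ≤ (a + b) * 1 := by rw [mul_one]; exact le_add_self
    _ ≤ (a + b) * (a + b) := by gcongr
    _ ≤ pr a b := le_self_add

@[simp] theorem pr_inj {a b c d : M} : pr a b = pr c d ↔ a = c ∧ b = d := by
  have key {a b c d : M} (h : a + b < c + d) : pr a b < pr c d := by
    have h' := lt_iff_succ_le.1 h
    calc pr a b ≤ (a + b) * (a + b) + (a + b) := by unfold pr; gcongr; exact le_self_add
      _ < (a + b + 1) * (a + b + 1) := by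
        have : (a + b + 1) * (a + b + 1) = (a + b) * (a + b) + (a + b) + (a + b + 1) := by ring
        rw [this]
        exact lt_add_of_pos_right _ (by positivity)
      _ ≤ (c + d) * (c + d) := by gcongr
      _ ≤ pr c d := le_self_add
  constructor
  · intro h
    rcases lt_trichotomy (a + b) (c + d) with h' | h' | h'
    · exact ((key h').ne h).elim
    · unfold pr at h
      rw [h'] at h
      obtain rfl := add_left_cancel h
      exact ⟨rfl, add_left_cancel h'⟩
    · exact ((key h').ne h.symm).elim
  · rintro ⟨rfl, rfl⟩
    rfl

open Classical in
/-- The first component of a pair, and `0` if `z` is not a pair. -/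
noncomputable def π₁ (z : M) : M := if h : ∃ a b, z = pr a b then h.choose else 0

open Classical in
/-- The second component of a pair, and `0` if `z` is not a pair. -/
noncomputable def π₂ (z : M) : M := if h : ∃ a b, z = pr a b then h.choose_spec.choose else 0

@[simp] theorem π₁_pr (a b : M) : π₁ (pr a b) = a := by
  have h : ∃ c d, pr a b = pr c d := ⟨a, b, rfl⟩
  rw [π₁, dif_pos h]
  exact (pr_inj.1 h.choose_spec.choose_spec).1.symm

@[simp] theorem π₂_pr (a b : M) : π₂ (pr a b) = b := by
  have h : ∃ c d, pr a b = pr c d := ⟨a, b, rfl⟩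
  rw [π₂, dif_pos h]
  exact (pr_inj.1 h.choose_spec.choose_spec).2.symm

theorem π_of_not_pair {z : M} (h : ¬ ∃ a b, z = pr a b) : π₁ z = 0 ∧ π₂ z = 0 := by
  rw [π₁, π₂, dif_neg h, dif_neg h]
  exact ⟨rfl, rfl⟩

end Pairing

/-! ### Predicates and functions represented by sets of the model -/

section Rec

/-- The bounded quantifier `∃ x < t`. -/
def bex (t : Tm) (φ : Form) : Form := .ex (.var 0 ≺ t.up 1 ⋏ φ)

namespace IsBounded

variable {φ ψ : Form}

theorem neg (hφ : IsBounded φ) : IsBounded ∼φ := .imp hφ .bot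
theorem and (hφ : IsBounded φ) (hψ : IsBounded ψ) : IsBounded (φ ⋏ ψ) := (hφ.imp hψ.neg).neg
theorem or (hφ : IsBounded φ) (hψ : IsBounded ψ) : IsBounded (φ ⋎ ψ) := hφ.neg.imp hψ

end IsBounded

variable {M S : Type} [DiscreteSemiring M] [Membership M S]

@[simp] theorem sat_bex (v : ℕ → M) (e : ℕ → S) (t : Tm) (φ : Form) :
    (bex t φ).Sat v e ↔ ∃ x < t.val v, φ.Sat (vcons x v) e := by
  simp [bex]

@[simp] theorem val_pair (v : ℕ → M) (s t : Tm) : (pair s t).val v = pr (s.val v) (t.val v) := rfl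

/-- `z = (a, b)` for some `a`, `b` satisfying `φ`; here `b`, `a`, `z` are `x0`, `x1` and `x3`. -/
def splitF (φ : Form) : Form := bex (x1 + 1) (bex (x2 + 1) (x3 ≐ pair x1 x0 ⋏ φ))

theorem splitF_bounded {φ : Form} (h : IsBounded φ) : IsBounded (splitF φ) :=
  .bex _ (.bex _ (.and (.eq _ _) h))

theorem sat_splitF (v : ℕ → M) (e : ℕ → S) (y z : M) (φ : Form) :
    (splitF φ).Sat (vcons y (vcons z v)) e ↔
      ∃ a b, z = pr a b ∧ φ.Sat (vcons b (vcons a (vcons y (vcons z v)))) e := by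
  simp only [splitF, sat_bex, sat_and, sat_eq, val_pair, val_var, val_add, val_one, vcons_zero,
    vcons_one, vcons_two, vcons_three, lt_succ_iff_le]
  constructor
  · rintro ⟨a, -, b, -, h⟩
    exact ⟨a, b, h⟩
  · rintro ⟨a, b, rfl, h⟩
    exact ⟨a, left_le_pr a b, b, right_le_pr a b, rfl, h⟩

variable (S) in
/-- The predicate `P` is (the membership predicate of) a set of the model. By comprehension these
predicates are closed under every `Δ⁰₁` definition, so they play the role of the decidable
predicates, relative to the sets of the model. A predicate of several arguments is treated as a
predicate of one tuple: `P : M → M → Prop` is represented by `fun z => P (π₁ z) (π₂ z)`. The closure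
properties are tagged `fun_prop`, which proves most instances. -/
@[fun_prop]
def Rec (P : M → Prop) : Prop := ∃ X : S, ∀ z, z ∈ X ↔ P z

variable (S) in
/-- The graph of the function `f` is represented by a set of the model. -/
@[fun_prop]
def RecF (f : M → M) : Prop := ∃ F : S, ∀ a b, pr a b ∈ F ↔ f a = b

variable [ModelRCA0 M S]

theorem rec_of_bounded {P : M → Prop} {θ : Form} (hθ : IsBounded θ) (v : ℕ → M) (e : ℕ → S)
    (h : ∀ y n, θ.Sat (vcons y (vcons n v)) e ↔ P n) : Rec S P := by
  obtain ⟨X, hX⟩ := ModelRCA0.comprehension θ θ hθ hθ v e fun n => by simp [h]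
  exact ⟨X, fun n => by simp [hX, h]⟩

theorem recF_of_bounded {f : M → M} {θ : Form} (hθ : IsBounded θ) (v : ℕ → M) (e : ℕ → S)
    (h : ∀ a b y z, θ.Sat (vcons b (vcons a (vcons y (vcons z v)))) e ↔ f a = b) : RecF S f := by
  obtain ⟨F, hF⟩ := rec_of_bounded (P := fun z => ∃ a b, z = pr a b ∧ f a = b)
    (splitF_bounded hθ) v e fun y z => by simp only [sat_splitF, h]
  exact ⟨F, fun a b => by simp [hF, eq_comm]⟩

namespace Rec

variable {P Q : M → Prop}

theorem congr (hP : Rec S P) (h : ∀ z, P z ↔ Q z) : Rec S Q := by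
  obtain rfl : P = Q := funext fun z => propext (h z)
  exact hP

theorem mem_set (X : S) : Rec S fun z : M => z ∈ X := ⟨X, fun _ => Iff.rfl⟩

@[fun_prop]
theorem imp (hP : Rec S P) (hQ : Rec S Q) : Rec S fun z => P z → Q z := by
  obtain ⟨X, hX⟩ := hP
  obtain ⟨Y, hY⟩ := hQ
  exact rec_of_bounded (θ := x1 ∊ 0 ⟹ x1 ∊ 1) (.imp (.mem _ _) (.mem _ _)) 0
    (vcons X fun _ => Y) fun y n => by simp [hX, hY]

@[fun_prop]
theorem not (hP : Rec S P) : Rec S fun z => ¬ P z := by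
  obtain ⟨X, hX⟩ := hP
  exact rec_of_bounded (θ := ∼(x1 ∊ 0)) (.neg (.mem _ _)) 0 (fun _ => X)
    fun y n => by simp [hX]

@[fun_prop]
theorem and (hP : Rec S P) (hQ : Rec S Q) : Rec S fun z => P z ∧ Q z :=
  (hP.imp hQ.not).not.congr fun _ => by simp

@[fun_prop]
theorem or (hP : Rec S P) (hQ : Rec S Q) : Rec S fun z => P z ∨ Q z :=
  (hP.not.imp hQ).congr fun z => by simp [or_iff_not_imp_left]

theorem comp {f : M → M} (hP : Rec S P) (hf : RecF S f) : Rec S fun z => P (f z) := by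
  obtain ⟨X, hX⟩ := hP
  obtain ⟨F, hF⟩ := hf
  obtain ⟨Y, hY⟩ := ModelRCA0.comprehension (M := M) (pair x1 x0 ∊ 0 ⋏ x0 ∊ 1)
    (pair x1 x0 ∊ 0 ⟹ x0 ∊ 1) (.and (.mem _ _) (.mem _ _)) (.imp (.mem _ _) (.mem _ _)) 0
    (vcons F fun _ => X) fun n => by simp [hF, hX]
  exact ⟨Y, fun n => by simp [hY, hF, hX]⟩

end Rec

namespace RecF

variable {f g h : M → M}

theorem congr (hf : RecF S f) (h : ∀ z, f z = g z) : RecF S g := by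
  obtain rfl : f = g := funext h
  exact hf

@[fun_prop]
theorem comp (hg : RecF S g) (hf : RecF S f) : RecF S fun z => g (f z) := by
  obtain ⟨G, hG⟩ := hg
  obtain ⟨F, hF⟩ := hf
  obtain ⟨Y, hY⟩ := ModelRCA0.comprehension (M := M)
    (splitF (pair x1 x2 ∊ 0 ⋏ pair x2 x0 ∊ 1)) (splitF (pair x1 x2 ∊ 0 ⟹ pair x2 x0 ∊ 1))
    (splitF_bounded (.and (.mem _ _) (.mem _ _))) (splitF_bounded (.imp (.mem _ _) (.mem _ _)))
    0 (vcons F fun _ => G) fun n => by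
      simp only [sat_splitF, sat_and, sat_imp, sat_mem, val_pair, val_var, vcons_zero, vcons_one,
        vcons_two, hF, hG]
      constructor
      · rintro ⟨y, a, b, rfl, rfl, h⟩ y
        exact ⟨a, b, rfl, by rintro rfl; exact h⟩
      · intro h
        obtain ⟨a, b, rfl, -⟩ := h 0
        obtain ⟨a', b', h', h''⟩ := h (f a)
        obtain ⟨rfl, rfl⟩ := pr_inj.1 h'
        exact ⟨_, _, _, rfl, rfl, h'' rfl⟩
  refine ⟨Y, fun a b => ?_⟩
  simp [hY, sat_splitF, hF, hG, eq_comm]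

@[fun_prop]
theorem pair (hf : RecF S f) (hg : RecF S g) : RecF S fun z => pr (f z) (g z) := by
  obtain ⟨F, hF⟩ := hf
  obtain ⟨G, hG⟩ := hg
  refine recF_of_bounded (θ := bex (x0 + 1) (bex (x1 + 1)
    (x2 ≐ SOArith.pair x1 x0 ⋏ SOArith.pair x3 x1 ∊ 0 ⋏ SOArith.pair x3 x0 ∊ 1)))
    (.bex _ (.bex _ (.and (.eq _ _) (.and (.mem _ _) (.mem _ _))))) 0 (vcons F fun _ => G)
    fun a b y z => ?_
  simp only [sat_bex, sat_and, sat_eq, sat_mem, val_pair, val_var, val_add, val_one, vcons_zero,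
    vcons_one, vcons_two, vcons_three, lt_succ_iff_le, hF, hG]
  constructor
  · rintro ⟨u, -, w, -, rfl, rfl, rfl⟩
    rfl
  · rintro rfl
    exact ⟨_, left_le_pr _ _, _, right_le_pr _ _, rfl, rfl, rfl⟩

variable [Nonempty S]

@[fun_prop]
theorem id : RecF S fun z : M => z :=
  recF_of_bounded (θ := x1 ≐ x0) (.eq _ _) 0 (fun _ => Classical.arbitrary S) (by simp)

@[fun_prop]
theorem const (c : M) : RecF S fun _ : M => c :=
  recF_of_bounded (θ := x4 ≐ x0) (.eq _ _) (fun _ => c) (fun _ => Classical.arbitrary S)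
    (by simp)

/-- A term `t`, as a function of a pair. Its value at `(0, 0)` is the value at non-pairs. -/
theorem term (t : Tm) (h0 : ∀ v : ℕ → M, t.val (vcons 0 (vcons 0 v)) = 0)
    (g : M → M → M) (hg : ∀ (a b : M) (v : ℕ → M), t.val (vcons b (vcons a v)) = g a b) :
    RecF S fun z => g (π₁ z) (π₂ z) := by
  have hsplit (e : ℕ → S) (a b y z : M) (φ : Form) :
      (bex (x1 + 1) (bex (x2 + 1) (x3 ≐ SOArith.pair x1 x0 ⋏ φ))).Sat
        (vcons b (vcons a (vcons y (vcons z 0)))) e ↔ ∃ u w, a = pr u w ∧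
          φ.Sat (vcons w (vcons u (vcons b (vcons a (vcons y (vcons z 0)))))) e :=
    sat_splitF _ e b a φ
  refine recF_of_bounded (θ := splitF (x2 ≐ t) ⋎ (∼(splitF (x2 ≐ x2)) ⋏ x0 ≐ 0))
    (.or (splitF_bounded (.eq _ _)) (.and (.neg (splitF_bounded (.eq _ _))) (.eq _ _))) 0
    (fun _ => Classical.arbitrary S) fun a b y z => ?_
  simp only [sat_or, sat_and, sat_neg, sat_splitF, sat_eq, hg, val_var, val_zero, vcons_zero,
    vcons_two, and_true]
  by_cases h : ∃ u w, a = pr u w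
  · obtain ⟨u, w, rfl⟩ := h
    simp [eq_comm]
  · have h00 : g 0 0 = 0 := by rw [← hg 0 0 0, h0]
    have h1 (q : M → M → Prop) : ¬ ∃ u w, a = pr u w ∧ q u w :=
      fun ⟨u, w, h', _⟩ => h ⟨u, w, h'⟩
    simp only [h1, h, π_of_not_pair h, h00, false_or, not_false_eq_true, true_and]
    exact eq_comm

@[fun_prop]
theorem fst (hf : RecF S f) : RecF S fun z => π₁ (f z) :=
  (term x1 (by simp) (fun a _ => a) (by simp)).comp hf

@[fun_prop]
theorem snd (hf : RecF S f) : RecF S fun z => π₂ (f z) :=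
  (term x0 (by simp) (fun _ b => b) (by simp)).comp hf

@[fun_prop]
theorem add (hf : RecF S f) (hg : RecF S g) : RecF S fun z => f z + g z :=
  ((term (x1 + x0) (by simp) (· + ·) (by simp)).comp (hf.pair hg)).congr (by simp)

@[fun_prop]
theorem mul (hf : RecF S f) (hg : RecF S g) : RecF S fun z => f z * g z :=
  ((term (x1 * x0) (by simp) (· * ·) (by simp)).comp (hf.pair hg)).congr (by simp)

end RecF

namespace Rec

variable [Nonempty S] {f g : M → M}

@[fun_prop]
theorem lt (hf : RecF S f) (hg : RecF S g) : Rec S fun z => f z < g z := by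
  have : Rec S fun z : M => ∃ a b, z = pr a b ∧ a < b :=
    rec_of_bounded (θ := splitF (x1 ≺ x0)) (splitF_bounded (.lt _ _)) 0
      (fun _ => Classical.arbitrary S) fun y z => by simp [sat_splitF]
  exact (this.comp (hf.pair hg)).congr fun z => by simp

@[fun_prop]
theorem le (hf : RecF S f) (hg : RecF S g) : Rec S fun z => f z ≤ g z :=
  (lt hg hf).not.congr fun _ => not_lt

@[fun_prop]
theorem eq (hf : RecF S f) (hg : RecF S g) : Rec S fun z => f z = g z :=
  ((le hf hg).and (le hg hf)).congr fun _ => le_antisymm_iff.symm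

@[fun_prop]
theorem mem (X : S) (hf : RecF S f) : Rec S fun z => f z ∈ X := (mem_set X).comp hf

@[fun_prop]
theorem ball {P : M → M → Prop} (hf : RecF S f) (hP : Rec S fun z => P (π₁ z) (π₂ z)) :
    Rec S fun z => ∀ y < f z, P z y := by
  obtain ⟨X, hX⟩ := hP
  have : Rec S fun z : M => ¬ ∃ a b, z = pr a b ∧ ∃ y < b, ¬ P a y := by
    refine rec_of_bounded (θ := ∼(splitF (bex x0 (∼(pair x2 x0 ∊ 0)))))
      (.neg (splitF_bounded (.bex _ (.neg (.mem _ _))))) 0 (fun _ => X) fun y z => ?_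
    simp [sat_splitF, hX]
  exact (this.comp (RecF.id.pair hf)).congr fun z => by simp

@[fun_prop]
theorem bex {P : M → M → Prop} (hf : RecF S f) (hP : Rec S fun z => P (π₁ z) (π₂ z)) :
    Rec S fun z => ∃ y < f z, P z y :=
  (ball (P := fun z y => ¬ P z y) hf hP.not).not.congr fun z => by simp

@[fun_prop]
theorem dvd (hf : RecF S f) (hg : RecF S g) : Rec S fun z => f z ∣ g z := by
  have : Rec S fun z => ∃ y < g z + 1, g z = f z * y :=
    bex (hg.add (.const 1)) (.eq (hg.comp (.fst .id)) ((hf.comp (.fst .id)).mul (.snd .id)))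
  refine this.congr fun z => ⟨fun ⟨y, _, h⟩ => ⟨y, h⟩, fun ⟨y, h⟩ => ?_⟩
  rcases eq_or_ne (f z) 0 with h0 | h0
  · exact ⟨0, by positivity, by rw [h, h0, zero_mul, zero_mul]⟩
  · refine ⟨y, lt_succ_iff_le.2 ?_, h⟩
    rw [h]
    exact le_mul_of_one_le_left' (DiscreteSemiring.one_le_of_pos _ (pos_of_ne_zero h0))

omit [Nonempty S] in
/-- `Δ⁰₁` comprehension. -/
theorem of_delta {P : M → Prop} {Q R : M → M → Prop} (hQ : Rec S fun z => Q (π₁ z) (π₂ z))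
    (hR : Rec S fun z => R (π₁ z) (π₂ z)) (hPQ : ∀ z, P z ↔ ∃ y, Q z y)
    (hPR : ∀ z, P z ↔ ∀ y, R z y) : Rec S P := by
  obtain ⟨X, hX⟩ := hQ
  obtain ⟨Y, hY⟩ := hR
  obtain ⟨Z, hZ⟩ := ModelRCA0.comprehension (M := M) (pair x1 x0 ∊ 0) (pair x1 x0 ∊ 1)
    (.mem _ _) (.mem _ _) 0 (vcons X fun _ => Y) fun n => by simp [hX, hY, ← hPQ, ← hPR]
  exact ⟨Z, fun n => by simp [hZ, hX, ← hPQ]⟩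

end Rec

@[fun_prop]
theorem RecF.ite {P : M → Prop} [DecidablePred P] {f g : M → M} (hP : Rec S P) (hf : RecF S f)
    (hg : RecF S g) : RecF S fun z => if P z then f z else g z := by
  obtain ⟨F, hF⟩ := hf
  obtain ⟨G, hG⟩ := hg
  obtain ⟨X, hX⟩ := hP
  refine recF_of_bounded 
    (θ := (x1 ∊ 2 ⟹ SOArith.pair x1 x0 ∊ 0) ⋏ (∼(x1 ∊ 2) ⟹ SOArith.pair x1 x0 ∊ 1))
    (.and (.imp (.mem _ _) (.mem _ _)) (.imp (.neg (.mem _ _)) (.mem _ _))) 0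
    (vcons F (vcons G fun _ => X)) fun a b y z => ?_
  by_cases h : P a <;> simp [hF, hG, hX, h]

/-! ### Induction -/

variable (S) in
/-- `Σ⁰₁` induction. -/
theorem sigma_induction {P : M → M → Prop} (hP : Rec S fun z => P (π₁ z) (π₂ z))
    (h0 : ∃ y, P 0 y) (hs : ∀ n, (∃ y, P n y) → ∃ y, P (n + 1) y) (n : M) : ∃ y, P n y := by
  obtain ⟨X, hX⟩ := hP
  have := ModelRCA0.induction (M := M) (pair x1 x0 ∊ 0) (.mem _ _) 0 (fun _ => X)
  simp only [sat_mem, val_pair, val_var, vcons_zero, vcons_one, hX, π₁_pr, π₂_pr] at this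
  exact this h0 hs n

variable [Nonempty S]

variable (S) in
theorem rec_induction {P : M → Prop} (hP : Rec S P) (h0 : P 0) (hs : ∀ n, P n → P (n + 1))
    (n : M) : P n := by
  have := sigma_induction S (P := fun n _ => P n) (hP.comp (.fst .id)) ⟨0, h0⟩
    (fun n ⟨_, h⟩ => ⟨0, hs n h⟩) n
  exact this.elim fun _ h => h

variable (S) in
/-- The least number principle. -/
theorem exists_least {P : M → Prop} (hP : Rec S P) {a : M} (ha : P a) :
    ∃ b, P b ∧ ∀ c < b, ¬ P c := by
  by_contra! h
  have key : ∀ n : M, ∀ y < n, ¬ P y := by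
    refine rec_induction S (.ball .id (hP.comp (.snd .id)).not) (fun y hy => ?_) fun n ih y hy => ?_
    · exact (not_lt_zero hy).elim
    · rcases (lt_succ_iff_le.1 hy).lt_or_eq with hy | rfl
      · exact ih y hy
      · intro hy
        obtain ⟨c, hc, hPc⟩ := h y hy
        exact ih c hc hPc
  exact key (a + 1) a (lt_add_one a) ha

end Rec

/-! ### Codes of finite sets -/

section Divisibility

variable {M : Type} [DiscreteSemiring M]

theorem dvd_right_of_dvd_add {a b c : M} (h : a ∣ b + c) (hb : a ∣ b) : a ∣ c := by
  obtain ⟨x, rfl⟩ := hb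
  obtain ⟨y, hy⟩ := h
  rcases eq_or_ne a 0 with rfl | ha
  · simp only [zero_mul, zero_add] at hy
    rw [hy]
  have hxy : x ≤ y := by
    by_contra hlt
    have := mul_lt_mul_of_pos_left (not_le.1 hlt) (pos_of_ne_zero ha)
    rw [← hy] at this
    exact this.not_ge le_self_add
  obtain ⟨w, rfl⟩ := exists_add_of_le hxy
  rw [mul_add] at hy
  exact ⟨w, add_left_cancel hy⟩

theorem dvd_of_dvd_mul_modulus {m i n : M} (h : m * (i + 1) + 1 ∣ n * m) :
    m * (i + 1) + 1 ∣ n := by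
  have h₁ : m * (i + 1) + 1 ∣ n * m * (i + 1) + n := ⟨n, by ring⟩
  exact dvd_right_of_dvd_add h₁ (h.mul_right _)

/-- The moduli `m (i + 1) + 1`, for `i < K`, are pairwise coprime if all positive numbers up to `K`
divide `m`. -/
theorem dvd_of_dvd_mul_of_ne {K m i j n : M} (hm : ∀ t < K, t + 1 ∣ m) (hi : i < K) (hj : j < K)
    (hij : i ≠ j) (h : m * (i + 1) + 1 ∣ n * (m * (j + 1) + 1)) : m * (i + 1) + 1 ∣ n := by
  have main {t : M} (ht : t + 1 ∣ m) (h : m * (i + 1) + 1 ∣ n * (t + 1) * m) :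
      m * (i + 1) + 1 ∣ n := by
    obtain ⟨s, hs⟩ := ht
    refine dvd_of_dvd_mul_modulus ?_
    have := (dvd_of_dvd_mul_modulus h).mul_right s
    rwa [mul_assoc, ← hs] at this
  rcases lt_or_gt_of_ne hij with hlt | hlt
  · obtain ⟨t, rfl⟩ := exists_add_of_le (lt_iff_succ_le.1 hlt)
    refine main (t := t) (hm t (lt_of_le_of_lt le_add_self hj)) ?_
    have h' : m * (i + 1) + 1 ∣ n * (m * (i + 1) + 1) + n * (t + 1) * m := by
      convert h using 1
      ring
    exact dvd_right_of_dvd_add h' (dvd_mul_left _ _)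
  · obtain ⟨t, rfl⟩ := exists_add_of_le (lt_iff_succ_le.1 hlt)
    refine main (t := t) (hm t (lt_of_le_of_lt le_add_self hi)) ?_
    refine dvd_right_of_dvd_add ?_ h
    exact ⟨n, by ring⟩

end Divisibility

section FiniteSets

variable {M : Type} [DiscreteSemiring M]

/-- `c` has the form `(k, m, n)`. -/
def IsTriple (c : M) : Prop := ∃ k m n, c = pr k (pr m n)

/-- `i` belongs to the finite set represented by `c`. -/
def FMem (i c : M) : Prop := ∃ k m n, c = pr k (pr m n) ∧ i < k ∧ m * (i + 1) + 1 ∣ n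

/-- `c` is the least representative of a finite set. -/
def IsCode (c : M) : Prop := IsTriple c ∧ ¬ ∃ x < c, IsTriple x ∧ ∀ i, FMem i x ↔ FMem i c

theorem isTriple_iff {c : M} :
    IsTriple c ↔ c = pr (π₁ c) (pr (π₁ (π₂ c)) (π₂ (π₂ c))) := by
  constructor
  · rintro ⟨k, m, n, rfl⟩
    simp
  · exact fun h => ⟨_, _, _, h⟩

theorem fMem_iff {i c : M} :
    FMem i c ↔ IsTriple c ∧ i < π₁ c ∧ π₁ (π₂ c) * (i + 1) + 1 ∣ π₂ (π₂ c) := by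
  constructor
  · rintro ⟨k, m, n, rfl, h⟩
    simpa [IsTriple] using h
  · rintro ⟨⟨k, m, n, rfl⟩, h⟩
    exact ⟨k, m, n, rfl, by simpa using h⟩

theorem FMem.lt {i c : M} (h : FMem i c) : i < c := by
  obtain ⟨k, m, n, rfl, h, -⟩ := h
  exact h.trans_le (left_le_pr _ _)

theorem FMem.left_lt {i j c : M} (h : FMem (pr i j) c) : i < c := (left_le_pr i j).trans_lt h.lt

theorem FMem.right_lt {i j c : M} (h : FMem (pr i j) c) : j < c := (right_le_pr i j).trans_lt h.lt

theorem IsCode.ext {c d : M} (hc : IsCode c) (hd : IsCode d) (h : ∀ i, FMem i c ↔ FMem i d) :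
    c = d := by
  rcases lt_trichotomy c d with hlt | heq | hlt
  · exact (hd.2 ⟨c, hlt, hc.1, h⟩).elim
  · exact heq
  · exact (hc.2 ⟨d, hlt, hd.1, fun i => (h i).symm⟩).elim

theorem pr_le_pr {a b c d : M} (h : a ≤ c) (h' : b ≤ d) : pr a b ≤ pr c d := by
  unfold pr
  gcongr

variable {S : Type} [Membership M S] [ModelRCA0 M S] [Nonempty S]

@[fun_prop]
theorem Rec.isTriple {f : M → M} (hf : RecF S f) : Rec S fun z => IsTriple (f z) := by
  simp only [isTriple_iff]
  fun_prop

@[fun_prop]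
theorem Rec.fMem {f g : M → M} (hf : RecF S f) (hg : RecF S g) :
    Rec S fun z => FMem (f z) (g z) := by
  simp only [fMem_iff]
  fun_prop

/-- Bounded quantification over the elements of a coded finite set. -/
@[fun_prop]
theorem Rec.forall_fMem {f : M → M} {P : M → M → Prop} (hf : RecF S f)
    (hP : Rec S fun z => P (π₁ z) (π₂ z)) : Rec S fun z => ∀ u, FMem u (f z) → P z u := by
  have : Rec S fun z => ∀ u < f z, FMem u (f z) → P z u :=
    .ball hf (.imp (by fun_prop) hP)
  exact this.congr fun z => ⟨fun h u hu => h u hu.lt hu, fun h u _ => h u⟩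

@[fun_prop]
theorem Rec.exists_fMem {f : M → M} {P : M → M → Prop} (hf : RecF S f)
    (hP : Rec S fun z => P (π₁ z) (π₂ z)) : Rec S fun z => ∃ u, FMem u (f z) ∧ P z u :=
  (Rec.forall_fMem (P := fun z u => ¬ P z u) hf hP.not).not.congr fun z => by simp

@[fun_prop]
theorem Rec.isCode {f : M → M} (hf : RecF S f) : Rec S fun z => IsCode (f z) := by
  have : Rec S fun c : M => IsTriple c ∧ ¬ ∃ x < c, IsTriple x ∧
      ((∀ i, FMem i x → FMem i c) ∧ ∀ i, FMem i c → FMem i x) := by fun_prop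
  refine (this.comp hf).congr fun z => ?_
  simp only [IsCode, iff_iff_implies_and_implies, forall_and]

variable (S) in
theorem exists_common_multiple {f : M → M} (hf : RecF S f) (hpos : ∀ i, 0 < f i) (K : M) :
    ∃ N, 0 < N ∧ ∀ i < K, f i ∣ N := by
  refine sigma_induction S (P := fun n y => 0 < y ∧ ∀ i < n, f i ∣ y) (by fun_prop)
    ⟨1, zero_lt_one, fun i hi => (not_lt_zero hi).elim⟩ ?_ K
  rintro n ⟨N, hN, h⟩
  refine ⟨N * f n, mul_pos hN (hpos n), fun i hi => ?_⟩
  rcases (lt_succ_iff_le.1 hi).lt_or_eq with hi | rfl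
  · exact (h i hi).mul_right _
  · exact dvd_mul_left _ _

variable (S) in
/-- The codes of the sets bounded by `K` are bounded. A set `D` is represented by the least positive
`n` that is a multiple of the moduli with indices in `D`: by coprimality, minimality of `n` excludes
the other moduli. -/
theorem exists_code_le (K : M) : ∃ B : M, ∀ D : M → Prop, Rec S D → (∀ i, D i → i < K) →
    ∃ c ≤ B, IsCode c ∧ ∀ i, FMem i c ↔ D i := by
  obtain ⟨m, hm, hdvd⟩ := exists_common_multiple S (f := fun i : M => i + 1) (by fun_prop)
    (fun i => by positivity) K
  obtain ⟨N, hN, hNdvd⟩ := exists_common_multiple S (f := fun i : M => m * (i + 1) + 1)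
    (by fun_prop) (fun i => by positivity) K
  refine ⟨pr K (pr m N), fun D ⟨X, hX⟩ hK => ?_⟩
  obtain rfl : (· ∈ X) = D := funext fun i => propext (hX i)
  obtain ⟨n, ⟨hn, hnD⟩, hmin⟩ := exists_least S
    (P := fun n : M => 0 < n ∧ ∀ i < K, i ∈ X → m * (i + 1) + 1 ∣ n)
    (by fun_prop)
    ⟨hN, fun i hi _ => hNdvd i hi⟩
  have hnN : n ≤ N := by
    by_contra h
    exact hmin N (not_le.1 h) ⟨hN, fun i hi _ => hNdvd i hi⟩
  have hrep (i : M) : FMem i (pr K (pr m n)) ↔ i ∈ X := by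
    constructor
    · rintro ⟨k, m', n', heq, hik, hi⟩
      obtain ⟨rfl, h'⟩ := pr_inj.1 heq
      obtain ⟨rfl, rfl⟩ := pr_inj.1 h'
      by_contra hDi
      obtain ⟨n', rfl⟩ := hi
      have hn' : 0 < n' := pos_of_mul_pos_right hn zero_le
      refine hmin n' ?_ ⟨hn', fun j hj hDj => ?_⟩
      · have : 1 < m * (i + 1) + 1 := lt_add_of_pos_left 1 (by positivity)
        exact lt_mul_of_one_lt_left hn' this
      · refine dvd_of_dvd_mul_of_ne hdvd hj hik ?_ (by rw [mul_comm n']; exact hnD j hj hDj)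
        rintro rfl
        exact hDi hDj
    · exact fun h => ⟨_, _, _, rfl, hK i h, hnD i (hK i h) h⟩
  obtain ⟨c, ⟨hc, hcD⟩, hcmin⟩ := exists_least S
    (P := fun c : M => IsTriple c ∧ ((∀ i, FMem i c → i ∈ X) ∧ ∀ i < K, i ∈ X → FMem i c))
    (by fun_prop)
    ⟨⟨_, _, _, rfl⟩, fun i => (hrep i).1, fun i _ => (hrep i).2⟩
  have hcD' (i : M) : FMem i c ↔ i ∈ X := ⟨hcD.1 i, fun h => hcD.2 i (hK i h) h⟩
  refine ⟨c, ?_, ⟨hc, ?_⟩, hcD'⟩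
  · refine le_trans (not_lt.1 fun h => ?_) (pr_le_pr le_rfl (pr_le_pr le_rfl hnN))
    exact hcmin _ h ⟨⟨_, _, _, rfl⟩, fun i => (hrep i).1, fun i _ => (hrep i).2⟩
  · rintro ⟨x, hx, hxt, hxc⟩
    refine hcmin x hx ⟨hxt, fun i hi => (hcD' i).1 ((hxc i).1 hi), fun i _ hi => ?_⟩
    exact (hxc i).2 ((hcD' i).2 hi)

theorem exists_code {D : M → Prop} (hD : Rec S D) {K : M} (hK : ∀ i, D i → i < K) :
    ∃ c, IsCode c ∧ ∀ i, FMem i c ↔ D i := by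
  obtain ⟨B, hB⟩ := exists_code_le S K
  obtain ⟨c, -, hc⟩ := hB D hD hK
  exact ⟨c, hc⟩

/-- `s` is the code of a finite sequence of length `l`. -/
def IsSeq (s l : M) : Prop :=
  IsCode s ∧ (∀ u, FMem u s → ∃ i y, u = pr i y ∧ i < l) ∧
    ∀ i, i < l → ∃ y, FMem (pr i y) s ∧ ∀ y', FMem (pr i y') s → y' = y

theorem exists_seq {g : M → M} (hg : RecF S g) {l B : M} (hB : ∀ i < l, g i ≤ B) :
    ∃ s, IsSeq s l ∧ ∀ i y, FMem (pr i y) s ↔ i < l ∧ y = g i := by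
  obtain ⟨s, hs, hsg⟩ := exists_code (S := S) (K := pr l B + 1)
    (D := fun u => u = pr (π₁ u) (π₂ u) ∧ π₁ u < l ∧ π₂ u = g (π₁ u)) (by fun_prop)
    (fun u ⟨h, hl, hu⟩ => by
      rw [h]
      exact lt_succ_iff_le.2 (pr_le_pr hl.le (hu ▸ hB _ hl)))
  have hs' (i y : M) : FMem (pr i y) s ↔ i < l ∧ y = g i := by simp [hsg]
  refine ⟨s, ⟨hs, fun u hu => ?_, fun i hi => ⟨g i, (hs' _ _).2 ⟨hi, rfl⟩, fun y' h => ?_⟩⟩, hs'⟩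
  · obtain ⟨h, hl, -⟩ := (hsg u).1 hu
    exact ⟨_, _, h, hl⟩
  · exact ((hs' _ _).1 h).2

end FiniteSets

/-! ### Weak orders and their enumeration -/

section WeakOrders

variable {M S : Type} [DiscreteSemiring M] [Membership M S]

/-- `r` is the code of a weak order on `X`. -/
def IsWO (X : S) (r : M) : Prop :=
  IsCode r ∧ (∀ u, FMem u r → ∃ a b, u = pr a b ∧ a ∈ X ∧ b ∈ X) ∧
    (∀ a b, a ∈ X ∧ b ∈ X → FMem (pr a b) r ∨ FMem (pr b a) r) ∧
    ∀ a b c, FMem (pr a b) r ∧ FMem (pr b c) r → FMem (pr a c) r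

/-- `p` lists the weak orders on `X` without repetitions, and `l` is its length. -/
def IsPerm (X : S) (p l : M) : Prop :=
  IsSeq p l ∧ (∀ i y, FMem (pr i y) p → IsWO X y) ∧
    ∀ r, IsWO X r → ∃ i, FMem (pr i r) p ∧ ∀ j, FMem (pr j r) p → j = i

variable [ModelRCA0 M S] [Nonempty S] {X : S} {L : M}

theorem Rec.isWO (hX : ∀ a ∈ X, a < L) {f : M → M} (hf : RecF S f) :
    Rec S fun z => IsWO X (f z) := by
  have : Rec S fun r : M => IsCode r ∧
      (∀ u, FMem u r → u = pr (π₁ u) (π₂ u) ∧ π₁ u ∈ X ∧ π₂ u ∈ X) ∧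
      (∀ a < L, ∀ b < L, a ∈ X ∧ b ∈ X → FMem (pr a b) r ∨ FMem (pr b a) r) ∧
      ∀ a < r, ∀ b < r, ∀ c < r, FMem (pr a b) r ∧ FMem (pr b c) r → FMem (pr a c) r := by
    fun_prop
  refine (this.comp hf).congr fun z => and_congr_right' (and_congr ?_ (and_congr ?_ ?_))
  · refine forall₂_congr fun u _ => ⟨fun h => ⟨_, _, h⟩, ?_⟩
    rintro ⟨a, b, rfl, h⟩
    simpa using h
  · exact ⟨fun h a b hab => h a (hX a hab.1) b (hX b hab.2) hab, fun h a _ b _ => h a b⟩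
  · exact ⟨fun h a b c hr => h a hr.1.left_lt b hr.1.right_lt c hr.2.right_lt hr,
      fun h a _ b _ c _ => h a b c⟩

theorem pr_mem_bound (hX : ∀ a ∈ X, a < L) {u : M} (h : ∃ a b, u = pr a b ∧ a ∈ X ∧ b ∈ X) :
    u < pr L L + 1 := by
  obtain ⟨a, b, rfl, ha, hb⟩ := h
  exact lt_succ_iff_le.2 (pr_le_pr (hX a ha).le (hX b hb).le)

/-- There are only boundedly many weak orders on a finite set. -/
theorem exists_bound_isWO (hX : ∀ a ∈ X, a < L) : ∃ B : M, ∀ r, IsWO X r → r < B := by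
  obtain ⟨B, hB⟩ := exists_code_le S (pr L L + 1)
  refine ⟨B + 1, fun r hr => lt_succ_iff_le.2 ?_⟩
  obtain ⟨c, hcB, hc, hcr⟩ := hB (fun u => FMem u r) (by fun_prop)
    fun u hu => pr_mem_bound hX (hr.2.1 u hu)
  rwa [hr.1.ext hc fun i => (hcr i).symm]

/-- The weak order induced by a ranking. -/
theorem exists_isWO_of_rank (hX : ∀ a ∈ X, a < L) {h : M → M} (hh : RecF S h) :
    ∃ r, IsWO X r ∧ ∀ a ∈ X, ∀ b ∈ X, FMem (pr a b) r ↔ h a ≤ h b := by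
  obtain ⟨r, hr, hrD⟩ := exists_code (S := S) (K := pr L L + 1)
    (D := fun u => u = pr (π₁ u) (π₂ u) ∧ (π₁ u ∈ X ∧ π₂ u ∈ X) ∧ h (π₁ u) ≤ h (π₂ u))
    (by fun_prop) (fun u ⟨h₁, h₂, _⟩ => pr_mem_bound hX ⟨_, _, h₁, h₂⟩)
  have hr' (a b : M) : FMem (pr a b) r ↔ (a ∈ X ∧ b ∈ X) ∧ h a ≤ h b := by simp [hrD]
  refine ⟨r, ⟨hr, fun u hu => ?_, fun a b hab => ?_, fun a b c hab => ?_⟩, fun a ha b hb => ?_⟩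
  · obtain ⟨h₁, h₂, -⟩ := (hrD u).1 hu
    exact ⟨_, _, h₁, h₂⟩
  · simp only [hr', hab, and_self, true_and]
    exact le_total _ _
  · simp only [hr'] at hab ⊢
    exact ⟨⟨hab.1.1.1, hab.2.1.2⟩, hab.1.2.trans hab.2.2⟩
  · simp [hr', ha, hb]

/-- `p` is an injective sequence of weak orders of length `l ≥ m` which has the value `g i` at each
`i < m`, and which lists all weak orders with a code below `b`. -/
def IsPartialPerm (X : S) (m : M) (g : M → M) (b p l : M) : Prop :=
  IsCode p ∧ m ≤ l ∧ (∀ i < l, ∃ u, FMem u p ∧ u = pr i (π₂ u)) ∧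
    (∀ u, FMem u p → (u = pr (π₁ u) (π₂ u) ∧ π₁ u < l ∧ IsWO X (π₂ u)) ∧
      ∀ w, FMem w p → (π₁ u = π₁ w ∨ π₂ u = π₂ w) → u = w) ∧
    (∀ i < m, FMem (pr i (g i)) p) ∧
    ∀ r < b, IsWO X r → ∃ u, FMem u p ∧ π₂ u = r

theorem exists_isPartialPerm (hX : ∀ a ∈ X, a < L) {m : M} {g : M → M} (hg : RecF S g)
    (hgW : ∀ i < m, IsWO X (g i)) (hinj : ∀ i < m, ∀ j < m, g i = g j → i = j) (b : M) :
    ∃ z, IsPartialPerm X m g b (π₁ z) (π₂ z) := by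
  obtain ⟨B, hB⟩ := exists_bound_isWO hX
  refine sigma_induction S (P := fun b z => IsPartialPerm X m g b (π₁ z) (π₂ z)) ?_ ?_ ?_ b
  · have hW : Rec S fun z => IsWO X (π₂ z) := Rec.isWO hX (by fun_prop)
    have hW' : Rec S fun z => IsWO X (π₂ (π₂ z)) := Rec.isWO hX (by fun_prop)
    unfold IsPartialPerm
    fun_prop
  · obtain ⟨s, hs, hsg⟩ := exists_seq hg (l := m) (B := B) fun i hi => (hB _ (hgW i hi)).le
    have hs' (u : M) (hu : FMem u s) : u = pr (π₁ u) (π₂ u) ∧ π₁ u < m ∧ π₂ u = g (π₁ u) := by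
      obtain ⟨i, y, rfl, -⟩ := hs.2.1 u hu
      simpa using (hsg _ _).1 hu
    refine ⟨pr s m, ?_⟩
    simp only [π₁_pr, π₂_pr]
    refine ⟨hs.1, le_rfl, fun i hi => ⟨pr i (g i), (hsg _ _).2 ⟨hi, rfl⟩, by simp⟩,
      fun u hu => ⟨?_, fun w hw h => ?_⟩, fun i hi => (hsg _ _).2 ⟨hi, rfl⟩,
      fun r hr => (not_lt_zero hr).elim⟩
    · obtain ⟨h₁, h₂, h₃⟩ := hs' u hu
      exact ⟨h₁, h₂, h₃ ▸ hgW _ h₂⟩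
    · obtain ⟨h₁, h₂, h₃⟩ := hs' u hu
      obtain ⟨h₁', h₂', h₃'⟩ := hs' w hw
      have : π₁ u = π₁ w := h.elim id fun h => hinj _ h₂ _ h₂' (by rw [← h₃, ← h₃', h])
      rw [h₁, h₁', h₃, h₃', this]
  · rintro n ⟨z, hz⟩
    obtain ⟨hp, hml, hdom, hval, hg', hsurj⟩ := hz
    set p := π₁ z
    set l := π₂ z
    by_cases hn : IsWO X n ∧ ¬ ∃ u, FMem u p ∧ π₂ u = n
    · obtain ⟨hnW, hn⟩ := hn
      obtain ⟨q, hq, hqp⟩ := exists_code (S := S) (K := p + pr l n + 1)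
        (D := fun u => FMem u p ∨ u = pr l n) (by fun_prop) (by
          rintro u (hu | rfl)
          · exact lt_succ_iff_le.2 (hu.lt.le.trans le_self_add)
          · exact lt_succ_iff_le.2 le_add_self)
      refine ⟨pr q (l + 1), ?_⟩
      simp only [π₁_pr, π₂_pr]
      refine ⟨hq, hml.trans le_self_add, fun i hi => ?_, fun u hu => ?_,
        fun i hi => (hqp _).2 (.inl (hg' i hi)), fun r hr hrW => ?_⟩
      · rcases (lt_succ_iff_le.1 hi).lt_or_eq with hi | rfl
        · obtain ⟨u, hu, h⟩ := hdom i hi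
          exact ⟨u, (hqp _).2 (.inl hu), h⟩
        · exact ⟨_, (hqp _).2 (.inr rfl), by simp⟩
      · rw [hqp] at hu
        refine ⟨?_, fun w hw h => ?_⟩
        · rcases hu with hu | rfl
          · obtain ⟨⟨h₁, h₂, h₃⟩, -⟩ := hval u hu
            exact ⟨h₁, h₂.trans (lt_add_one l), h₃⟩
          · simp [hnW]
        · rw [hqp] at hw
          rcases hu with hu | rfl <;> rcases hw with hw | rfl
          · exact (hval u hu).2 w hw h
          · simp only [π₁_pr, π₂_pr] at h
            rcases h with h | h
            · exact ((hval u hu).1.2.1.ne h).elim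
            · exact (hn ⟨u, hu, h⟩).elim
          · simp only [π₁_pr, π₂_pr] at h
            rcases h with h | h
            · exact ((hval w hw).1.2.1.ne h.symm).elim
            · exact (hn ⟨w, hw, h.symm⟩).elim
          · rfl
      · rcases (lt_succ_iff_le.1 hr).lt_or_eq with hr | rfl
        · obtain ⟨u, hu, h⟩ := hsurj r hr hrW
          exact ⟨u, (hqp _).2 (.inl hu), h⟩
        · exact ⟨_, (hqp _).2 (.inr rfl), by simp⟩
    · refine ⟨z, hp, hml, hdom, hval, hg', fun r hr hrW => ?_⟩
      rcases (lt_succ_iff_le.1 hr).lt_or_eq with hr | rfl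
      · exact hsurj r hr hrW
      · by_contra h
        exact hn ⟨hrW, h⟩

/-- An injective sequence of weak orders extends to an enumeration of all of them. -/
theorem exists_isPerm (hX : ∀ a ∈ X, a < L) {m : M} {g : M → M} (hg : RecF S g)
    (hgW : ∀ i < m, IsWO X (g i)) (hinj : ∀ i < m, ∀ j < m, g i = g j → i = j) :
    ∃ p l, IsPerm X p l ∧ m ≤ l ∧ ∀ i < m, FMem (pr i (g i)) p := by
  obtain ⟨B, hB⟩ := exists_bound_isWO hX
  obtain ⟨z, hp, hml, hdom, hval, hg', hsurj⟩ := exists_isPartialPerm hX hg hgW hinj B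
  refine ⟨π₁ z, π₂ z, ⟨⟨hp, fun u hu => ?_, fun i hi => ?_⟩, fun i y h => ?_, fun r hr => ?_⟩,
    hml, hg'⟩
  · exact ⟨_, _, (hval u hu).1.1, (hval u hu).1.2.1⟩
  · obtain ⟨u, hu, h⟩ := hdom i hi
    rw [h] at hu
    exact ⟨_, hu, fun y' hy' => (pr_inj.1 ((hval _ hy').2 _ hu (by simp))).2⟩
  · simpa using (hval _ h).1.2.2
  · obtain ⟨u, hu, rfl⟩ := hsurj r (hB r hr) hr
    have h := (hval u hu).1.1
    rw [h] at hu
    exact ⟨_, hu, fun j hj => (pr_inj.1 ((hval _ hj).2 _ hu (by simp))).1⟩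

end WeakOrders

/-! ### Countable societies and social welfare functions in a model -/

section Society

variable {M S : Type} [DiscreteSemiring M] [Membership M S]

/-- `x ≲_{i(v)} y`. -/
def Pref (F : S) (i v x y : M) : Prop := ∃ r, pr i (pr v r) ∈ F ∧ FMem (pr x y) r

/-- `x <_{i(v)} y`. -/
def SPref (F : S) (i v x y : M) : Prop := Pref F i v x y ∧ ¬ Pref F i v y x

/-- `x ≲_{σ(i)} y`. -/
def Soc (σ : S) (i x y : M) : Prop := ∃ r, pr i r ∈ σ ∧ FMem (pr x y) r

/-- `x <_{σ(i)} y`. -/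
def SSoc (σ : S) (i x y : M) : Prop := Soc σ i x y ∧ ¬ Soc σ i y x

/-- `i < k - 1` and `v ∈ A_{s(i)}`. -/
def InPart (A : S) (s k i v : M) : Prop := i + 1 < k ∧ ∃ n, FMem (pr i n) s ∧ pr n v ∈ A

/-- `i` is the only index with `InPart A s k i v`. -/
def OnlyPart (A : S) (s k i v : M) : Prop :=
  InPart A s k i v ∧ ∀ j, InPart A s k j v → j = i

/-- `f_n(v)` is the order which the quasi-partition `s` and the permutation `p` assign to `v`. -/
def IsMixedAt (A F : S) (p s k n v : M) : Prop :=
  (∀ i, OnlyPart A s k i v → ∃ r, FMem (pr i r) p ∧ pr n (pr v r) ∈ F) ∧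
    ((¬ ∃ i, OnlyPart A s k i v) → ∃ i r, i + 1 = k ∧ FMem (pr i r) p ∧ pr n (pr v r) ∈ F)

/-- `⟨V, X, A, F⟩` is a countable society, in which quasi-partitions are embedded by means of the
function `E`. The measurability function is only asserted to exist pointwise, and the domains and
ranges of both functions are left out: the argument does not depend on them. -/
structure IsSociety (V X A F E : S) : Prop where
  nonempty : ∃ v : M, v ∈ V
  finite : ∃ L : M, ∀ x, x ∈ X → x < L
  three : ∃ x y z : M, x ∈ X ∧ y ∈ X ∧ z ∈ X ∧ x ≠ y ∧ x ≠ z ∧ y ≠ z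
  sub : ∀ n v : M, pr n v ∈ A → v ∈ V
  univ : ∃ k : M, ∀ v, pr k v ∈ A ↔ v ∈ V
  union : ∀ i j : M, ∃ k, ∀ v, pr k v ∈ A ↔ pr i v ∈ A ∨ pr j v ∈ A
  inter : ∀ i j : M, ∃ k, ∀ v, pr k v ∈ A ↔ pr i v ∈ A ∧ pr j v ∈ A
  compl : ∀ i : M, ∃ k, ∀ v, pr k v ∈ A ↔ v ∈ V ∧ ¬ pr i v ∈ A
  singleton : ∀ d : M, d ∈ V → ∃ k, ∀ v, pr k v ∈ A ↔ v = d
  profile_mem : ∀ i u : M, pr i u ∈ F → ∃ v r, u = pr v r ∧ v ∈ V ∧ IsWO X r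
  profile_fun : ∀ i v : M, v ∈ V → ∃ r, pr i (pr v r) ∈ F ∧ ∀ r', pr i (pr v r') ∈ F → r' = r
  measurable : ∀ i x y : M, x ∈ X ∧ y ∈ X → ∃ k, ∀ v ∈ V, Pref F i v x y ↔ pr k v ∈ A
  mixed : ∀ p l s k : M, IsPerm X p l ∧ IsSeq s k ∧ 1 ≤ k ∧ k ≤ l →
    ∃ n, pr (pr p s) n ∈ E ∧ (∀ n', pr (pr p s) n' ∈ E → n' = n) ∧
      ∀ v, v ∈ V → IsMixedAt A F p s k n v

/-- `σ` is a social welfare function. -/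
structure IsSWF (V X F σ : S) : Prop where
  mem : ∀ u : M, u ∈ σ → ∃ i r, u = pr i r ∧ IsWO X r
  total : ∀ i : M, ∃ r, pr i r ∈ σ ∧ ∀ r', pr i r' ∈ σ → r' = r
  unanimity : ∀ x y i : M, x ∈ X ∧ y ∈ X ∧ (∀ v, v ∈ V → SPref F i v x y) → SSoc σ i x y
  independence : ∀ x y i j : M,
    (x ∈ X ∧ y ∈ X ∧ ∀ v a b, v ∈ V ∧ (a = x ∨ a = y) ∧ (b = x ∨ b = y) →
      (Pref F i v a b ↔ Pref F j v a b)) →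
    ∀ a b, (a = x ∨ a = y) ∧ (b = x ∨ b = y) → (Soc σ i a b ↔ Soc σ j a b)

/-- The coalition `A_n` is decisive. -/
def Decisive (X A F σ : S) (n : M) : Prop :=
  ∀ x y i, x ∈ X ∧ y ∈ X ∧ (∀ v, pr n v ∈ A → SPref F i v x y) → SSoc σ i x y

/-- The coalition `A_n` is decisive for the pair `x`, `y` when all others have the opposite
preference. -/
def AlmostDecisive (V A F σ : S) (x y n : M) : Prop :=
  ∀ i, (∀ v ∈ V, (pr n v ∈ A → SPref F i v x y) ∧ (¬ pr n v ∈ A → SPref F i v y x)) →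
    SSoc σ i x y

/-- On `X`, the order `f_i(v)` is the weak order given by the ranking `h`. -/
def Ranks (X F : S) (i v : M) (h : M → M) : Prop :=
  ∀ a ∈ X, ∀ b ∈ X, Pref F i v a b ↔ h a ≤ h b

theorem Ranks.sPref {X F : S} {i v : M} {h : M → M} (hr : Ranks X F i v h) {a b : M}
    (ha : a ∈ X) (hb : b ∈ X) : SPref F i v a b ↔ h a < h b := by
  rw [SPref, hr a ha b hb, hr b hb a ha, lt_iff_le_not_ge]

/-- The rankings `h` and `h'` induce different orders on `X`. -/
def DistinctOn (X : S) (h h' : M → M) : Prop :=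
  ∃ a ∈ X, ∃ b ∈ X, ¬ (h a ≤ h b ↔ h' a ≤ h' b)

/-- A ranking in which `x`, `y`, `z` have the given ranks. -/
def rank (x y z a b c : M) : M → M :=
  fun u => if u = x then a else if u = y then b else if u = z then c else 0

theorem lt_three_iff {j : M} : j < 3 ↔ j = 0 ∨ j = 1 ∨ j = 2 := by
  have h₃ : (3 : M) = 0 + 1 + 1 + 1 := by norm_num
  have h₂ : (2 : M) = 0 + 1 + 1 := by norm_num
  have h₁ : (1 : M) = 0 + 1 := by norm_num
  have h₀ : j ≤ 0 ↔ j = 0 := nonpos_iff_eq_zero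
  rw [h₃, lt_succ_iff_le, le_iff_lt_or_eq, lt_succ_iff_le, le_iff_lt_or_eq, lt_succ_iff_le, h₀,
    ← h₂, ← h₁, or_assoc]

theorem lt_four_iff {j : M} : j < 4 ↔ j = 0 ∨ j = 1 ∨ j = 2 ∨ j = 3 := by
  have h₄ : (4 : M) = 3 + 1 := by norm_num
  rw [h₄, lt_succ_iff_le, le_iff_lt_or_eq, lt_three_iff, or_assoc, or_assoc]

theorem succ_lt_four_iff {j : M} : j + 1 < 4 ↔ j = 0 ∨ j = 1 ∨ j = 2 := by
  have h₄ : (4 : M) = 3 + 1 := by norm_num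
  rw [h₄, add_lt_add_iff_right, lt_three_iff]

theorem lt_two_iff {j : M} : j < 2 ↔ j = 0 ∨ j = 1 := by
  have h₂ : (2 : M) = 0 + 1 + 1 := by norm_num
  have h₁ : (1 : M) = 0 + 1 := by norm_num
  have h₀ : j ≤ 0 ↔ j = 0 := nonpos_iff_eq_zero
  rw [h₂, lt_succ_iff_le, le_iff_lt_or_eq, lt_succ_iff_le, h₀, ← h₁]

theorem succ_lt_two_iff {j : M} : j + 1 < 2 ↔ j = 0 := by
  have h₂ : (2 : M) = 0 + 1 + 1 := by norm_num
  rw [h₂, add_lt_add_iff_right, lt_succ_iff_le]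
  exact nonpos_iff_eq_zero

theorem IsSeq.unique {s l i y y' : M} (hs : IsSeq s l) (h : FMem (pr i y) s)
    (h' : FMem (pr i y') s) : y = y' := by
  obtain ⟨j, z, hj, hi⟩ := hs.2.1 _ h
  obtain ⟨rfl, rfl⟩ := pr_inj.1 hj
  obtain ⟨w, -, hw⟩ := hs.2.2 _ hi
  rw [hw _ h, hw _ h']

namespace IsSociety

variable {V X A F E : S} (H : IsSociety V X A F E)

include H

theorem pref_iff {i v r : M} (hr : pr i (pr v r) ∈ F) (x y : M) :
    Pref F i v x y ↔ FMem (pr x y) r := by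
  obtain ⟨v', r', heq, hv, -⟩ := H.profile_mem _ _ hr
  obtain ⟨rfl, rfl⟩ := pr_inj.1 heq
  obtain ⟨w, -, hw⟩ := H.profile_fun i v hv
  refine ⟨fun ⟨r', hr', h⟩ => ?_, fun h => ⟨r, hr, h⟩⟩
  rwa [hw r hr, ← hw r' hr']

theorem pref_refl {i v x : M} (hv : v ∈ V) (hx : x ∈ X) : Pref F i v x x := by
  obtain ⟨r, hr, -⟩ := H.profile_fun i v hv
  obtain ⟨v', r', heq, -, hW⟩ := H.profile_mem _ _ hr
  obtain ⟨rfl, rfl⟩ := pr_inj.1 heq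
  rw [H.pref_iff hr]
  exact (hW.2.2.1 x x ⟨hx, hx⟩).elim id id

theorem exists_empty : ∃ k : M, ∀ v, ¬ pr k v ∈ A := by
  obtain ⟨k, hk⟩ := H.univ
  obtain ⟨m, hm⟩ := H.compl k
  exact ⟨m, fun v hv => ((hm v).1 hv).2 ((hk v).2 ((hm v).1 hv).1)⟩

theorem exists_diff (k n : M) : ∃ m, ∀ v, pr m v ∈ A ↔ pr k v ∈ A ∧ ¬ pr n v ∈ A := by
  obtain ⟨c, hc⟩ := H.compl n
  obtain ⟨m, hm⟩ := H.inter k c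
  refine ⟨m, fun v => ?_⟩
  rw [hm, hc]
  exact ⟨fun h => ⟨h.1, h.2.2⟩, fun h => ⟨h.1, H.sub _ _ h.1, h.2⟩⟩

/-- The voters outside `A_n` with `x <_{i(v)} y` form a coalition. -/
theorem exists_sPref_diff (n i : M) {x y : M} (hx : x ∈ X) (hy : y ∈ X) :
    ∃ m, ∀ v ∈ V, pr m v ∈ A ↔ SPref F i v x y ∧ ¬ pr n v ∈ A := by
  obtain ⟨k, hk⟩ := H.measurable i x y ⟨hx, hy⟩
  obtain ⟨l, hl⟩ := H.measurable i y x ⟨hy, hx⟩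
  obtain ⟨m, hm⟩ := H.exists_diff k l
  obtain ⟨q, hq⟩ := H.exists_diff m n
  exact ⟨q, fun v hv => by rw [hq, hm, SPref, hk v hv, hl v hv]⟩

variable [ModelRCA0 M S] [Nonempty S]

/-- Three disjoint coalitions and the remaining voters can be given four different orders. The
profile is obtained from a permutation of the weak orders that starts with these four, and the
quasi-partition `⟨n₁, n₂, n₃, 0⟩`, whose last entry is irrelevant. -/
theorem exists_profile {h₁ h₂ h₃ h₄ : M → M} (r₁ : RecF S h₁) (r₂ : RecF S h₂) (r₃ : RecF S h₃)
    (r₄ : RecF S h₄) (d₁₂ : DistinctOn X h₁ h₂) (d₁₃ : DistinctOn X h₁ h₃)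
    (d₁₄ : DistinctOn X h₁ h₄) (d₂₃ : DistinctOn X h₂ h₃) (d₂₄ : DistinctOn X h₂ h₄)
    (d₃₄ : DistinctOn X h₃ h₄) {n₁ n₂ n₃ : M} (e₁₂ : ∀ v, pr n₁ v ∈ A → ¬ pr n₂ v ∈ A)
    (e₁₃ : ∀ v, pr n₁ v ∈ A → ¬ pr n₃ v ∈ A) (e₂₃ : ∀ v, pr n₂ v ∈ A → ¬ pr n₃ v ∈ A) :
    ∃ i, ∀ v ∈ V, (pr n₁ v ∈ A → Ranks X F i v h₁) ∧ (pr n₂ v ∈ A → Ranks X F i v h₂) ∧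
      (pr n₃ v ∈ A → Ranks X F i v h₃) ∧
      (¬ pr n₁ v ∈ A → ¬ pr n₂ v ∈ A → ¬ pr n₃ v ∈ A → Ranks X F i v h₄) := by
  obtain ⟨L, hL⟩ := H.finite
  obtain ⟨R₁, w₁, hR₁⟩ := exists_isWO_of_rank hL r₁
  obtain ⟨R₂, w₂, hR₂⟩ := exists_isWO_of_rank hL r₂
  obtain ⟨R₃, w₃, hR₃⟩ := exists_isWO_of_rank hL r₃
  obtain ⟨R₄, w₄, hR₄⟩ := exists_isWO_of_rank hL r₄
  have ne {h h' : M → M} {R R' : M} (hd : DistinctOn X h h')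
      (hR : ∀ a ∈ X, ∀ b ∈ X, FMem (pr a b) R ↔ h a ≤ h b)
      (hR' : ∀ a ∈ X, ∀ b ∈ X, FMem (pr a b) R' ↔ h' a ≤ h' b) : R ≠ R' := by
    rintro rfl
    obtain ⟨a, ha, b, hb, hab⟩ := hd
    exact hab ((hR a ha b hb).symm.trans (hR' a ha b hb))
  have ne₁₂ := ne d₁₂ hR₁ hR₂
  have ne₁₃ := ne d₁₃ hR₁ hR₃
  have ne₁₄ := ne d₁₄ hR₁ hR₄
  have ne₂₃ := ne d₂₃ hR₂ hR₃
  have ne₂₄ := ne d₂₄ hR₂ hR₄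
  have ne₃₄ := ne d₃₄ hR₃ hR₄
  let g : M → M := fun i => if i = 0 then R₁ else if i = 1 then R₂ else if i = 2 then R₃ else R₄
  have g0 : g 0 = R₁ := by simp [g]
  have g1 : g 1 = R₂ := by simp [g]
  have g2 : g 2 = R₃ := by simp [g]
  have g3 : g 3 = R₄ := by simp [g]
  obtain ⟨p, l, hp, hl, hpg⟩ := exists_isPerm hL (g := g) (m := 4)
    (by fun_prop)
    (by
      intro i hi
      rcases lt_four_iff.1 hi with rfl | rfl | rfl | rfl
      · rwa [g0]
      · rwa [g1]
      · rwa [g2]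
      · rwa [g3])
    (by
      intro i hi j hj hij
      rcases lt_four_iff.1 hi with rfl | rfl | rfl | rfl <;>
        rcases lt_four_iff.1 hj with rfl | rfl | rfl | rfl <;>
        simp only [g0, g1, g2, g3] at hij <;>
        first | rfl | exact absurd hij ‹_› | exact absurd hij.symm ‹_›)
  let t : M → M := fun i => if i = 0 then n₁ else if i = 1 then n₂ else if i = 2 then n₃ else 0
  have t0 : t 0 = n₁ := by simp [t]
  have t1 : t 1 = n₂ := by simp [t]
  have t2 : t 2 = n₃ := by simp [t]
  obtain ⟨s, hs, hst⟩ := exists_seq (S := S) (g := t) (l := 4) (B := n₁ + n₂ + n₃)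
    (by fun_prop)
    (by
      intro i hi
      rcases lt_four_iff.1 hi with rfl | rfl | rfl | rfl
      · rw [t0, add_assoc]
        exact le_self_add
      · rw [t1, add_assoc, add_left_comm]
        exact le_self_add
      · rw [t2]
        exact le_add_self
      · simp [t])
  obtain ⟨i, -, -, hi⟩ := H.mixed p l s 4 ⟨hp, hs, by norm_num, hl⟩
  have hpv {j r : M} (hj : j < 4) (h : FMem (pr j r) p) : r = g j := hp.1.unique h (hpg j hj)
  have hin (j v : M) : InPart A s 4 j v ↔ (j = 0 ∨ j = 1 ∨ j = 2) ∧ pr (t j) v ∈ A := by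
    rw [InPart, succ_lt_four_iff]
    refine and_congr_right fun hj =>
      ⟨fun ⟨n, hn, h⟩ => ?_, fun h => ⟨t j, (hst _ _).2 ⟨?_, rfl⟩, h⟩⟩
    · rwa [← ((hst _ _).1 hn).2]
    · rw [lt_four_iff]
      tauto
  have hranks {v r R : M} {h : M → M} (hr : pr i (pr v r) ∈ F) (he : r = R)
      (hR : ∀ a ∈ X, ∀ b ∈ X, FMem (pr a b) R ↔ h a ≤ h b) : Ranks X F i v h := by
    intro a ha b hb
    rw [H.pref_iff hr, he, hR a ha b hb]
  refine ⟨i, fun v hv => ⟨fun hv₁ => ?_, fun hv₂ => ?_, fun hv₃ => ?_, fun hv₁ hv₂ hv₃ => ?_⟩⟩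
  · obtain ⟨r, hr, hir⟩ := (hi v hv).1 0 ⟨(hin _ _).2 ⟨.inl rfl, by rwa [t0]⟩, fun j hj => by
      rcases (hin _ _).1 hj with ⟨rfl | rfl | rfl, hj⟩
      · rfl
      · exact (e₁₂ v hv₁ (by rwa [t1] at hj)).elim
      · exact (e₁₃ v hv₁ (by rwa [t2] at hj)).elim⟩
    exact hranks hir ((hpv (by norm_num) hr).trans g0) hR₁
  · obtain ⟨r, hr, hir⟩ := (hi v hv).1 1 ⟨(hin _ _).2 ⟨.inr (.inl rfl), by rwa [t1]⟩, fun j hj => by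
      rcases (hin _ _).1 hj with ⟨rfl | rfl | rfl, hj⟩
      · exact (e₁₂ v (by rwa [t0] at hj) hv₂).elim
      · rfl
      · exact (e₂₃ v hv₂ (by rwa [t2] at hj)).elim⟩
    exact hranks hir ((hpv (by norm_num) hr).trans g1) hR₂
  · obtain ⟨r, hr, hir⟩ := (hi v hv).1 2 ⟨(hin _ _).2 ⟨.inr (.inr rfl), by rwa [t2]⟩, fun j hj => by
      rcases (hin _ _).1 hj with ⟨rfl | rfl | rfl, hj⟩
      · exact (e₁₃ v (by rwa [t0] at hj) hv₃).elim
      · exact (e₂₃ v (by rwa [t1] at hj) hv₃).elim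
      · rfl⟩
    exact hranks hir ((hpv (by norm_num) hr).trans g2) hR₃
  · obtain ⟨j, r, hj, hr, hir⟩ := (hi v hv).2 (by
      rintro ⟨j, hj, -⟩
      rcases (hin _ _).1 hj with ⟨rfl | rfl | rfl, hj⟩
      · exact hv₁ (by rwa [t0] at hj)
      · exact hv₂ (by rwa [t1] at hj)
      · exact hv₃ (by rwa [t2] at hj))
    have h₄ : (4 : M) = 3 + 1 := by norm_num
    rw [h₄] at hj
    obtain rfl := add_right_cancel hj
    exact hranks hir ((hpv (by norm_num) hr).trans g3) hR₄

end IsSociety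

namespace IsSWF

variable {V X F σ : S} (hσ : IsSWF V X F σ)

include hσ

theorem exists_isWO (i : M) :
    ∃ r, pr i r ∈ σ ∧ IsWO X r ∧ ∀ x y, Soc σ i x y ↔ FMem (pr x y) r := by
  obtain ⟨r, hr, huniq⟩ := hσ.total i
  obtain ⟨i', r', heq, hW⟩ := hσ.mem _ hr
  obtain ⟨rfl, rfl⟩ := pr_inj.1 heq
  refine ⟨r, hr, hW, fun x y => ⟨fun ⟨r', hr', h⟩ => ?_, fun h => ⟨r, hr, h⟩⟩⟩
  rwa [← huniq r' hr']

theorem soc_trans {i x y z : M} (h : Soc σ i x y) (h' : Soc σ i y z) : Soc σ i x z := by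
  obtain ⟨r, -, hW, hr⟩ := hσ.exists_isWO i
  rw [hr] at h h' ⊢
  exact hW.2.2.2 x y z ⟨h, h'⟩

theorem soc_total (i : M) {x y : M} (hx : x ∈ X) (hy : y ∈ X) : Soc σ i x y ∨ Soc σ i y x := by
  obtain ⟨r, -, hW, hr⟩ := hσ.exists_isWO i
  rw [hr, hr]
  exact hW.2.2.1 x y ⟨hx, hy⟩

theorem sSoc_of_soc_of_sSoc {i x y z : M} (h : Soc σ i x y) (h' : SSoc σ i y z) : SSoc σ i x z :=
  ⟨hσ.soc_trans h h'.1, fun hzx => h'.2 (hσ.soc_trans hzx h)⟩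

theorem sSoc_trans {i x y z : M} (h : SSoc σ i x y) (h' : SSoc σ i y z) : SSoc σ i x z :=
  hσ.sSoc_of_soc_of_sSoc h.1 h'

end IsSWF

end Society

/-! ### Decisive coalitions -/

section Arrow

variable {M S : Type} [DiscreteSemiring M] [Membership M S]

@[simp] theorem rank_left (x y z a b c : M) : rank x y z a b c x = a := by simp [rank]

theorem rank_mid {x y : M} (hxy : x ≠ y) (z a b c : M) : rank x y z a b c y = b := by
  simp [rank, hxy.symm]

theorem rank_right {x y z : M} (hxz : x ≠ z) (hyz : y ≠ z) (a b c : M) :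
    rank x y z a b c z = c := by
  simp [rank, hxz.symm, hyz.symm]

variable [ModelRCA0 M S] [Nonempty S]

theorem RecF.rank (x y z a b c : M) : RecF S (rank x y z a b c) := by
  unfold SOArith.rank
  fun_prop

variable {V X A F E σ : S} (H : IsSociety V X A F E)

include H

theorem IsSociety.exists_third {x y : M} : ∃ z ∈ X, x ≠ z ∧ y ≠ z := by
  obtain ⟨a, b, c, ha, hb, hc, hab, hac, hbc⟩ := H.three
  by_cases h₁ : x ≠ a ∧ y ≠ a
  · exact ⟨a, ha, h₁⟩
  by_cases h₂ : x ≠ b ∧ y ≠ b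
  · exact ⟨b, hb, h₂⟩
  refine ⟨c, hc, ?_⟩
  by_cases h₃ : x = a
  · subst h₃
    refine ⟨hac, fun h => ?_⟩
    subst h
    exact h₂ ⟨hab, hbc.symm⟩
  · have hya : y = a := by tauto
    subst hya
    refine ⟨fun h => ?_, hac⟩
    subst h
    exact h₂ ⟨hbc.symm, hab⟩

theorem IsSociety.exists_opposed_profile {x y : M} (hx : x ∈ X) (hy : y ∈ X) (hxy : x ≠ y) (n : M) :
    ∃ i, ∀ v ∈ V, (pr n v ∈ A → SPref F i v x y) ∧ (¬ pr n v ∈ A → SPref F i v y x) := by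
  obtain ⟨z, hz, hxz, hyz⟩ := H.exists_third (x := x) (y := y)
  obtain ⟨e, he⟩ := H.exists_empty
  obtain ⟨q, hq⟩ := H.exists_profile
    (RecF.rank x y z 0 1 2) (RecF.rank x y z 0 2 1) (RecF.rank x y z 2 1 0) (RecF.rank x y z 1 0 2)
    ⟨y, hy, z, hz, by simp [rank_mid hxy, rank_right hxz hyz]⟩
    ⟨x, hx, z, hz, by simp [rank_right hxz hyz]⟩
    ⟨x, hx, y, hy, by simp [rank_mid hxy]⟩
    ⟨x, hx, y, hy, by simp [rank_mid hxy]⟩ ⟨x, hx, y, hy, by simp [rank_mid hxy]⟩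
    ⟨x, hx, z, hz, by simp [rank_right hxz hyz]⟩
    (n₁ := n) (n₂ := e) (n₃ := e) (fun v _ => he v) (fun v _ => he v) (fun v _ => he v)
  refine ⟨q, fun v hv => ⟨fun a => ?_, fun a => ?_⟩⟩
  · simp [((hq v hv).1 a).sPref hx hy, rank_mid hxy]
  · simp [((hq v hv).2.2.2 a (he v) (he v)).sPref hy hx, rank_mid hxy]

variable (hσ : IsSWF V X F σ)

include hσ

/-- Independence, for strict preferences. -/
theorem sSoc_of_agree {i j x y : M} (hx : x ∈ X) (hy : y ∈ X)
    (h : ∀ v ∈ V, (SPref F i v x y ↔ SPref F j v x y) ∧ (SPref F i v y x ↔ SPref F j v y x))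
    (hs : SSoc σ i x y) : SSoc σ j x y := by
  have total (i v : M) (hv : v ∈ V) : Pref F i v x y ∨ Pref F i v y x := by
    obtain ⟨r, hr, -⟩ := H.profile_fun i v hv
    obtain ⟨v', r', heq, -, hW⟩ := H.profile_mem _ _ hr
    obtain ⟨rfl, rfl⟩ := pr_inj.1 heq
    rw [H.pref_iff hr, H.pref_iff hr]
    exact hW.2.2.1 x y ⟨hx, hy⟩
  have hag := hσ.independence x y i j ⟨hx, hy, by
    rintro v a b ⟨hv, ha, hb⟩
    have h₁ := h v hv
    have hi := total i v hv
    have hj := total j v hv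
    simp only [SPref] at h₁
    rcases ha with rfl | rfl <;> rcases hb with rfl | rfl
    · simp [H.pref_refl hv hx]
    · tauto
    · tauto
    · simp [H.pref_refl hv hy]⟩
  rw [SSoc, hag x y (by simp), hag y x (by simp)] at hs
  exact hs

/-- By independence, one profile suffices for almost decisiveness. -/
theorem almostDecisive_of_sSoc {i x y n : M} (hx : x ∈ X) (hy : y ∈ X)
    (h : ∀ v ∈ V, (pr n v ∈ A → SPref F i v x y) ∧ (¬ pr n v ∈ A → SPref F i v y x))
    (hs : SSoc σ i x y) : AlmostDecisive V A F σ x y n := by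
  intro j hj
  refine sSoc_of_agree H hσ hx hy (fun v hv => ?_) hs
  have h₁ := h v hv
  have h₂ := hj v hv
  simp only [SPref] at h₁ h₂ ⊢
  tauto

/-- If `A_n` is almost decisive for `x`, `y`, then it is decisive for `x`, `z`: let `x < y < z` on
`A_n`, and `y < x`, `y < z` elsewhere. -/
theorem AlmostDecisive.expand_right {x y z n : M} (h : AlmostDecisive V A F σ x y n) (hx : x ∈ X)
    (hy : y ∈ X) (hz : z ∈ X) (hxy : x ≠ y) (hxz : x ≠ z) (hyz : y ≠ z) (i : M)
    (hi : ∀ v, pr n v ∈ A → SPref F i v x z) : SSoc σ i x z := by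
  obtain ⟨n₂, hn₂⟩ := H.exists_sPref_diff n i hx hz
  obtain ⟨n₃, hn₃⟩ := H.exists_sPref_diff n i hz hx
  have hV := H.sub
  obtain ⟨j, hj⟩ := H.exists_profile
    (RecF.rank x y z 0 1 2) (RecF.rank x y z 1 0 2) (RecF.rank x y z 2 0 1) (RecF.rank x y z 1 0 1)
    ⟨x, hx, y, hy, by simp [rank_mid hxy]⟩ ⟨x, hx, y, hy, by simp [rank_mid hxy]⟩
    ⟨x, hx, y, hy, by simp [rank_mid hxy]⟩
    ⟨x, hx, z, hz, by simp [rank_right hxz hyz]⟩ ⟨z, hz, x, hx, by simp [rank_right hxz hyz]⟩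
    ⟨x, hx, z, hz, by simp [rank_right hxz hyz]⟩
    (n₁ := n) (n₂ := n₂) (n₃ := n₃)
    (fun v hv hv' => ((hn₂ v (hV _ _ hv)).1 hv').2 hv)
    (fun v hv hv' => ((hn₃ v (hV _ _ hv)).1 hv').2 hv)
    (fun v hv hv' => by
      have h₁ := ((hn₂ v (hV _ _ hv)).1 hv).1
      have h₂ := ((hn₃ v (hV _ _ hv)).1 hv').1
      exact h₁.2 h₂.1)
  have key (v : M) (hv : v ∈ V) :
      ((pr n v ∈ A → SPref F j v x y) ∧ (¬ pr n v ∈ A → SPref F j v y x)) ∧ SPref F j v y z ∧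
        (SPref F j v x z ↔ SPref F i v x z) ∧ (SPref F j v z x ↔ SPref F i v z x) := by
    obtain ⟨h₁, h₂, h₃, h₄⟩ := hj v hv
    by_cases hn : pr n v ∈ A
    · have hr := h₁ hn
      have := hi v hn
      simp only [hr.sPref hx hy, hr.sPref hy hx, hr.sPref hy hz, hr.sPref hx hz, hr.sPref hz hx,
        rank_left, rank_mid hxy, rank_right hxz hyz, hn, this]
      have : ¬ SPref F i v z x := fun h' => this.2 h'.1
      simp [this]
    · by_cases h₂' : SPref F i v x z
      · have hr := h₂ ((hn₂ v hv).2 ⟨h₂', hn⟩)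
        simp only [hr.sPref hx hy, hr.sPref hy hx, hr.sPref hy hz, hr.sPref hx hz, hr.sPref hz hx,
          rank_left, rank_mid hxy, rank_right hxz hyz, hn, h₂']
        have : ¬ SPref F i v z x := fun h' => h₂'.2 h'.1
        simp [this]
      · by_cases h₃' : SPref F i v z x
        · have hr := h₃ ((hn₃ v hv).2 ⟨h₃', hn⟩)
          simp only [hr.sPref hx hy, hr.sPref hy hx, hr.sPref hy hz, hr.sPref hx hz,
            hr.sPref hz hx, rank_left, rank_mid hxy, rank_right hxz hyz, hn, h₂', h₃']
          simp
        · have hr := h₄ hn (fun h => h₂' ((hn₂ v hv).1 h).1) (fun h => h₃' ((hn₃ v hv).1 h).1)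
          simp only [hr.sPref hx hy, hr.sPref hy hx, hr.sPref hy hz, hr.sPref hx hz,
            hr.sPref hz hx, rank_left, rank_mid hxy, rank_right hxz hyz, hn, h₂', h₃']
          simp
  refine sSoc_of_agree H hσ hx hz (fun v hv => (key v hv).2.2) ?_
  exact hσ.sSoc_trans (h j fun v hv => (key v hv).1)
    (hσ.unanimity y z j ⟨hy, hz, fun v hv => (key v hv).2.1⟩)

/-- If `A_n` is almost decisive for `x`, `y`, then it is decisive for `z`, `y`: let `z < x < y` on
`A_n`, and `z < x`, `y < x` elsewhere. -/
theorem AlmostDecisive.expand_left {x y z n : M} (h : AlmostDecisive V A F σ x y n) (hx : x ∈ X)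
    (hy : y ∈ X) (hz : z ∈ X) (hxy : x ≠ y) (hxz : x ≠ z) (hyz : y ≠ z) (i : M)
    (hi : ∀ v, pr n v ∈ A → SPref F i v z y) : SSoc σ i z y := by
  obtain ⟨n₂, hn₂⟩ := H.exists_sPref_diff n i hz hy
  obtain ⟨n₃, hn₃⟩ := H.exists_sPref_diff n i hy hz
  have hV := H.sub
  obtain ⟨j, hj⟩ := H.exists_profile
    (RecF.rank x y z 1 2 0) (RecF.rank x y z 2 1 0) (RecF.rank x y z 2 0 1) (RecF.rank x y z 1 0 0)
    ⟨x, hx, y, hy, by simp [rank_mid hxy]⟩ ⟨x, hx, y, hy, by simp [rank_mid hxy]⟩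
    ⟨x, hx, y, hy, by simp [rank_mid hxy]⟩
    ⟨y, hy, z, hz, by simp [rank_mid hxy, rank_right hxz hyz]⟩
    ⟨y, hy, z, hz, by simp [rank_mid hxy, rank_right hxz hyz]⟩
    ⟨z, hz, y, hy, by simp [rank_mid hxy, rank_right hxz hyz]⟩
    (n₁ := n) (n₂ := n₂) (n₃ := n₃)
    (fun v hv hv' => ((hn₂ v (hV _ _ hv)).1 hv').2 hv)
    (fun v hv hv' => ((hn₃ v (hV _ _ hv)).1 hv').2 hv)
    (fun v hv hv' => by
      have h₁ := ((hn₂ v (hV _ _ hv)).1 hv).1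
      have h₂ := ((hn₃ v (hV _ _ hv)).1 hv').1
      exact h₁.2 h₂.1)
  have key (v : M) (hv : v ∈ V) :
      ((pr n v ∈ A → SPref F j v x y) ∧ (¬ pr n v ∈ A → SPref F j v y x)) ∧ SPref F j v z x ∧
        (SPref F j v z y ↔ SPref F i v z y) ∧ (SPref F j v y z ↔ SPref F i v y z) := by
    obtain ⟨h₁, h₂, h₃, h₄⟩ := hj v hv
    by_cases hn : pr n v ∈ A
    · have hr := h₁ hn
      have := hi v hn
      simp only [hr.sPref hx hy, hr.sPref hy hx, hr.sPref hy hz, hr.sPref hz hy, hr.sPref hz hx,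
        rank_left, rank_mid hxy, rank_right hxz hyz, hn, this]
      have : ¬ SPref F i v y z := fun h' => this.2 h'.1
      simp [this]
    · by_cases h₂' : SPref F i v z y
      · have hr := h₂ ((hn₂ v hv).2 ⟨h₂', hn⟩)
        simp only [hr.sPref hx hy, hr.sPref hy hx, hr.sPref hy hz, hr.sPref hz hy, hr.sPref hz hx,
          rank_left, rank_mid hxy, rank_right hxz hyz, hn, h₂']
        have : ¬ SPref F i v y z := fun h' => h₂'.2 h'.1
        simp [this]
      · by_cases h₃' : SPref F i v y z
        · have hr := h₃ ((hn₃ v hv).2 ⟨h₃', hn⟩)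
          simp only [hr.sPref hx hy, hr.sPref hy hx, hr.sPref hy hz, hr.sPref hz hy,
            hr.sPref hz hx, rank_left, rank_mid hxy, rank_right hxz hyz, hn, h₂', h₃']
          simp
        · have hr := h₄ hn (fun h => h₂' ((hn₂ v hv).1 h).1) (fun h => h₃' ((hn₃ v hv).1 h).1)
          simp only [hr.sPref hx hy, hr.sPref hy hx, hr.sPref hy hz, hr.sPref hz hy,
            hr.sPref hz hx, rank_left, rank_mid hxy, rank_right hxz hyz, hn, h₂', h₃']
          simp
  refine sSoc_of_agree H hσ hz hy (fun v hv => (key v hv).2.2) ?_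
  exact hσ.sSoc_trans (hσ.unanimity z x j ⟨hz, hx, fun v hv => (key v hv).2.1⟩)
    (h j fun v hv => (key v hv).1)

/-- A coalition which is almost decisive for one pair is decisive. -/
theorem AlmostDecisive.decisive {x y n : M} (h : AlmostDecisive V A F σ x y n) (hx : x ∈ X)
    (hy : y ∈ X) (hxy : x ≠ y) : Decisive X A F σ n := by
  have toAlmost {u w : M} (hd : ∀ i, (∀ v, pr n v ∈ A → SPref F i v u w) → SSoc σ i u w) :
      AlmostDecisive V A F σ u w n :=
    fun i hi => hd i fun v hv => (hi v (H.sub _ _ hv)).1 hv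
  have right {u w z : M} (ha : AlmostDecisive V A F σ u w n) (hu : u ∈ X) (hw : w ∈ X) (hz : z ∈ X)
      (huw : u ≠ w) (huz : u ≠ z) : AlmostDecisive V A F σ u z n := by
    by_cases hwz : w = z
    · rwa [← hwz]
    · exact toAlmost (ha.expand_right H hσ hu hw hz huw huz hwz)
  have left {u w z : M} (ha : AlmostDecisive V A F σ u w n) (hu : u ∈ X) (hw : w ∈ X) (hz : z ∈ X)
      (huw : u ≠ w) (hwz : w ≠ z) : AlmostDecisive V A F σ z w n := by
    by_cases huz : u = z
    · rwa [← huz]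
    · exact toAlmost (ha.expand_left H hσ hu hw hz huw huz hwz)
  have all {u w : M} (hu : u ∈ X) (hw : w ∈ X) (huw : u ≠ w) : AlmostDecisive V A F σ u w n := by
    obtain ⟨z, hz, hxz, hyz⟩ := H.exists_third (x := x) (y := y)
    by_cases huy : u = y
    · subst huy
      have h₁ := right h hx hu hz hxy hxz
      have h₂ := left h₁ hx hz hu hxz hyz.symm
      exact right h₂ hu hz hw hyz huw
    · exact right (left h hx hy hu hxy (Ne.symm huy)) hu hy hw huy huw
  rintro u w i ⟨hu, hw, hi⟩
  by_cases huw : u = w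
  · subst huw
    obtain ⟨j, hj⟩ := H.exists_opposed_profile hx hy hxy n
    have hempty (v : M) : ¬ pr n v ∈ A := fun hv => (hi v hv).2 (hi v hv).1
    have h₁ := h j hj
    have h₂ := hσ.unanimity y x j ⟨hy, hx, fun v hv => (hj v hv).2 (hempty v)⟩
    exact (h₁.2 h₂.1).elim
  · obtain ⟨z, hz, huz, hwz⟩ := H.exists_third (x := u) (y := w)
    exact (all hu hz huz).expand_right H hσ hu hz hw huz huw hwz.symm i hi

theorem decisive_iff {x y n : M} (hx : x ∈ X) (hy : y ∈ X) (hxy : x ≠ y) :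
    Decisive X A F σ n ↔ AlmostDecisive V A F σ x y n :=
  ⟨fun h i hi => h x y i ⟨hx, hy, fun v hv => (hi v (H.sub _ _ hv)).1 hv⟩,
    fun h => h.decisive H hσ hx hy hxy⟩

end Arrow

/-! ### The ultrafilter of decisive coalitions -/

section Ultrafilter

variable {M S : Type} [DiscreteSemiring M] [Membership M S] {V X A F E σ : S}

theorem IsSWF.decisive_of_univ (hσ : IsSWF V X F σ) {k : M} (hk : ∀ v, pr k v ∈ A ↔ v ∈ V) : Decisive X A F σ k :=
  fun x y i h => hσ.unanimity x y i ⟨h.1, h.2.1, fun v hv => h.2.2 v ((hk v).2 hv)⟩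

theorem IsSociety.not_decisive_of_empty (H : IsSociety V X A F E) {k : M} (hk : ∀ v, ¬ pr k v ∈ A) : ¬ Decisive X A F σ k := by
  intro h
  obtain ⟨x, -, -, hx, -⟩ := H.three
  have := h x x 0 ⟨hx, hx, fun v hv => (hk v hv).elim⟩
  exact this.2 this.1

theorem Decisive.mono {i j : M} (h : Decisive X A F σ i)
    (hij : ∀ v, pr i v ∈ A → pr j v ∈ A) : Decisive X A F σ j :=
  fun x y k hk => h x y k ⟨hk.1, hk.2.1, fun v hv => hk.2.2 v (hij v hv)⟩

variable [ModelRCA0 M S] [Nonempty S] (H : IsSociety V X A F E) (hσ : IsSWF V X F σ)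

include H hσ

/-- On `A_k = A_i ∩ A_j` let `x < y < z`, on `A_i \ A_j` let `z < x < y`, on `A_j \ A_i` let
`y < z < x`, and elsewhere `z < y < x`. -/
theorem Decisive.inter {i j k : M} (hi : Decisive X A F σ i) (hj : Decisive X A F σ j)
    (hk : ∀ v, pr k v ∈ A ↔ pr i v ∈ A ∧ pr j v ∈ A) : Decisive X A F σ k := by
  obtain ⟨x, y, z, hx, hy, hz, hxy, hxz, hyz⟩ := H.three
  obtain ⟨n₂, hn₂⟩ := H.exists_diff i j
  obtain ⟨n₃, hn₃⟩ := H.exists_diff j i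
  obtain ⟨q, hq⟩ := H.exists_profile
    (RecF.rank x y z 0 1 2) (RecF.rank x y z 1 2 0) (RecF.rank x y z 2 0 1) (RecF.rank x y z 2 1 0)
    ⟨x, hx, z, hz, by simp [rank_right hxz hyz]⟩ ⟨x, hx, z, hz, by simp [rank_right hxz hyz]⟩
    ⟨x, hx, z, hz, by simp [rank_right hxz hyz]⟩
    ⟨x, hx, y, hy, by simp [rank_mid hxy]⟩ ⟨x, hx, y, hy, by simp [rank_mid hxy]⟩
    ⟨y, hy, z, hz, by simp [rank_mid hxy, rank_right hxz hyz]⟩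
    (n₁ := k) (n₂ := n₂) (n₃ := n₃)
    (fun v hv hv' => ((hn₂ v).1 hv').2 ((hk v).1 hv).2)
    (fun v hv hv' => ((hn₃ v).1 hv').2 ((hk v).1 hv).1)
    (fun v hv hv' => ((hn₃ v).1 hv').2 ((hn₂ v).1 hv).1)
  have key (v : M) (hv : v ∈ V) : (pr i v ∈ A → SPref F q v x y) ∧ (pr j v ∈ A → SPref F q v y z) ∧
      (pr k v ∈ A → SPref F q v x z) ∧ (¬ pr k v ∈ A → SPref F q v z x) := by
    obtain ⟨h₁, h₂, h₃, h₄⟩ := hq v hv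
    rw [hk] at h₁ h₄ ⊢
    rw [hn₂] at h₂ h₄
    rw [hn₃] at h₃ h₄
    by_cases a : pr i v ∈ A <;> by_cases b : pr j v ∈ A
    · have hr := h₁ ⟨a, b⟩
      simp [hr.sPref hx hy, hr.sPref hy hz, hr.sPref hx hz, rank_mid hxy, rank_right hxz hyz, a, b]
    · have hr := h₂ ⟨a, b⟩
      simp [hr.sPref hx hy, hr.sPref hz hx, rank_mid hxy, rank_right hxz hyz, a, b]
    · have hr := h₃ ⟨b, a⟩
      simp [hr.sPref hy hz, hr.sPref hz hx, rank_mid hxy, rank_right hxz hyz, a, b]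
    · have hr := h₄ (fun h => a h.1) (fun h => a h.1) (fun h => b h.1)
      simp [hr.sPref hz hx, rank_right hxz hyz, a, b]
  have hV := H.sub
  refine (almostDecisive_of_sSoc H hσ hx hz (fun v hv => (key v hv).2.2)
    (hσ.sSoc_trans (y := y) ?_ ?_)).decisive H hσ hx hz hxz
  · exact hi x y q ⟨hx, hy, fun v hv => (key v (hV _ _ hv)).1 hv⟩
  · exact hj y z q ⟨hy, hz, fun v hv => (key v (hV _ _ hv)).2.1 hv⟩

/-- If `A_i` is not decisive, then `y ≲ x` holds for society as soon as `x < y` exactly on `A_i` and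
`y < x` elsewhere. Let `x < z < y` on `A_i` and `y < x < z` elsewhere. -/
theorem decisive_or_decisive_compl {i j : M} (hj : ∀ v, pr j v ∈ A ↔ v ∈ V ∧ ¬ pr i v ∈ A) :
    Decisive X A F σ i ∨ Decisive X A F σ j := by
  refine or_iff_not_imp_left.2 fun hi => ?_
  obtain ⟨x, y, z, hx, hy, hz, hxy, hxz, hyz⟩ := H.three
  obtain ⟨e, he⟩ := H.exists_empty
  obtain ⟨q, hq⟩ := H.exists_profile
    (RecF.rank x y z 0 2 1) (RecF.rank x y z 0 1 2) (RecF.rank x y z 2 1 0) (RecF.rank x y z 1 0 2)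
    ⟨y, hy, z, hz, by simp [rank_mid hxy, rank_right hxz hyz]⟩
    ⟨x, hx, z, hz, by simp [rank_right hxz hyz]⟩
    ⟨x, hx, y, hy, by simp [rank_mid hxy]⟩
    ⟨x, hx, y, hy, by simp [rank_mid hxy]⟩ ⟨x, hx, y, hy, by simp [rank_mid hxy]⟩
    ⟨x, hx, z, hz, by simp [rank_right hxz hyz]⟩
    (n₁ := i) (n₂ := e) (n₃ := e) (fun v _ => he v) (fun v _ => he v) (fun v _ => he v)
  have key (v : M) (hv : v ∈ V) : ((pr i v ∈ A → SPref F q v x y) ∧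
      (¬ pr i v ∈ A → SPref F q v y x)) ∧ SPref F q v x z ∧
      (pr j v ∈ A → SPref F q v y z) ∧ (¬ pr j v ∈ A → SPref F q v z y) := by
    obtain ⟨h₁, -, -, h₄⟩ := hq v hv
    rw [hj]
    by_cases a : pr i v ∈ A
    · have hr := h₁ a
      simp [hr.sPref hx hy, hr.sPref hx hz, hr.sPref hz hy, rank_mid hxy, rank_right hxz hyz, a]
    · have hr := h₄ a (he v) (he v)
      simp [hr.sPref hy hx, hr.sPref hx hz, hr.sPref hy hz, rank_mid hxy, rank_right hxz hyz, a, hv]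
  have hns : ¬ SSoc σ q x y := fun hs => hi
    ((almostDecisive_of_sSoc H hσ hx hy (fun v hv => (key v hv).1) hs).decisive H hσ hx hy hxy)
  have hyx : Soc σ q y x := by
    rcases hσ.soc_total q hx hy with h | h
    · by_contra h'
      exact hns ⟨h, h'⟩
    · exact h
  exact (almostDecisive_of_sSoc H hσ hy hz (fun v hv => (key v hv).2.2)
    (hσ.sSoc_of_soc_of_sSoc hyx (hσ.unanimity x z q ⟨hx, hz, fun v hv => (key v hv).2.1⟩))).decisive
    H hσ hy hz hyz

/-- The set of (indices of) decisive coalitions exists. Fix `x ≠ y` and a permutation of the weak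
orders whose first two entries have `x < y` and `y < x`. Then `A_n` is decisive iff `x <_{σ(i)} y`
for the profile `f_i` which the embedding assigns to this permutation and the sequence `⟨n, 0⟩`;
this is a `Δ⁰₁` condition. -/
theorem exists_set_decisive : ∃ U : S, ∀ n, n ∈ U ↔ Decisive X A F σ n := by
  obtain ⟨x, y, z, hx, hy, hz, hxy, hxz, hyz⟩ := H.three
  obtain ⟨L, hL⟩ := H.finite
  obtain ⟨R₁, w₁, hR₁⟩ := exists_isWO_of_rank hL (RecF.rank (S := S) x y z 0 1 2)
  obtain ⟨R₂, w₂, hR₂⟩ := exists_isWO_of_rank hL (RecF.rank (S := S) x y z 1 0 2)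
  have ne : R₁ ≠ R₂ := by
    rintro rfl
    have := (hR₁ x hx y hy).symm.trans (hR₂ x hx y hy)
    simp [rank_mid hxy] at this
  let g : M → M := fun i => if i = 0 then R₁ else R₂
  have g0 : g 0 = R₁ := by simp [g]
  have g1 : g 1 = R₂ := by simp [g]
  obtain ⟨p, l, hp, hl, hpg⟩ := exists_isPerm hL (g := g) (m := 2) (by fun_prop)
    (by
      intro i hi
      rcases lt_two_iff.1 hi with rfl | rfl
      · rwa [g0]
      · rwa [g1])
    (by
      intro i hi j hj hij
      rcases lt_two_iff.1 hi with rfl | rfl <;> rcases lt_two_iff.1 hj with rfl | rfl <;>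
        simp only [g0, g1] at hij <;>
        first | rfl | exact absurd hij ne | exact absurd hij.symm ne)
  -- `w = (s, i, r)` consists of the sequence `s = ⟨n, 0⟩`, the profile `i` and its value `r = σ(i)`
  let T (n w : M) : Prop := IsCode (π₁ w) ∧ (∀ u, FMem u (π₁ w) → u = pr 0 n ∨ u = pr 1 0) ∧
    FMem (pr 0 n) (π₁ w) ∧ FMem (pr 1 0) (π₁ w) ∧ pr (pr p (π₁ w)) (π₁ (π₂ w)) ∈ E ∧
    pr (π₁ (π₂ w)) (π₂ (π₂ w)) ∈ σ
  let D (w : M) : Prop := FMem (pr x y) (π₂ (π₂ w)) ∧ ¬ FMem (pr y x) (π₂ (π₂ w))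
  have two : ((1 : M) + 1 = 2) := by norm_num
  have seq_of {s n : M} (hs : IsCode s) (h : ∀ u, FMem u s → u = pr 0 n ∨ u = pr 1 0)
      (h0 : FMem (pr 0 n) s) (h1 : FMem (pr 1 0) s) : IsSeq s 2 := by
    refine ⟨hs, fun u hu => ?_, fun i hi => ?_⟩
    · rcases h u hu with rfl | rfl
      · exact ⟨_, _, rfl, by norm_num⟩
      · exact ⟨_, _, rfl, by norm_num⟩
    · rcases lt_two_iff.1 hi with rfl | rfl
      · exact ⟨n, h0, fun y' hy' => by simpa using h _ hy'⟩
      · exact ⟨0, h1, fun y' hy' => by simpa using h _ hy'⟩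
  have hex (n : M) : ∃ w, T n w := by
    obtain ⟨s, hs, hsD⟩ := exists_code (S := S) (D := fun u => u = pr 0 n ∨ u = pr 1 0)
      (K := pr 0 n + pr 1 0 + 1) (by fun_prop) (by
        rintro u (rfl | rfl)
        · exact lt_succ_iff_le.2 le_self_add
        · exact lt_succ_iff_le.2 le_add_self)
    have h0 := (hsD _).2 (.inl rfl)
    have h1 := (hsD _).2 (.inr rfl)
    obtain ⟨i, hi, -⟩ := H.mixed p l s 2
      ⟨hp, seq_of hs (fun u => (hsD u).1) h0 h1, by norm_num, hl⟩
    obtain ⟨r, hr, -⟩ := hσ.total i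
    refine ⟨pr s (pr i r), ?_⟩
    simp only [T, π₁_pr, π₂_pr]
    exact ⟨hs, fun u => (hsD u).1, h0, h1, hi, hr⟩
  have hT (n w : M) (h : T n w) : Decisive X A F σ n ↔ D w := by
    obtain ⟨hs, hsu, h0, h1, hE, hr⟩ := h
    simp only [D]
    generalize π₁ w = s at *
    generalize π₁ (π₂ w) = i at *
    generalize π₂ (π₂ w) = r at *
    have hseq := seq_of hs hsu h0 h1
    obtain ⟨i', -, hiu, hi⟩ := H.mixed p l s 2 ⟨hp, hseq, by norm_num, hl⟩
    rw [← hiu i hE] at hi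
    have hin (j v : M) : InPart A s 2 j v ↔ j = 0 ∧ pr n v ∈ A := by
      rw [InPart, succ_lt_two_iff]
      refine and_congr_right fun hj => ⟨fun ⟨m, hm, h⟩ => ?_, fun h => ⟨n, ?_, h⟩⟩
      · rw [hj] at hm
        rwa [hseq.unique h0 hm]
      · rwa [hj]
    have hpat (v : M) (hv : v ∈ V) :
        (pr n v ∈ A → SPref F i v x y) ∧ (¬ pr n v ∈ A → SPref F i v y x) := by
      constructor
      · intro hn
        obtain ⟨q, hq, hiq⟩ := (hi v hv).1 0
          ⟨(hin _ _).2 ⟨rfl, hn⟩, fun j hj => ((hin _ _).1 hj).1⟩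
        obtain rfl : q = R₁ := (hp.1.unique hq (hpg 0 (by norm_num))).trans g0
        rw [SPref, H.pref_iff hiq, H.pref_iff hiq, hR₁ x hx y hy, hR₁ y hy x hx]
        simp [rank_mid hxy]
      · intro hn
        obtain ⟨j, q, hj, hq, hiq⟩ := (hi v hv).2 fun ⟨j, hj, _⟩ => hn ((hin _ _).1 hj).2
        rw [← two] at hj
        obtain rfl := add_right_cancel hj
        obtain rfl : q = R₂ := (hp.1.unique hq (hpg 1 (by norm_num))).trans g1
        rw [SPref, H.pref_iff hiq, H.pref_iff hiq, hR₂ x hx y hy, hR₂ y hy x hx]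
        simp [rank_mid hxy]
    have hsoc (a b : M) : Soc σ i a b ↔ FMem (pr a b) r := by
      obtain ⟨r₀, hr₀, hu⟩ := hσ.total i
      refine ⟨fun ⟨r', hr', h⟩ => ?_, fun h => ⟨r, hr, h⟩⟩
      rwa [hu r hr, ← hu r' hr']
    rw [decisive_iff H hσ hx hy hxy, ← hsoc, ← hsoc]
    exact ⟨fun h => h i hpat, almostDecisive_of_sSoc H hσ hx hy hpat⟩
  obtain ⟨U, hU⟩ := Rec.of_delta (S := S) (P := Decisive X A F σ) (Q := fun n w => T n w ∧ D w)
    (R := fun n w => T n w → D w) (by simp only [T, D]; fun_prop) (by simp only [T, D]; fun_prop)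
    (fun n => ⟨fun h => (hex n).elim fun w hw => ⟨w, hw, (hT n w hw).1 h⟩,
      fun ⟨w, hw, h⟩ => (hT n w hw).2 h⟩)
    (fun n => ⟨fun h w hw => (hT n w hw).1 h, fun h => (hex n).elim fun w hw =>
      (hT n w hw).2 (h w hw)⟩)
  exact ⟨U, hU⟩

/-- The decisive coalitions include a singleton iff there is a dictator. -/
theorem principal_iff : (∃ k d : M, Decisive X A F σ k ∧ ∀ v, pr k v ∈ A ↔ v = d) ↔
    ¬ ∀ v, v ∈ V → ∃ i x y, x ∈ X ∧ y ∈ X ∧ SPref F i v x y ∧ Soc σ i y x := by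
  constructor
  · rintro ⟨k, d, hk, hd⟩ h
    obtain ⟨i, x, y, hx, hy, hp, hs⟩ := h d (H.sub k d ((hd d).2 rfl))
    refine (hk x y i ⟨hx, hy, fun v hv => ?_⟩).2 hs
    rwa [(hd v).1 hv]
  · intro h
    push Not at h
    obtain ⟨d, hd, h⟩ := h
    obtain ⟨k, hk⟩ := H.singleton d hd
    refine ⟨k, d, fun x y i ⟨hx, hy, hi⟩ => ?_, hk⟩
    have hs := h i x y hx hy (hi d ((hk d).2 rfl))
    exact ⟨(hσ.soc_total i hx hy).resolve_right hs, hs⟩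

end Ultrafilter

/-! ### The meaning of the formalized notions -/

section Meaning

variable {M S : Type} [DiscreteSemiring M] [Membership M S] (v : ℕ → M) (e : ℕ → S)

@[simp] theorem val_triple (a b c : Tm) :
    (triple a b c).val v = pr (a.val v) (pr (b.val v) (c.val v)) := rfl

@[simp] theorem sat_dvd (s t : Tm) : (dvd s t).Sat v e ↔ s.val v ∣ t.val v := by
  simp [dvd, Dvd.dvd, eq_comm]

@[simp] theorem sat_le (s t : Tm) : (le s t).Sat v e ↔ s.val v ≤ t.val v := by
  simp [le, le_iff_lt_or_eq]

@[simp] theorem sat_isTriple (c : Tm) : (isTriple c).Sat v e ↔ IsTriple (c.val v) := by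
  simp [isTriple, IsTriple]

@[simp] theorem sat_fmem (i c : Tm) : (fmem i c).Sat v e ↔ FMem (i.val v) (c.val v) := by
  simp [fmem, FMem]

@[simp] theorem sat_isCode (c : Tm) : (isCode c).Sat v e ↔ IsCode (c.val v) := by
  simp [isCode, IsCode]

@[simp] theorem sat_isSeq (s l : Tm) : (isSeq s l).Sat v e ↔ IsSeq (s.val v) (l.val v) := by
  simp [isSeq, IsSeq]

@[simp] theorem sat_seqVal (s i y : Tm) :
    (seqVal s i y).Sat v e ↔ FMem (pr (i.val v) (y.val v)) (s.val v) := by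
  simp [seqVal]

@[simp] theorem sat_rel (r x y : Tm) :
    (rel r x y).Sat v e ↔ FMem (pr (x.val v) (y.val v)) (r.val v) := by
  simp [rel]

@[simp] theorem sat_isWO (X : ℕ) (r : Tm) : (isWO X r).Sat v e ↔ IsWO (e X) (r.val v) := by
  simp [isWO, IsWO]

@[simp] theorem sat_inA (A : ℕ) (n w : Tm) :
    (inA A n w).Sat v e ↔ pr (n.val v) (w.val v) ∈ e A := by
  simp [inA]

@[simp] theorem sat_pref (F : ℕ) (i w x y : Tm) :
    (pref F i w x y).Sat v e ↔ Pref (e F) (i.val v) (w.val v) (x.val v) (y.val v) := by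
  simp [pref, Pref]

@[simp] theorem sat_spref (F : ℕ) (i w x y : Tm) :
    (spref F i w x y).Sat v e ↔ SPref (e F) (i.val v) (w.val v) (x.val v) (y.val v) := by
  simp [spref, SPref]

@[simp] theorem sat_soc (σ : ℕ) (i x y : Tm) :
    (soc σ i x y).Sat v e ↔ Soc (e σ) (i.val v) (x.val v) (y.val v) := by
  simp [soc, Soc]

@[simp] theorem sat_ssoc (σ : ℕ) (i x y : Tm) :
    (ssoc σ i x y).Sat v e ↔ SSoc (e σ) (i.val v) (x.val v) (y.val v) := by
  simp [ssoc, SSoc]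

@[simp] theorem sat_isPerm (X : ℕ) (p l : Tm) :
    (isPerm X p l).Sat v e ↔ IsPerm (e X) (p.val v) (l.val v) := by
  simp [isPerm, IsPerm]

@[simp] theorem sat_isQPart (s k l : Tm) : (isQPart s k l).Sat v e ↔
    IsSeq (s.val v) (k.val v) ∧ 1 ≤ k.val v ∧ k.val v ≤ l.val v := by
  simp [isQPart]

@[simp] theorem sat_inPart (A : ℕ) (s k i w : Tm) : (inPart A s k i w).Sat v e ↔
    InPart (e A) (s.val v) (k.val v) (i.val v) (w.val v) := by
  simp [inPart, InPart]

@[simp] theorem sat_onlyPart (A : ℕ) (s k i w : Tm) : (onlyPart A s k i w).Sat v e ↔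
    OnlyPart (e A) (s.val v) (k.val v) (i.val v) (w.val v) := by
  simp [onlyPart, OnlyPart]

@[simp] theorem sat_isMixedAt (A F : ℕ) (p s k n w : Tm) : (isMixedAt A F p s k n w).Sat v e ↔
    IsMixedAt (e A) (e F) (p.val v) (s.val v) (k.val v) (n.val v) (w.val v) := by
  simp [isMixedAt, IsMixedAt]

@[simp] theorem sat_decisive (X A F σ : ℕ) (n : Tm) : (decisive X A F σ n).Sat v e ↔
    Decisive (e X) (e A) (e F) (e σ) (n.val v) := by
  simp [decisive, Decisive, sprefOn]

theorem exists_isSociety_of_sat {V X A F : ℕ} (h : (isSociety V X A F).Sat v e) :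
    ∃ E, IsSociety (e V) (e X) (e A) (e F) E := by
  simp only [isSociety, sat_and] at h
  obtain ⟨h₁, h₂, h₃, h₄, h₅, h₆, h₇⟩ := h
  simp only [isQPEmbedded, sat_exS, sat_and] at h₇
  obtain ⟨E, -, h₇⟩ := h₇
  simp only [isAtomicAlgebra, sat_and] at h₄
  obtain ⟨a₁, a₂, a₃, a₄, a₅, a₆⟩ := h₄
  simp only [isProfileSeq, sat_and] at h₅
  simp only [isUniformlyMeasurable, sat_exS, sat_and] at h₆
  obtain ⟨μ, -, h₆⟩ := h₆
  refine ⟨E, ?_, ?_, ?_, ?_, ?_, ?_, ?_, ?_, ?_, ?_, ?_, ?_, ?_⟩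
  · simpa using h₁
  · simpa using h₂
  · simpa using h₃
  · simpa using a₁
  · simpa [eqV] using a₂
  · simpa [eqUnion] using a₃
  · simpa [eqInter] using a₄
  · simpa [eqCompl] using a₅
  · simpa [eqSingleton] using a₆
  · simpa using h₅.1
  · simpa using h₅.2
  · intro i x y hxy
    simp only [sat_alls_three, sat_imp] at h₆
    have := h₆ i x y (by simpa using hxy)
    simp only [sat_ex, sat_and] at this
    obtain ⟨k, -, -, hk⟩ := this
    exact ⟨k, by simpa using hk⟩
  · intro p l s k hp
    simp only [sat_alls_four, sat_imp] at h₇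
    have := h₇ p l s k (by simpa using hp)
    simpa using this

theorem isSWF_of_sat {V X F σ : ℕ} (h : (isSWF V X F σ).Sat v e) :
    IsSWF (e V) (e X) (e F) (e σ) := by
  simp only [isSWF, isFunToW, sat_and] at h
  obtain ⟨⟨h₁, h₂⟩, h₃, h₄⟩ := h
  refine ⟨?_, ?_, ?_, ?_⟩
  · simpa using h₁
  · simpa using h₂
  · simpa [unanimity] using h₃
  · intro x y i j hxy
    simp only [independence, sat_alls_four, sat_imp] at h₄
    have := h₄ x y i j (by simpa [profilesAgreeOn] using hxy)
    simpa [socAgreeOn] using this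

theorem sat_KS [ModelRCA0 M S] [Nonempty S] : KS.Sat v e := by
  suffices h : ∀ e : ℕ → S, (isSociety 4 3 2 1 ⋏ isSWF 4 3 1 0 ⟹
      .exS (.all (x0 ∊ 0 ⟺ decisive 4 3 2 1 x0) ⋏
        isUltrafilter 5 3 0 ⋏ (isPrincipal 3 0 ⟺ dictatorial 5 4 2 1))).Sat v e from
    fun _ _ _ _ _ => h _
  intro e
  simp only [sat_imp, sat_and, sat_exS]
  rintro ⟨hs, hσ⟩
  obtain ⟨E, H⟩ := exists_isSociety_of_sat v e hs
  have hσ := isSWF_of_sat v e hσ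
  obtain ⟨U, hU⟩ := exists_set_decisive H hσ
  refine ⟨U, by simpa using hU, ?_, ?_⟩
  · simp only [isUltrafilter, eqV, eqEmpty, subA, eqInter, eqCompl, sat_and]
    refine ⟨?_, ?_, ?_, ?_, ?_⟩
    · simpa [hU] using fun k => hσ.decisive_of_univ
    · simpa [hU] using fun k => H.not_decisive_of_empty
    · simpa [hU] using fun i j h h' => Decisive.mono h h'
    · simpa [hU] using fun i j k hi hj hk => Decisive.inter H hσ hi hj hk
    · simpa [hU] using fun i j h => decisive_or_decisive_compl H hσ h
  · have := principal_iff H hσ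
    simpa [isPrincipal, eqSingleton, dictatorial, nonDictatorial, hU] using this

end Meaning

end SOArith

theorem theorem4p4 : SOArith.Provable SOArith.RCA0 SOArith.KS :=
  SOArith.provable_RCA0_of_models fun _ _ _ _ _ _ v e => SOArith.sat_KS v e
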